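/- **Setting.** Let $\alpha,\beta,\gamma>0$ with $\gamma^2-\alpha\beta>0$, and put $e^1=(1,0)$, $e^2=(0,1)$, $e^3=(\tfrac12,\tfrac12)$. The mid-edges of $\mathbb Z^2$ are $\mathbb M=\big((\mathbb Z+\tfrac12)\times\mathbb Z\big)\sqcup\big(\mathbb Z\times(\mathbb Z+\tfrac12)\big)$; those in the first set are black, $c(x)=B$, those in the second are white, $c(x)=W$. Let $\mathbb M_n$ be the mid-edges of the torus $\mathbb T_n=(\mathbb Z/n)^2$, i.e. $\mathbb M$ modulo $n$ in each coordinate. A generalised snake configuration on $\mathbb M_n$ (resp. $\mathbb M$) is a permutation $\bar\rho$ with $\bar\rho(x)\in\{x,x+e^3,x+e^1\}$ for black $x$ and $\bar\rho(x)\in\{x,x+e^3,x+e^2\}$ for white $x$. Write $\mathcal{GS}_n$ (resp. $\mathcal{GS}$) for the set of these. For $\bar\rho\in\mathcal{GS}_n$ let $A,B,C$ be the numbers of $x\in\mathbb M_n$ with $\bar\rho(x)-x$ equal to $e^1,e^2,e^3$, and let $S$ be the number of crossings, i.e. of $v\in\mathbb T_n$ with $\bar\rho(v-\frac12e^1)=v+\frac12e^1$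 and $\bar\rho(v-\frac12e^2)=v+\frac12e^2$. Put $$\bar w(\bar\rho)=(-1)^{S}\alpha^{A}\beta^{B}\gamma^{C},\qquad Z_n=\sum_{\bar\rho\in\mathcal{GS}_n}\bar w(\bar\rho),\qquad P_n(\bar\rho)=\bar w(\bar\rho)/Z_n .$$ Via $n$-periodic extension of configurations, $P_n$ is regarded as a signed measure on $\mathcal{GS}$. A cylinder event is a subset of $\mathcal{GS}$ that depends on the values of $\bar\rho$ at finitely many mid-edges only; the cylinder events form an algebra. By a signed measure on cylinder events we mean a real-valued function on this algebra that is countably additive on it. Let $K_{00}(x,y)=1$ if $y=x$; $\alpha$ if $y=x+e^1$ and $x$ is black; $\beta$ if $y=x+e^2$ and $x$ is white; $\gamma$ if $y=x+e^3$; and $0$ otherwise. For $|w_1|=|w_2|=1$ let $$M(w_1,w_2)=\begin{pmatrix}1+\alpha w_1&\gamma w_1^{1/2}w_2^{1/2}\\ \gamma w_1^{1/2}w_2^{1/2}&1+\beta w_2\end{pmatrix}$$ with rows and columns labelled $B,W$, where $w^{1/2}$ has argument in $[0,\pi)$ and $w^{m/2}=(w^{1/2})^m$ for $m\in\mathbb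 Z$. For $x,y\in\mathbb M$ let $$L(x,y)=\oint\!\oint_{|w_1|=|w_2|=1}\frac{dw_1}{2\pi i w_1}\frac{dw_2}{2\pi i w_2}\,w_1^{y_1-x_1}w_2^{y_2-x_2}\big[M(w_1,w_2)^{-1}\big]_{c(x),c(y)} .$$ **Theorem 4.1.** $Z_n>0$ for all $n\ge2$, so that $P_n$ is well defined, and the integrand of $L(x,y)$ is absolutely integrable over the torus $|w_1|=|w_2|=1$ for all $x,y\in\mathbb M$. As $n\to\infty$, the signed measures $P_n$ converge weakly, in the sense of finite-coordinate projections, to a signed probability measure $P$ on $\mathcal{GS}$: there is a signed measure $P$ on cylinder events with $P(\mathcal{GS})=1$ and $P_n(E)\to P(E)$ for every cylinder event $E$. Its correlations are as follows. Let $k\ge0$ and $x^1,\dots,x^k,y^1,\dots,y^k\in\mathbb M$ be such that $y^i-x^i\in\{(0,0),e^1,e^2,e^3\}$ for every $i$ and the pairs $(x^1,y^1),\dots,(x^k,y^k)$ are distinct. Then $$P\Big(\bigcap_{i=1}^k\{\bar\rho(x^i)=y^i\}\Big)=\Big(\prod_{i=1}^kK_{00}(x^i,y^i)\Big)\det_{i,j=1}^{k}L(x^i,y^j).$$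 -/

import Mathlib

open Filter Topology

/-- Colours of mid-edges: midpoints of horizontal edges are black, of vertical edges white. -/
inductive Colour
  | B
  | W
  deriving DecidableEq

instance : Fintype Colour := ⟨{Colour.B, Colour.W}, fun c => by cases c <;> decide⟩

/-- The mid-edges of the square lattice with coordinates in `R`, where `R = ℤ` gives the lattice
`ℤ²` and `R = ZMod n` the discrete `n × n` torus. The triple `(B, a, b)` is the midpoint
`(a + 1/2, b)` of the horizontal edge leaving `(a, b)` to the east, and `(W, a, b)` is the midpoint
`(a, b + 1/2)` of the vertical edge leaving `(a, b)` to the north. -/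
abbrev MidEdge (R : Type) := Colour × R × R

namespace MidEdge

variable {R : Type} [AddCommGroupWithOne R]

/-- `x ↦ x + e¹`, with `e¹ = (1, 0)`. -/
def addE1 (x : MidEdge R) : MidEdge R := (x.1, x.2.1 + 1, x.2.2)

/-- `x ↦ x + e²`, with `e² = (0, 1)`. -/
def addE2 (x : MidEdge R) : MidEdge R := (x.1, x.2.1, x.2.2 + 1)

/-- `x ↦ x + e³`, with `e³ = (1/2, 1/2)`: it takes the black `(a + 1/2, b)` to the white
`(a + 1, b + 1/2)` and the white `(a, b + 1/2)` to the black `(a + 1/2, b + 1)`. -/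
def addE3 : MidEdge R → MidEdge R
  | (Colour.B, a, b) => (Colour.W, a + 1, b)
  | (Colour.W, a, b) => (Colour.B, a, b + 1)

/-- The straight step: `x + e¹` for black `x`, and `x + e²` for white `x`. -/
def straight (x : MidEdge R) : MidEdge R :=
  match x.1 with
  | Colour.B => addE1 x
  | Colour.W => addE2 x

/-- The mid-edge immediately west of the vertex `v`. -/
def west (v : R × R) : MidEdge R := (Colour.B, v.1 - 1, v.2)

/-- The mid-edge immediately east of the vertex `v`. -/
def east (v : R × R) : MidEdge R := (Colour.B, v.1, v.2)

/-- The mid-edge immediately south of the vertex `v`. -/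
def south (v : R × R) : MidEdge R := (Colour.W, v.1, v.2 - 1)

/-- The mid-edge immediately north of the vertex `v`. -/
def north (v : R × R) : MidEdge R := (Colour.W, v.1, v.2)

/-- Twice the first coordinate of a mid-edge of `ℤ²`. -/
def twice1 (x : MidEdge ℤ) : ℤ :=
  match x.1 with
  | Colour.B => 2 * x.2.1 + 1
  | Colour.W => 2 * x.2.1

/-- Twice the second coordinate of a mid-edge of `ℤ²`. -/
def twice2 (x : MidEdge ℤ) : ℤ :=
  match x.1 with
  | Colour.B => 2 * x.2.2
  | Colour.W => 2 * x.2.2 + 1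

/-- Reduction modulo `n`, from the mid-edges of `ℤ²` to those of the torus. -/
def toTorus (n : ℕ) (x : MidEdge ℤ) : MidEdge (ZMod n) := (x.1, (x.2.1 : ZMod n), (x.2.2 : ZMod n))

end MidEdge

/-- A permutation `ρ` of the mid-edges is a generalised snake configuration if `ρ x` is one of
`x`, `x + e³` and the straight step of `x`, for all `x`. -/
def IsGenSnake {R : Type} [AddCommGroupWithOne R] (ρ : Equiv.Perm (MidEdge R)) : Prop :=
  ∀ x, ρ x = x ∨ ρ x = x.addE3 ∨ ρ x = x.straight

/-- The set of generalised snake configurations. -/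
abbrev GenSnake (R : Type) [AddCommGroupWithOne R] := {ρ : Equiv.Perm (MidEdge R) // IsGenSnake ρ}

section Torus

variable (n : ℕ) [NeZero n]

noncomputable instance : Fintype (GenSnake (ZMod n)) := Fintype.ofFinite _

/-- The number of east steps. -/
def numE1 (ρ : GenSnake (ZMod n)) : ℕ :=
  (Finset.univ.filter fun x : MidEdge (ZMod n) => ρ.1 x = x.addE1).card

/-- The number of north steps. -/
def numE2 (ρ : GenSnake (ZMod n)) : ℕ :=
  (Finset.univ.filter fun x : MidEdge (ZMod n) => ρ.1 x = x.addE2).card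

/-- The number of diagonal steps. -/
def numE3 (ρ : GenSnake (ZMod n)) : ℕ :=
  (Finset.univ.filter fun x : MidEdge (ZMod n) => ρ.1 x = x.addE3).card

/-- The number of crossings. -/
def numCrossings (ρ : GenSnake (ZMod n)) : ℕ :=
  (Finset.univ.filter fun v : ZMod n × ZMod n =>
    ρ.1 (MidEdge.west v) = MidEdge.east v ∧ ρ.1 (MidEdge.south v) = MidEdge.north v).card

/-- The signed weight of a generalised snake configuration on the torus. -/
def snakeWeight (α β γ : ℝ) (ρ : GenSnake (ZMod n)) : ℝ :=
  (-1) ^ numCrossings n ρ * α ^ numE1 n ρ * β ^ numE2 n ρ * γ ^ numE3 n ρ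

/-- The signed partition function. -/
noncomputable def snakePartition (α β γ : ℝ) : ℝ :=
  ∑ ρ : GenSnake (ZMod n), snakeWeight n α β γ ρ

/-- The signed Boltzmann measure `P_n` on generalised snake configurations on the torus. -/
noncomputable def snakeBoltzmann (α β γ : ℝ) (ρ : GenSnake (ZMod n)) : ℝ :=
  snakeWeight n α β γ ρ / snakePartition n α β γ

end Torus

/-- The map underlying the periodic extension to `ℤ²` of a generalised snake configuration on the
torus: every mid-edge of `ℤ²` makes the step that its reduction modulo `n` makes. -/
def periodicExtFun (n : ℕ) (σ : GenSnake (ZMod n)) (x : MidEdge ℤ) : MidEdge ℤ :=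
  if σ.1 (x.toTorus n) = x.toTorus n then x
  else if σ.1 (x.toTorus n) = (x.toTorus n).addE3 then x.addE3
  else x.straight

theorem toTorus_addE3 (n : ℕ) (x : MidEdge ℤ) : x.addE3.toTorus n = (x.toTorus n).addE3 := by
  obtain ⟨c, a, b⟩ := x
  cases c <;> simp [MidEdge.addE3, MidEdge.toTorus]

theorem toTorus_straight (n : ℕ) (x : MidEdge ℤ) :
    x.straight.toTorus n = (x.toTorus n).straight := by
  obtain ⟨c, a, b⟩ := x
  cases c <;> simp [MidEdge.straight, MidEdge.addE1, MidEdge.addE2, MidEdge.toTorus]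

theorem addE3_bijective (R : Type) [AddCommGroupWithOne R] :
    Function.Bijective (MidEdge.addE3 (R := R)) := by
  constructor
  · rintro ⟨c, a, b⟩ ⟨c', a', b'⟩ h
    cases c <;> cases c' <;> simp_all [MidEdge.addE3]
  · rintro ⟨c, a, b⟩
    cases c
    · exact ⟨(Colour.W, a, b - 1), by simp [MidEdge.addE3]⟩
    · exact ⟨(Colour.B, a - 1, b), by simp [MidEdge.addE3]⟩

theorem straight_bijective (R : Type) [AddCommGroupWithOne R] :
    Function.Bijective (MidEdge.straight (R := R)) := by
  constructor
  · rintro ⟨c, a, b⟩ ⟨c', a', b'⟩ h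
    cases c <;> cases c' <;> simp_all [MidEdge.straight, MidEdge.addE1, MidEdge.addE2]
  · rintro ⟨c, a, b⟩
    cases c
    · exact ⟨(Colour.B, a - 1, b), by simp [MidEdge.straight, MidEdge.addE1]⟩
    · exact ⟨(Colour.W, a, b - 1), by simp [MidEdge.straight, MidEdge.addE2]⟩

theorem toTorus_periodicExtFun (n : ℕ) (σ : GenSnake (ZMod n)) (x : MidEdge ℤ) :
    (periodicExtFun n σ x).toTorus n = σ.1 (x.toTorus n) := by
  unfold periodicExtFun
  split_ifs with h1 h2
  · exact h1.symm
  · rw [toTorus_addE3, h2]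
  · rw [toTorus_straight]
    rcases σ.2 (x.toTorus n) with h | h | h
    · exact absurd h h1
    · exact absurd h h2
    · exact h.symm

theorem periodicExtFun_bijective (n : ℕ) (σ : GenSnake (ZMod n)) :
    Function.Bijective (periodicExtFun n σ) := by
  constructor
  · intro x y h
    have hxy : x.toTorus n = y.toTorus n := by
      apply σ.1.injective
      rw [← toTorus_periodicExtFun, ← toTorus_periodicExtFun, h]
    unfold periodicExtFun at h
    rw [hxy] at h
    split_ifs at h with h1 h2
    · exact h
    · exact (addE3_bijective ℤ).1 h
    · exact (straight_bijective ℤ).1 h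
  · intro y
    obtain ⟨u, hu⟩ := σ.1.surjective (y.toTorus n)
    by_cases h1 : σ.1 u = u
    · refine ⟨y, ?_⟩
      have : y.toTorus n = u := by rw [← hu, h1]
      simp [periodicExtFun, this, h1]
    by_cases h2 : σ.1 u = u.addE3
    · obtain ⟨x, rfl⟩ := (addE3_bijective ℤ).2 y
      have : x.toTorus n = u := by
        apply (addE3_bijective (ZMod n)).1
        rw [← toTorus_addE3, ← hu, h2]
      refine ⟨x, ?_⟩
      unfold periodicExtFun
      rw [this, if_neg h1, if_pos h2]
    · obtain ⟨x, rfl⟩ := (straight_bijective ℤ).2 y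
      have h3 : σ.1 u = u.straight := by
        rcases σ.2 u with h | h | h
        · exact absurd h h1
        · exact absurd h h2
        · exact h
      have : x.toTorus n = u := by
        apply (straight_bijective (ZMod n)).1
        rw [← toTorus_straight, ← hu, h3]
      refine ⟨x, ?_⟩
      unfold periodicExtFun
      rw [this, if_neg h1, if_neg h2]

/-- The `n`-periodic extension to `ℤ²` of a generalised snake configuration on the torus. -/
noncomputable def periodicExt (n : ℕ) (σ : GenSnake (ZMod n)) : GenSnake ℤ :=
  ⟨Equiv.ofBijective (periodicExtFun n σ) (periodicExtFun_bijective n σ), by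
    intro x
    simp only [Equiv.ofBijective_apply, periodicExtFun]
    split_ifs <;> simp⟩

open Classical in
/-- The signed measure `P_n`, regarded as a signed measure on the generalised snake configurations
of `ℤ²` that is carried by the `n`-periodic ones. -/
noncomputable def periodicLaw (n : ℕ) [NeZero n] (α β γ : ℝ) (E : Set (GenSnake ℤ)) : ℝ :=
  ∑ σ : GenSnake (ZMod n), if periodicExt n σ ∈ E then snakeBoltzmann n α β γ σ else 0

/-- `E` is a cylinder event: it depends on the values of `ρ` at finitely many mid-edges only. -/
def IsCylinder (E : Set (GenSnake ℤ)) : Prop :=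
  ∃ F : Finset (MidEdge ℤ), ∀ ρ ρ' : GenSnake ℤ, (∀ x ∈ F, ρ.1 x = ρ'.1 x) → (ρ ∈ E ↔ ρ' ∈ E)

/-- The algebra of cylinder events. -/
abbrev CylinderEvent := {E : Set (GenSnake ℤ) // IsCylinder E}

/-- The sure event. -/
def CylinderEvent.univ : CylinderEvent := ⟨Set.univ, ∅, fun _ _ _ => Iff.rfl⟩

/-- The event that `ρ (x i) = y i` for all `i`. -/
def CylinderEvent.ofValues {k : ℕ} (x y : Fin k → MidEdge ℤ) : CylinderEvent :=
  ⟨{ρ | ∀ i, ρ.1 (x i) = y i}, Finset.univ.image x, fun ρ ρ' h => by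
    have h' : ∀ i, ρ.1 (x i) = ρ'.1 (x i) := fun i =>
      h (x i) (Finset.mem_image_of_mem x (Finset.mem_univ i))
    simp [h']⟩

/-- A signed measure on the cylinder events of the space of generalised snake configurations of
`ℤ²`: a real function on the algebra of cylinder events that is countably additive there. -/
structure SignedCylinderMeasure where
  /-- The value on a cylinder event. -/
  toFun : CylinderEvent → ℝ
  hasSum_iUnion : ∀ (E : ℕ → CylinderEvent) (U : CylinderEvent),
    (∀ i j, i ≠ j → Disjoint (E i).1 (E j).1) → U.1 = ⋃ i, (E i).1 →
      HasSum (fun i => toFun (E i)) (toFun U)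

/-- The Kasteleyn operator `K_{(0,0)}` on the mid-edges of `ℤ²`. -/
noncomputable def kasteleyn (α β γ : ℝ) (x y : MidEdge ℤ) : ℂ :=
  if y = x then 1
  else if y = x.addE1 ∧ x.1 = Colour.B then (α : ℂ)
  else if y = x.addE2 ∧ x.1 = Colour.W then (β : ℂ)
  else if y = x.addE3 then (γ : ℂ)
  else 0

/-- The square root of a complex number with argument in `[0, π)`. -/
noncomputable def sqrtBranch (z : ℂ) : ℂ :=
  if 0 ≤ z.arg then z ^ (1 / 2 : ℂ) else -z ^ (1 / 2 : ℂ)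

/-- The matrix `M(w₁, w₂)`, with rows and columns labelled by the colours. -/
noncomputable def symbolMatrix (α β γ : ℝ) (w₁ w₂ : ℂ) : Matrix Colour Colour ℂ :=
  Matrix.of fun c c' =>
    match c, c' with
    | Colour.B, Colour.B => 1 + α * w₁
    | Colour.W, Colour.W => 1 + β * w₂
    | _, _ => γ * sqrtBranch w₁ * sqrtBranch w₂

/-- The integrand of the kernel `L`, namely
`(2πi w₁)⁻¹ (2πi w₂)⁻¹ w₁^(y₁ - x₁) w₂^(y₂ - x₂) [M(w₁, w₂)⁻¹]_{c(x), c(y)}`. The exponents are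
half-integers, and `w^(m/2)` is the integer power `(w^(1/2))^m`. -/
noncomputable def kernelIntegrand (α β γ : ℝ) (x y : MidEdge ℤ) (w : Fin 2 → ℂ) : ℂ :=
  (2 * Real.pi * Complex.I * w 0)⁻¹ * (2 * Real.pi * Complex.I * w 1)⁻¹ *
    sqrtBranch (w 0) ^ (y.twice1 - x.twice1) * sqrtBranch (w 1) ^ (y.twice2 - x.twice2) *
    (symbolMatrix α β γ (w 0) (w 1))⁻¹ x.1 y.1

/-- The kernel `L(x, y)`: the double contour integral over `|w₁| = |w₂| = 1`. -/
noncomputable def kernelL (α β γ : ℝ) (x y : MidEdge ℤ) : ℂ :=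
  torusIntegral (kernelIntegrand α β γ x y) 0 1

/-! The proof is Kasteleyn's method on the torus, with an argument that copes with determinants that
vanish or nearly vanish.

Order the mid-edges along antidiagonals. The inversions of a configuration come from its crossings
and from wrapping around the torus, and the number of the latter depends only on the two fluxes P
and Q through the seams. So the signature is (-1)^S times a sign in P and Q (`sign_genSnake`). Hence
the generating function of the fluxes, with those signs, is a determinant of the Kasteleyn matrix
with twisted weights, and four twists recombine to the partition function (`sum_twistedSum`).
Prescribing k values multiplies a nonzero determinant by k entries of K and a k × k minor of its
inverse (`det_restrictMatrix`).

A twist of interest may have zero or tiny determinant, and the weights are signed, so one cannot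
simply pass to the limit in these ratios. Two facts repair this.

Positivity: configurations with the same moved mid-edges differ only by switching crossings into
pairs of diagonal steps, and each crossing costs the factor -αβ/γ². Summed over such a class, the
weight is a positive number times a power of 1 - αβ/γ². So the weight acts as a positive measure on
functions of the moved set, the fluxes among them, and prescribing k values costs at most a constant
to the power k (`norm_sum_restrict_le`).

Concentration: after a Fourier transform the determinant is a product over frequencies w of A(w)^n -
z B(w)^n. The maximum principle bounds the product of max(|A|, |B|)^n by the partition function, and
Chernoff's bound then gives Q = nμ + o(n) (`exists_flux_lln`).

Consequently, a change of the twist by an angle φ = O(1/n) multiplies all twisted sums by the same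
phase, up to o(Z_n). Trouble occurs only at the few frequencies where |A| and |B| nearly agree. A
pigeonhole argument finds φ that keeps the determinant away from zero there (`exists_isGoodTwist`),
and for such a twist the inverse matrix converges (`tendsto_greenSum`). Transporting back,
restricted sum minus unrestricted sum times the limit is o(Z_n), and no division by a possibly
vanishing determinant occurs (`tendsto_twistedSum_ratio`).

It remains to see that compactness of the configuration space makes the limit countably additive,
that the integrand of L is integrable despite its poles, and that L is the transpose of the limiting
inverse. -/

open MidEdge MeasureTheory

set_option linter.unusedSectionVars false

/-! ### Inversions of a permutation. -/

/-- The sign of a permutation as the parity of the number of inversions with respect to an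
injective key. -/
theorem sign_eq_prod_key {Y : Type*} [Fintype Y] [DecidableEq Y] (key : Y → ℕ)
    (hkey : Function.Injective key) (σ : Equiv.Perm Y) :
    σ.sign = ∏ x, ∏ y, (if key x < key y ∧ key (σ y) < key (σ x) then (-1 : ℤˣ) else 1) := by
  let _ : LinearOrder Y := LinearOrder.lift' key hkey
  have hlt : ∀ x y : Y, x < y ↔ key x < key y := fun x y => Iff.rfl
  let e : Fin (Fintype.card Y) ≃o Y := Fintype.orderIsoFinOfCardEq Y rfl
  have h1 : σ.sign = Equiv.Perm.sign ((e.toEquiv.trans σ).trans e.toEquiv.symm) := by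
    refine Equiv.Perm.sign_eq_sign_of_equiv _ _ e.toEquiv.symm ?_
    intro x
    simp
  rw [h1, Equiv.Perm.sign_eq_prod_prod_Ioi, ← e.toEquiv.prod_comp]
  refine Finset.prod_congr rfl fun i _ => ?_
  rw [← e.toEquiv.prod_comp, ← Finset.prod_subset (Finset.subset_univ (Finset.Ioi i))]
  · refine Finset.prod_congr rfl fun j hj => ?_
    have hij : i < j := Finset.mem_Ioi.1 hj
    have h2 : key (e i) < key (e j) := by
      rw [← hlt]; exact e.lt_iff_lt.2 hij
    have hne : σ (e i) ≠ σ (e j) := fun h => hij.ne (e.injective (σ.injective h))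
    have h3 : (e.symm (σ (e i)) < e.symm (σ (e j))) ↔ ¬ key (σ (e j)) < key (σ (e i)) := by
      rw [← hlt, e.symm.lt_iff_lt, not_lt]
      exact ⟨le_of_lt, fun h => lt_of_le_of_ne h hne⟩
    by_cases hc : key (σ (e j)) < key (σ (e i))
    · have : ¬ (e.symm (σ (e i)) < e.symm (σ (e j))) := fun h => h3.1 h hc
      simp [h2, hc, this]
    · have := h3.2 hc
      simp [hc, this]
  · intro j _ hj
    have hij : ¬ i < j := fun h => hj (Finset.mem_Ioi.2 h)
    have h2 : ¬ key (e i) < key (e j) := by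
      rw [← hlt]; exact fun h => hij (e.lt_iff_lt.1 h)
    simp [h2]

/-- The sign of a permutation as the parity of the number of inversions among moved points. -/
theorem sign_eq_neg_one_pow_card_inversions {X : Type*} [Fintype X] [DecidableEq X] (key : X → ℕ)
    (hkey : Function.Injective key) (σ : Equiv.Perm X) :
    σ.sign = ∏ p : X × X, (if (σ p.1 ≠ p.1 ∧ σ p.2 ≠ p.2) ∧
      key p.1 < key p.2 ∧ key (σ p.2) < key (σ p.1) then (-1 : ℤˣ) else 1) := by
  have h₁ : ∀ x, σ (σ x) ≠ σ x ↔ σ x ≠ x := fun x => by simp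
  -- Restricting to the support keeps the sign and discards inversions against fixed points, whose
  -- number would depend on where those points lie.
  rw [← Equiv.Perm.sign_subtypePerm σ (p := fun x => σ x ≠ x) h₁ (fun x hx => hx),
    sign_eq_prod_key (fun x => key x.1) (fun x y h => Subtype.ext (hkey h)),
    Fintype.prod_prod_type]
  simp only [Equiv.Perm.subtypePerm_apply]
  have hsub : ∀ f : X → ℤˣ, (∀ x, σ x = x → f x = 1) →
      ∏ x : {x // σ x ≠ x}, f x.1 = ∏ x, f x := by
    intro f hf
    rw [← Finset.prod_filter_mul_prod_filter_not Finset.univ (fun x => σ x ≠ x) f]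
    rw [Finset.prod_eq_one (s := Finset.univ.filter fun x => ¬ σ x ≠ x), mul_one]
    · exact (Finset.prod_subtype (Finset.univ.filter fun x => σ x ≠ x)
        (by simp) f).symm
    · intro x hx
      exact hf x (by simpa using hx)
  rw [← hsub (fun x => ∏ y, _) (fun x hx => Finset.prod_eq_one fun y _ => by simp [hx])]
  refine Finset.prod_congr rfl fun x _ => ?_
  rw [← hsub (fun y => _) (fun y hy => by simp [hy])]
  refine Finset.prod_congr rfl fun y _ => ?_
  have hx := x.2
  have hy := y.2
  exact if_congr (by simp [hx, hy]) rfl rfl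

/-! ### Conservation of flux for a cyclic height. -/

/-- The flux of a permutation through the levels of a cyclic height function is constant. -/
theorem flux_succ {X : Type*} [Fintype X] {m : ℕ} [NeZero m] (h : X → ZMod m)
    (ρ : Equiv.Perm X) (hstep : ∀ x, h (ρ x) = h x ∨ h (ρ x) = h x + 1) (c : ZMod m) :
    (Finset.univ.filter fun x => h x = c ∧ h (ρ x) ≠ h x).card =
      (Finset.univ.filter fun x => h x = c + 1 ∧ h (ρ x) ≠ h x).card := by
  classical
  have h1 : (Finset.univ.filter fun x => h (ρ x) = c + 1).card =
      (Finset.univ.filter fun x => h x = c + 1).card := by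
    refine Finset.card_bij (fun x _ => ρ x) (by simp) (fun x _ y _ h => ρ.injective h) ?_
    intro y hy
    exact ⟨ρ.symm y, by simpa using hy, by simp⟩
  -- Whatever lands on level c + 1 either climbed from level c or was there and stayed. Removing
  -- those that stay from both counts leaves the two fluxes.
  have h2 : (Finset.univ.filter fun x => h (ρ x) = c + 1) =
      (Finset.univ.filter fun x => h x = c ∧ h (ρ x) ≠ h x) ∪
        (Finset.univ.filter fun x => h x = c + 1 ∧ h (ρ x) = h x) := by
    ext x
    simp only [Finset.mem_filter, Finset.mem_univ, true_and, Finset.mem_union]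
    constructor
    · intro hx
      by_cases he : h (ρ x) = h x
      · right; exact ⟨he ▸ hx, he⟩
      · left
        refine ⟨?_, he⟩
        rcases hstep x with h' | h'
        · exact absurd h' he
        · rw [h'] at hx; exact add_right_cancel hx
    · rintro (⟨hx, hne⟩ | ⟨hx, he⟩)
      · rcases hstep x with h' | h'
        · exact absurd h' hne
        · rw [h', hx]
      · rw [he, hx]
  have h3 : (Finset.univ.filter fun x => h x = c + 1) =
      (Finset.univ.filter fun x => h x = c + 1 ∧ h (ρ x) ≠ h x) ∪
        (Finset.univ.filter fun x => h x = c + 1 ∧ h (ρ x) = h x) := by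
    ext x
    simp only [Finset.mem_filter, Finset.mem_univ, true_and, Finset.mem_union]
    tauto
  rw [h2, h3, Finset.card_union_of_disjoint, Finset.card_union_of_disjoint] at h1
  · exact Nat.add_right_cancel h1
  · rw [Finset.disjoint_filter]; tauto
  · rw [Finset.disjoint_filter]; tauto

theorem flux_const {X : Type*} [Fintype X] {m : ℕ} [NeZero m] (h : X → ZMod m)
    (ρ : Equiv.Perm X) (hstep : ∀ x, h (ρ x) = h x ∨ h (ρ x) = h x + 1) (c d : ZMod m) :
    (Finset.univ.filter fun x => h x = c ∧ h (ρ x) ≠ h x).card =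
      (Finset.univ.filter fun x => h x = d ∧ h (ρ x) ≠ h x).card := by
  have key : ∀ k : ℕ, (Finset.univ.filter fun x => h x = c ∧ h (ρ x) ≠ h x).card =
      (Finset.univ.filter fun x => h x = c + k ∧ h (ρ x) ≠ h x).card := by
    intro k
    induction k with
    | zero => simp
    | succ k ih => rw [ih, flux_succ h ρ hstep]; push_cast; rw [add_assoc]
  have := key (d - c).val
  rwa [ZMod.natCast_zmod_val, add_sub_cancel] at this

theorem card_eq_mul_flux {X : Type*} [Fintype X] {m : ℕ} [NeZero m] (h : X → ZMod m)
    (ρ : Equiv.Perm X) (hstep : ∀ x, h (ρ x) = h x ∨ h (ρ x) = h x + 1) (c : ZMod m) :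
    (Finset.univ.filter fun x => h (ρ x) ≠ h x).card =
      m * (Finset.univ.filter fun x => h x = c ∧ h (ρ x) ≠ h x).card := by
  classical
  rw [Finset.card_eq_sum_card_fiberwise (f := h) (t := Finset.univ) (fun _ _ => by simp)]
  rw [Finset.sum_congr rfl (g := fun _ => (Finset.univ.filter fun x => h x = c ∧ h (ρ x) ≠ h x).card)]
  · simp [ZMod.card]
  · intro d _
    rw [flux_const h ρ hstep c d, Finset.filter_filter]
    congr 1
    ext x
    simp [and_comm]

/-! ### Fluxes and step counts of a configuration. -/

section Moved

variable {n : ℕ} [NeZero n]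

/-- The mid-edges moved by a permutation. -/
def moved (ρ : Equiv.Perm (MidEdge (ZMod n))) : Finset (MidEdge (ZMod n)) :=
  Finset.univ.filter fun x => ρ x ≠ x

@[simp] theorem mem_moved {ρ : Equiv.Perm (MidEdge (ZMod n))} {x : MidEdge (ZMod n)} :
    x ∈ moved ρ ↔ ρ x ≠ x := by simp [moved]

/-- The vertices at which a permutation has a crossing. -/
def crossSet (ρ : Equiv.Perm (MidEdge (ZMod n))) : Finset (ZMod n × ZMod n) :=
  Finset.univ.filter fun v => ρ (west v) = east v ∧ ρ (south v) = north v

@[simp] theorem mem_crossSet {ρ : Equiv.Perm (MidEdge (ZMod n))} {v : ZMod n × ZMod n} :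
    v ∈ crossSet ρ ↔ ρ (west v) = east v ∧ ρ (south v) = north v := by simp [crossSet]

/-- The number of moved mid-edges crossing the vertical seam of the torus. -/
def fluxE (Y : Finset (MidEdge (ZMod n))) : ℕ :=
  (Y.filter fun x => x.1 = Colour.B ∧ x.2.1 = -1).card

/-- The number of moved mid-edges crossing the horizontal seam of the torus. -/
def fluxN (Y : Finset (MidEdge (ZMod n))) : ℕ :=
  (Y.filter fun x => x.1 = Colour.W ∧ x.2.2 = -1).card

theorem genSnake_black (ρ : GenSnake (ZMod n)) (a b : ZMod n) :
    ρ.1 (Colour.B, a, b) = (Colour.B, a, b) ∨ ρ.1 (Colour.B, a, b) = (Colour.W, a + 1, b) ∨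
      ρ.1 (Colour.B, a, b) = (Colour.B, a + 1, b) := ρ.2 (Colour.B, a, b)

theorem genSnake_white (ρ : GenSnake (ZMod n)) (a b : ZMod n) :
    ρ.1 (Colour.W, a, b) = (Colour.W, a, b) ∨ ρ.1 (Colour.W, a, b) = (Colour.B, a, b + 1) ∨
      ρ.1 (Colour.W, a, b) = (Colour.W, a, b + 1) := ρ.2 (Colour.W, a, b)

variable [Fact (1 < n)] (ρ : GenSnake (ZMod n))

/-- Every step that is not a fixed point raises the height `x.2.1 + x.2.2` by one, so all
antidiagonals carry the same flux. -/
theorem card_moved_level (t : ZMod n) :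
    ((moved ρ.1).filter fun x => x.2.1 + x.2.2 = t).card =
      ((moved ρ.1).filter fun x => x.2.1 + x.2.2 = -1).card := by
  have h : ∀ x : MidEdge (ZMod n), ((ρ.1 x).2.1 + (ρ.1 x).2.2 ≠ x.2.1 + x.2.2 ↔ ρ.1 x ≠ x) ∧
      ((ρ.1 x).2.1 + (ρ.1 x).2.2 = x.2.1 + x.2.2 ∨
        (ρ.1 x).2.1 + (ρ.1 x).2.2 = x.2.1 + x.2.2 + 1) := by
    rintro ⟨c, a, b⟩
    cases c
    · rcases genSnake_black ρ a b with h | h | h <;> rw [h] <;> simp <;> ring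
    · rcases genSnake_white ρ a b with h | h | h <;> rw [h] <;> simp <;> ring
  have := flux_const (fun x : MidEdge (ZMod n) => x.2.1 + x.2.2) ρ.1 (fun x => (h x).2) t (-1)
  simp only [(h _).1] at this
  simpa [moved, Finset.filter_filter, and_comm] using this

theorem card_moved :
    (moved ρ.1).card = n * ((moved ρ.1).filter fun x => x.2.1 + x.2.2 = -1).card := by
  have h1 := Finset.card_eq_sum_card_fiberwise (s := moved ρ.1)
    (f := fun x : MidEdge (ZMod n) => x.2.1 + x.2.2) (t := Finset.univ) (fun _ _ => by simp)
  rw [h1, Finset.sum_congr rfl fun t _ => card_moved_level ρ t]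
  simp [ZMod.card]

/-- With the first coordinate as height, exactly the moved black mid-edges climb, by straight and by
diagonal steps alike. -/
theorem card_moved_black :
    ((moved ρ.1).filter fun x => x.1 = Colour.B).card = n * fluxE (moved ρ.1) := by
  have h : ∀ x : MidEdge (ZMod n), ((ρ.1 x).2.1 ≠ x.2.1 ↔ ρ.1 x ≠ x ∧ x.1 = Colour.B) ∧
      ((ρ.1 x).2.1 = x.2.1 ∨ (ρ.1 x).2.1 = x.2.1 + 1) := by
    rintro ⟨c, a, b⟩
    cases c
    · rcases genSnake_black ρ a b with h | h | h <;> rw [h] <;> simp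
    · rcases genSnake_white ρ a b with h | h | h <;> rw [h] <;> simp
  have := card_eq_mul_flux (fun x : MidEdge (ZMod n) => x.2.1) ρ.1 (fun x => (h x).2) (-1)
  simp only [(h _).1] at this
  rw [moved, fluxE, Finset.filter_filter, this, Finset.filter_filter]
  congr 2
  ext x
  simp
  tauto

theorem card_moved_white :
    ((moved ρ.1).filter fun x => x.1 = Colour.W).card = n * fluxN (moved ρ.1) := by
  have h : ∀ x : MidEdge (ZMod n), ((ρ.1 x).2.2 ≠ x.2.2 ↔ ρ.1 x ≠ x ∧ x.1 = Colour.W) ∧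
      ((ρ.1 x).2.2 = x.2.2 ∨ (ρ.1 x).2.2 = x.2.2 + 1) := by
    rintro ⟨c, a, b⟩
    cases c
    · rcases genSnake_black ρ a b with h | h | h <;> rw [h] <;> simp
    · rcases genSnake_white ρ a b with h | h | h <;> rw [h] <;> simp
  have := card_eq_mul_flux (fun x : MidEdge (ZMod n) => x.2.2) ρ.1 (fun x => (h x).2) (-1)
  simp only [(h _).1] at this
  rw [moved, fluxN, Finset.filter_filter, this, Finset.filter_filter]
  congr 2
  ext x
  simp
  tauto

theorem card_filter_black_add_white (Y : Finset (MidEdge (ZMod n))) :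
    (Y.filter fun x => x.1 = Colour.B).card + (Y.filter fun x => x.1 = Colour.W).card =
      Y.card := by
  rw [← Finset.card_filter_add_card_filter_not (s := Y) (fun x => x.1 = Colour.B)]
  congr 2
  ext ⟨c, a, b⟩
  cases c <;> simp

theorem card_moved_level_eq :
    ((moved ρ.1).filter fun x => x.2.1 + x.2.2 = -1).card =
      fluxE (moved ρ.1) + fluxN (moved ρ.1) := by
  have h := card_filter_black_add_white (moved ρ.1)
  rw [card_moved_black, card_moved_white, card_moved, ← mul_add] at h
  exact (Nat.eq_of_mul_eq_mul_left (NeZero.pos n) h).symm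

/-- As many diagonal steps start at black mid-edges as at white ones. -/
theorem card_diag_black :
    (Finset.univ.filter fun x : MidEdge (ZMod n) => x.1 = Colour.B ∧ ρ.1 x = x.addE3).card =
      (Finset.univ.filter fun x : MidEdge (ZMod n) => x.1 = Colour.W ∧ ρ.1 x = x.addE3).card := by
  -- The colour as a height in `ZMod 2`: exactly the diagonal steps change level.
  let h : MidEdge (ZMod n) → ZMod 2 := fun x => if x.1 = Colour.B then 0 else 1
  have hh : ∀ x : MidEdge (ZMod n), (h (ρ.1 x) ≠ h x ↔ ρ.1 x = x.addE3) ∧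
      (h (ρ.1 x) = h x ∨ h (ρ.1 x) = h x + 1) ∧ (h x = 0 ↔ x.1 = Colour.B) ∧
        (h x = 1 ↔ x.1 = Colour.W) := by
    rintro ⟨c, a, b⟩
    have h11 : (1 + 1 : ZMod 2) = 0 := rfl
    cases c
    · rcases genSnake_black ρ a b with h' | h' | h' <;> rw [h'] <;> simp [h, addE3]
    · rcases genSnake_white ρ a b with h' | h' | h' <;> rw [h'] <;> simp [h, addE3, h11]
  have := flux_const h ρ.1 (fun x => (hh x).2.1) 0 1
  simpa only [(hh _).1, (hh _).2.2.1, (hh _).2.2.2] using this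

/-- A diagonal step counts as half an east and half a north step. This identity makes the weights α
v₁², β v₂², γ v₁ v₂ produce powers of v₁^(2n) and v₂^(2n) with the fluxes as exponents. -/
theorem two_mul_numE1_add :
    2 * numE1 n ρ + numE3 n ρ = 2 * n * fluxE (moved ρ.1) := by
  have h1 : ((moved ρ.1).filter fun x => x.1 = Colour.B).card = numE1 n ρ +
      (Finset.univ.filter fun x : MidEdge (ZMod n) => x.1 = Colour.B ∧ ρ.1 x = x.addE3).card := by
    rw [numE1, ← Finset.card_union_of_disjoint]
    · congr 1
      ext ⟨c, a, b⟩
      simp only [Finset.mem_union, Finset.mem_filter, Finset.mem_univ, true_and, mem_moved]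
      cases c
      · rcases genSnake_black ρ a b with h' | h' | h' <;> simp [h', addE3, addE1]
      · rcases genSnake_white ρ a b with h' | h' | h' <;> simp [h', addE1]
    · rw [Finset.disjoint_filter]
      rintro ⟨c, a, b⟩
      cases c <;> simp +contextual [addE1, addE3]
  have h2 : numE3 n ρ =
      (Finset.univ.filter fun x : MidEdge (ZMod n) => x.1 = Colour.B ∧ ρ.1 x = x.addE3).card +
      (Finset.univ.filter fun x : MidEdge (ZMod n) => x.1 = Colour.W ∧ ρ.1 x = x.addE3).card := by
    rw [numE3, ← card_filter_black_add_white, Finset.filter_filter, Finset.filter_filter]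
    simp only [and_comm]
  have h3 := card_diag_black ρ
  have h4 := card_moved_black ρ
  rw [mul_assoc, ← h4]
  omega

theorem two_mul_numE2_add :
    2 * numE2 n ρ + numE3 n ρ = 2 * n * fluxN (moved ρ.1) := by
  have h1 : ((moved ρ.1).filter fun x => x.1 = Colour.W).card = numE2 n ρ +
      (Finset.univ.filter fun x : MidEdge (ZMod n) => x.1 = Colour.W ∧ ρ.1 x = x.addE3).card := by
    rw [numE2, ← Finset.card_union_of_disjoint]
    · congr 1
      ext ⟨c, a, b⟩
      simp only [Finset.mem_union, Finset.mem_filter, Finset.mem_univ, true_and, mem_moved]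
      cases c
      · rcases genSnake_black ρ a b with h' | h' | h' <;> simp [h', addE2]
      · rcases genSnake_white ρ a b with h' | h' | h' <;> simp [h', addE3, addE2]
    · rw [Finset.disjoint_filter]
      rintro ⟨c, a, b⟩
      cases c <;> simp +contextual [addE2, addE3]
  have h2 : numE3 n ρ =
      (Finset.univ.filter fun x : MidEdge (ZMod n) => x.1 = Colour.B ∧ ρ.1 x = x.addE3).card +
      (Finset.univ.filter fun x : MidEdge (ZMod n) => x.1 = Colour.W ∧ ρ.1 x = x.addE3).card := by
    rw [numE3, ← card_filter_black_add_white, Finset.filter_filter, Finset.filter_filter]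
    simp only [and_comm]
  have h3 := card_diag_black ρ
  have h4 := card_moved_white ρ
  rw [mul_assoc, ← h4]
  omega

end Moved

/-! ### The signature in terms of crossings and fluxes. -/

section SignFormula

variable {n : ℕ} [NeZero n]

/-- The position of a mid-edge within its level. -/
def levelPos (x : MidEdge (ZMod n)) : ℕ := 2 * x.2.1.val + if x.1 = Colour.B then 1 else 0

/-- The level of a mid-edge. -/
def level (x : MidEdge (ZMod n)) : ZMod n := x.2.1 + x.2.2

/-- A key ordering the mid-edges first by level and then by position. -/
def levelKey (x : MidEdge (ZMod n)) : ℕ := (level x).val * (2 * n) + levelPos x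

theorem levelPos_lt (x : MidEdge (ZMod n)) : levelPos x < 2 * n := by
  have := ZMod.val_lt x.2.1
  unfold levelPos
  split_ifs <;> omega

theorem levelKey_lt_iff (x y : MidEdge (ZMod n)) : levelKey x < levelKey y ↔
    (level x).val < (level y).val ∨ (level x).val = (level y).val ∧ levelPos x < levelPos y := by
  have hx := levelPos_lt x
  have hy := levelPos_lt y
  unfold levelKey
  constructor
  · intro h
    rcases lt_trichotomy (level x).val (level y).val with h1 | h1 | h1
    · exact Or.inl h1
    · right; rw [h1] at h; exact ⟨h1, by omega⟩
    · have := Nat.mul_le_mul_right (2 * n) h1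
      rw [Nat.succ_mul] at this
      omega
  · rintro (h1 | ⟨h1, h2⟩)
    · have := Nat.mul_le_mul_right (2 * n) h1
      rw [Nat.succ_mul] at this
      omega
    · rw [h1]; omega

theorem level_pos_ext {x y : MidEdge (ZMod n)} (h1 : (level x).val = (level y).val)
    (h2 : levelPos x = levelPos y) : x = y := by
  obtain ⟨c, a, b⟩ := x
  obtain ⟨c', a', b'⟩ := y
  have h3 : c = c' ∧ a.val = a'.val := by
    unfold levelPos at h2
    cases c <;> cases c' <;> simp at h2 ⊢ <;> omega
  obtain ⟨rfl, h4⟩ := h3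
  obtain rfl := ZMod.val_injective n h4
  have h5 := ZMod.val_injective n h1
  simp [level] at h5
  rw [h5]

theorem levelKey_injective : Function.Injective (levelKey (n := n)) := by
  intro x y h
  have h1 := (levelKey_lt_iff x y).not.1 (by omega)
  have h2 := (levelKey_lt_iff y x).not.1 (by omega)
  exact level_pos_ext (by omega) (by omega)

theorem zmod_val_add_one (a : ZMod n) [Fact (1 < n)] :
    (a + 1).val = if a.val + 1 = n then 0 else a.val + 1 := by
  have h := ZMod.val_lt a
  rw [ZMod.val_add, ZMod.val_one]
  split_ifs with h1
  · rw [h1, Nat.mod_self]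
  · exact Nat.mod_eq_of_lt (by omega)

theorem zmod_eq_neg_one_iff (a : ZMod n) [Fact (1 < n)] : a = -1 ↔ a.val + 1 = n := by
  rw [eq_neg_iff_add_eq_zero, ← ZMod.val_eq_zero, zmod_val_add_one]
  split_ifs with h <;> simp [h]

/-- The position on an antidiagonal is twice the first coordinate. Away from the seam, a step takes
a black site from p to p + 1 or p + 2 and a white one from p to p + 1 or p, so order within a level
is reversed only when a black site and the next white site both go straight, which is a crossing.
The other two factors record wrapping, of the level and of the position. At a crossing on the
position seam the last factor cancels the inversion that the second one wrongly counts. -/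
theorem inversion_parity {n lx ly px py lx' ly' px' py' ax ay bx b_y sx sy : ℕ}
    (hlx : lx < n) (hly : ly < n) (hax : ax < n) (hay : ay < n)
    (hbx : bx = 0 ∨ bx = 1) (hby : b_y = 0 ∨ b_y = 1) (hsx : sx = 0 ∨ sx = 1)
    (hsy : sy = 0 ∨ sy = 1)
    (hpx : px = 2 * ax + bx) (hpy : py = 2 * ay + b_y)
    (hpx' : px' = if bx = 1 then (if ax + 1 = n then sx else 2 * ax + 2 + sx) else 2 * ax + 1 - sx)
    (hpy' : py' = if b_y = 1 then (if ay + 1 = n then sy else 2 * ay + 2 + sy) else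
      2 * ay + 1 - sy)
    (hlx' : lx' = if lx + 1 = n then 0 else lx + 1) (hly' : ly' = if ly + 1 = n then 0 else ly + 1)
    (hd : ¬ (lx' = ly' ∧ px' = py')) (hd' : ¬ (lx = ly ∧ px = py)) :
    (if (lx < ly ∨ lx = ly ∧ px < py) ∧ (ly' < lx' ∨ ly' = lx' ∧ py' < px') then (-1 : ℤˣ)
      else 1) =
      (if lx + 1 ≠ n ∧ ly + 1 = n then (-1 : ℤˣ) else 1) *
      (if lx = ly ∧ b_y = 1 ∧ ay + 1 = n then (-1 : ℤˣ) else 1) *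
      (if (lx < ly ∨ lx = ly ∧ px < py) ∧
        ((lx = ly ∧ bx = 1 ∧ b_y = 0 ∧ sx = 1 ∧ sy = 1 ∧ ay = if ax + 1 = n then 0 else ax + 1) ∨
        (lx = ly ∧ b_y = 1 ∧ bx = 0 ∧ sx = 1 ∧ sy = 1 ∧ ax = if ay + 1 = n then 0 else ay + 1))
        then (-1 : ℤˣ) else 1) := by
  by_cases hl : lx = ly
  · subst hl
    have h1 : lx' = ly' := by rw [hlx', hly']
    rcases hbx with rfl | rfl <;> rcases hby with rfl | rfl <;> rcases hsx with rfl | rfl <;>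
      rcases hsy with rfl | rfl <;> simp at hpx' hpy' ⊢ <;> split_ifs at * <;>
      first | rfl | omega
  · simp only [hl, false_and, or_false, and_false, if_false, mul_one]
    split_ifs at * <;> first | rfl | omega

end SignFormula

section SignFormula

variable {n : ℕ} [NeZero n] [Fact (1 < n)] (ρ : GenSnake (ZMod n))

theorem level_val_step {x : MidEdge (ZMod n)} (hx : ρ.1 x ≠ x) :
    (level (ρ.1 x)).val = if (level x).val + 1 = n then 0 else (level x).val + 1 := by
  rw [← zmod_val_add_one]
  congr 1
  obtain ⟨c, a, b⟩ := x
  cases c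
  · rcases genSnake_black ρ a b with h | h | h
    · exact absurd h hx
    all_goals rw [h]; simp only [level]; ring
  · rcases genSnake_white ρ a b with h | h | h
    · exact absurd h hx
    all_goals rw [h]; simp only [level]; ring

theorem levelPos_step {x : MidEdge (ZMod n)} (hx : ρ.1 x ≠ x) :
    levelPos (ρ.1 x) = if (if x.1 = Colour.B then 1 else 0) = 1 then
      (if x.2.1.val + 1 = n then (if ρ.1 x = x.straight then 1 else 0) else
        2 * x.2.1.val + 2 + (if ρ.1 x = x.straight then 1 else 0)) else
      2 * x.2.1.val + 1 - (if ρ.1 x = x.straight then 1 else 0) := by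
  obtain ⟨c, a, b⟩ := x
  have ha := zmod_val_add_one a
  cases c
  · rcases genSnake_black ρ a b with h | h | h
    · exact absurd h hx
    all_goals
      rw [h]; simp only [levelPos, ha, straight, addE1]; simp; split_ifs <;> omega
  · rcases genSnake_white ρ a b with h | h | h
    · exact absurd h hx
    all_goals
      rw [h]; simp [levelPos, straight, addE2]

/-- The mid-edges `x` and `y` are the west and the south one at a crossing. -/
def crossAt (x y : MidEdge (ZMod n)) : Prop :=
  ∃ v ∈ crossSet ρ.1, x = west v ∧ y = south v

/-- Translates crossings into the numerical data of `inversion_parity`. -/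
theorem crossAt_iff (x y : MidEdge (ZMod n)) : crossAt ρ x y ↔
    (level x).val = (level y).val ∧ (if x.1 = Colour.B then 1 else 0) = 1 ∧
      (if y.1 = Colour.B then 1 else 0) = 0 ∧ (if ρ.1 x = x.straight then 1 else 0) = 1 ∧
      (if ρ.1 y = y.straight then 1 else 0) = 1 ∧
      y.2.1.val = if x.2.1.val + 1 = n then 0 else x.2.1.val + 1 := by
  rw [← zmod_val_add_one, (ZMod.val_injective n).eq_iff, (ZMod.val_injective n).eq_iff]
  obtain ⟨c, a, b⟩ := x
  obtain ⟨c', a', b'⟩ := y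
  unfold crossAt
  constructor
  · rintro ⟨⟨v₁, v₂⟩, hv, h1, h2⟩
    rw [mem_crossSet] at hv
    rw [h1, h2, hv.1, hv.2]
    simp [west, south, straight, east, addE1, addE2, level, north]
    ring
  · rintro ⟨h1, h2, h3, h4, h5, h6⟩
    cases c <;> cases c' <;> simp at h2 h3
    simp only at h6
    subst h6
    have hb : b' = b - 1 := by
      have h1' : a + b = a + 1 + b' := h1
      linear_combination -h1'
    subst hb
    refine ⟨(a + 1, b), ?_, ?_, ?_⟩
    · rw [mem_crossSet]
      have h4' : ρ.1 (Colour.B, a, b) = straight (Colour.B, a, b) := by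
        by_contra hh
        rw [if_neg hh] at h4
        omega
      have h5' : ρ.1 (Colour.W, a + 1, b - 1) = straight (Colour.W, a + 1, b - 1) := by
        by_contra hh
        rw [if_neg hh] at h5
        omega
      simp only [straight, addE1, addE2] at h4' h5'
      simp [west, south, east, north, h4', h5']
    · simp [west]
    · simp [south]

open Classical in
theorem prod_inversions : (Equiv.Perm.sign ρ.1 : ℤˣ) =
    (∏ p : MidEdge (ZMod n) × MidEdge (ZMod n),
      (if (p.1 ∈ moved ρ.1 ∧ p.2 ∈ moved ρ.1) ∧ (level p.1).val + 1 ≠ n ∧ (level p.2).val + 1 = n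
        then (-1 : ℤˣ) else 1)) *
    (∏ p : MidEdge (ZMod n) × MidEdge (ZMod n),
      (if (p.1 ∈ moved ρ.1 ∧ p.2 ∈ moved ρ.1) ∧ p.1 ≠ p.2 ∧ (level p.1).val = (level p.2).val ∧
        p.2.1 = Colour.B ∧ p.2.2.1 = -1 then (-1 : ℤˣ) else 1)) *
    (∏ p : MidEdge (ZMod n) × MidEdge (ZMod n),
      (if levelKey p.1 < levelKey p.2 ∧ (crossAt ρ p.1 p.2 ∨ crossAt ρ p.2 p.1)
        then (-1 : ℤˣ) else 1)) := by
  rw [sign_eq_neg_one_pow_card_inversions levelKey levelKey_injective, ← Finset.prod_mul_distrib,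
    ← Finset.prod_mul_distrib]
  refine Finset.prod_congr rfl ?_
  rintro ⟨x, y⟩ -
  have hcm : ∀ x y, crossAt ρ x y → ρ.1 x ≠ x ∧ ρ.1 y ≠ y := by
    rintro _ _ ⟨⟨v₁, v₂⟩, hv, rfl, rfl⟩
    rw [mem_crossSet] at hv
    rw [hv.1, hv.2]
    simp [east, west, north, south, eq_sub_iff_add_eq]
  simp only [mem_moved]
  by_cases hm : ρ.1 x ≠ x ∧ ρ.1 y ≠ y
  · by_cases hxy : x = y
    · subst hxy
      simp
    · obtain ⟨hx, hy⟩ := hm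
      have hne : ρ.1 x ≠ ρ.1 y := fun h => hxy (ρ.1.injective h)
      have key := inversion_parity (ZMod.val_lt (level x)) (ZMod.val_lt (level y))
        (ZMod.val_lt x.2.1) (ZMod.val_lt y.2.1)
        (bx := if x.1 = Colour.B then 1 else 0) (b_y := if y.1 = Colour.B then 1 else 0)
        (sx := if ρ.1 x = x.straight then 1 else 0) (sy := if ρ.1 y = y.straight then 1 else 0)
        (by split_ifs <;> simp) (by split_ifs <;> simp) (by split_ifs <;> simp)
        (by split_ifs <;> simp) rfl rfl (levelPos_step ρ hx) (levelPos_step ρ hy)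
        (level_val_step ρ hx) (level_val_step ρ hy)
        (fun h => hne (level_pos_ext h.1 h.2)) (fun h => hxy (level_pos_ext h.1 h.2))
      convert! key using 1
      · refine if_congr ?_ rfl rfl
        rw [levelKey_lt_iff, levelKey_lt_iff]
        tauto
      · congr 1
        · congr 1
          · refine if_congr ?_ rfl rfl
            tauto
          · refine if_congr ?_ rfl rfl
            rw [zmod_eq_neg_one_iff]
            have : (if y.1 = Colour.B then 1 else 0) = 1 ↔ y.1 = Colour.B := by simp
            tauto
        · refine if_congr ?_ rfl rfl
          rw [levelKey_lt_iff, crossAt_iff, crossAt_iff]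
          simp only [levelPos, eq_comm (a := (level y).val)]
          tauto
  · have h1 : ¬ crossAt ρ x y := fun h => hm (hcm _ _ h)
    have h2 : ¬ crossAt ρ y x := fun h => hm (hcm _ _ h).symm
    simp [hm, h1, h2]

theorem val_add_one_eq_iff (x : MidEdge (ZMod n)) :
    (level x).val + 1 = n ↔ x.2.1 + x.2.2 = -1 := (zmod_eq_neg_one_iff _).symm

/-- Each of the n levels carries P + Q moved sites; a site of the last level is paired with all
those of the other n - 1 levels. -/
theorem card_level_wrap : (Finset.univ.filter fun p : MidEdge (ZMod n) × MidEdge (ZMod n) =>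
    (p.1 ∈ moved ρ.1 ∧ p.2 ∈ moved ρ.1) ∧ (level p.1).val + 1 ≠ n ∧
      (level p.2).val + 1 = n).card =
    (n - 1) * (fluxE (moved ρ.1) + fluxN (moved ρ.1)) *
      (fluxE (moved ρ.1) + fluxN (moved ρ.1)) := by
  have h1 : (Finset.univ.filter fun p : MidEdge (ZMod n) × MidEdge (ZMod n) =>
    (p.1 ∈ moved ρ.1 ∧ p.2 ∈ moved ρ.1) ∧ (level p.1).val + 1 ≠ n ∧ (level p.2).val + 1 = n) =
    ((moved ρ.1).filter fun x => ¬ x.2.1 + x.2.2 = -1) ×ˢ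
      ((moved ρ.1).filter fun x => x.2.1 + x.2.2 = -1) := by
    ext p
    simp only [Finset.mem_filter, Finset.mem_univ, true_and, Finset.mem_product,
      val_add_one_eq_iff, ne_eq]
    tauto
  have h2 := Finset.card_filter_add_card_filter_not (s := moved ρ.1)
    (fun x => x.2.1 + x.2.2 = -1)
  rw [card_moved, card_moved_level_eq] at h2
  rw [h1, Finset.card_product, card_moved_level_eq]
  congr 1
  rw [Nat.sub_mul, one_mul]
  omega

/-- Each of the P moved black sites at the column seam is paired with the P + Q - 1 other moved
sites of its own level. -/
theorem card_pos_wrap : (Finset.univ.filter fun p : MidEdge (ZMod n) × MidEdge (ZMod n) =>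
    (p.1 ∈ moved ρ.1 ∧ p.2 ∈ moved ρ.1) ∧ p.1 ≠ p.2 ∧ (level p.1).val = (level p.2).val ∧
      p.2.1 = Colour.B ∧ p.2.2.1 = -1).card =
    fluxE (moved ρ.1) * (fluxE (moved ρ.1) + fluxN (moved ρ.1) - 1) := by
  rw [Finset.card_eq_sum_card_fiberwise (f := Prod.snd)
    (t := (moved ρ.1).filter fun x => x.1 = Colour.B ∧ x.2.1 = -1)]
  · rw [Finset.sum_congr rfl
      (g := fun _ => fluxE (moved ρ.1) + fluxN (moved ρ.1) - 1)]
    · simp [fluxE]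
    · intro y hy
      rw [Finset.mem_filter] at hy
      have h1 : ((moved ρ.1).filter fun x => x.2.1 + x.2.2 = level y).card =
          fluxE (moved ρ.1) + fluxN (moved ρ.1) := by
        rw [card_moved_level, card_moved_level_eq]
      have h2 : y ∈ (moved ρ.1).filter fun x => x.2.1 + x.2.2 = level y :=
        Finset.mem_filter.2 ⟨hy.1, rfl⟩
      rw [← h1, ← Finset.card_erase_of_mem h2]
      refine Finset.card_bij (fun p _ => p.1) ?_ ?_ ?_
      · rintro ⟨x, y'⟩ h
        simp only [Finset.mem_filter, Finset.mem_univ, true_and,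
          (ZMod.val_injective n).eq_iff] at h
        obtain ⟨h, rfl⟩ := h
        simp only [Finset.mem_erase, Finset.mem_filter]
        exact ⟨h.2.1, h.1.1, h.2.2.1⟩
      · rintro ⟨x, y'⟩ h ⟨x', y''⟩ h' hxx
        simp only [Finset.mem_filter] at h h'
        exact Prod.ext hxx (h.2.trans h'.2.symm)
      · intro x hx
        simp only [Finset.mem_erase, Finset.mem_filter] at hx
        refine ⟨(x, y), ?_, rfl⟩
        simp only [Finset.mem_filter, Finset.mem_univ, true_and,
          (ZMod.val_injective n).eq_iff, and_true]
        exact ⟨⟨hx.2.1, hy.1⟩, hx.1, hx.2.2, hy.2.1, hy.2.2⟩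
  · intro p hp
    simp only [Finset.coe_filter, Set.mem_ofPred_eq, Finset.mem_univ, true_and] at hp ⊢
    exact ⟨hp.1.2, hp.2.2.2⟩

open Classical in
theorem card_crossAt : (Finset.univ.filter fun p : MidEdge (ZMod n) × MidEdge (ZMod n) =>
    levelKey p.1 < levelKey p.2 ∧ (crossAt ρ p.1 p.2 ∨ crossAt ρ p.2 p.1)).card =
    numCrossings n ρ := by
  symm
  refine Finset.card_bij (fun v _ => if levelKey (west v) < levelKey (south v) then
    (west v, south v) else (south v, west v)) ?_ ?_ ?_
  · intro v hv
    have hv' : v ∈ crossSet ρ.1 := hv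
    simp only [Finset.mem_filter, Finset.mem_univ, true_and]
    split_ifs with h
    · exact ⟨h, Or.inl ⟨v, hv', rfl, rfl⟩⟩
    · refine ⟨lt_of_le_of_ne (not_lt.1 h) fun h' => ?_, Or.inr ⟨v, hv', rfl, rfl⟩⟩
      have := levelKey_injective h'
      simp [south, west] at this
  · rintro ⟨a, b⟩ _ ⟨a', b'⟩ _
    split_ifs <;> simp [west, south]
  · rintro ⟨x, y⟩ h
    simp only [Finset.mem_filter, Finset.mem_univ, true_and] at h
    obtain ⟨h1, ⟨v, hv, rfl, rfl⟩ | ⟨v, hv, rfl, rfl⟩⟩ := h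
    · exact ⟨v, hv, by simp [h1]⟩
    · exact ⟨v, hv, by simp [h1.not_gt]⟩

/-- The sign relating the number of crossings to the signature of a generalised snake
configuration with given fluxes. -/
def fluxSign (n P Q : ℕ) : ℤ := (-1) ^ (n * (P + Q) + P + Q + P * Q)

theorem sign_genSnake : ((Equiv.Perm.sign ρ.1 : ℤˣ) : ℤ) =
    (-1) ^ numCrossings n ρ * fluxSign n (fluxE (moved ρ.1)) (fluxN (moved ρ.1)) := by
  classical
  have hprod : ∀ (q : MidEdge (ZMod n) × MidEdge (ZMod n) → Prop) [DecidablePred q],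
      ∏ p, (if q p then (-1 : ℤˣ) else 1) = (-1) ^ (Finset.univ.filter q).card := by
    intro q _
    rw [Finset.prod_ite]; simp
  rw [prod_inversions, hprod, hprod, hprod, card_level_wrap, card_pos_wrap, card_crossAt]
  push_cast
  rw [mul_comm, fluxSign]
  congr 1
  rw [← pow_add]
  generalize fluxE (moved ρ.1) = P
  generalize fluxN (moved ρ.1) = Q
  obtain ⟨m, rfl⟩ : ∃ m, n = m + 1 := ⟨n - 1, by have := NeZero.pos n; omega⟩
  -- The exponents (n - 1)(P + Q)² + P(P + Q - 1) and that of `fluxSign` agree modulo 2; the case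
  -- split removes the truncated subtraction.
  rcases P with _ | P
  · simp only [zero_add, add_tsub_cancel_right, zero_mul, add_zero]
    apply neg_one_pow_congr
    simp only [Nat.even_add, Nat.even_mul, Nat.even_add_one]
    tauto
  · rw [show P + 1 + Q - 1 = P + Q by omega, Nat.add_sub_cancel]
    apply neg_one_pow_congr
    simp only [Nat.even_add, Nat.even_mul, Nat.even_add_one]
    tauto

end SignFormula

/-! ### Determinants with prescribed entries. -/

section Restrict

variable {X : Type*} [Fintype X] [DecidableEq X] {k : ℕ}

/-- The matrix `K` with all entries violating the constraints `x i ↦ y i` set to zero. -/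
def restrictMatrix (K : Matrix X X ℂ) (x y : Fin k → X) : Matrix X X ℂ :=
  Matrix.of fun u v => if ∀ i, x i = u → y i = v then K u v else 0

/-- Multiplied by the inverse G, the restricted matrix differs from the identity only in the k rows
`x i`. It is a perturbation of rank at most k, so det(1 + UV) = det(1 + VU) reduces the determinant
to size k. -/
theorem det_restrictMatrix (K G : Matrix X X ℂ) (hKG : K * G = 1) (x y : Fin k → X)
    (hx : Function.Injective x) :
    (restrictMatrix K x y).det =
      K.det * ((∏ i, K (x i) (y i)) * (Matrix.of fun i j => G (y i) (x j)).det) := by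
  let U : Matrix X (Fin k) ℂ := Matrix.of fun u i => if u = x i then 1 else 0
  let V : Matrix (Fin k) X ℂ := Matrix.of fun i v =>
    K (x i) (y i) * G (y i) v - if x i = v then 1 else 0
  have h1 : restrictMatrix K x y * G = 1 + U * V := by
    ext u v
    rw [Matrix.mul_apply, Matrix.add_apply, Matrix.mul_apply]
    by_cases hu : ∃ i, x i = u
    · obtain ⟨i, rfl⟩ := hu
      have h2 : ∀ w, restrictMatrix K x y (x i) w = if w = y i then K (x i) (y i) else 0 := by
        intro w
        simp only [restrictMatrix, Matrix.of_apply, hx.eq_iff]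
        by_cases hw : w = y i
        · subst hw; simp
        · rw [if_neg hw, if_neg]
          intro h; exact hw (h i rfl).symm
      simp only [h2, U, V, Matrix.of_apply, hx.eq_iff, Matrix.one_apply]
      simp
    · push Not at hu
      have h2 : ∀ w, restrictMatrix K x y u w = K u w := by
        intro w
        simp [restrictMatrix, hu]
      have h3 : ∀ i, U u i = 0 := fun i => by simp [U, (hu i).symm]
      simp only [h2, h3, zero_mul, Finset.sum_const_zero, add_zero]
      rw [← Matrix.mul_apply, hKG]
  have h2 : 1 + V * U = Matrix.of fun i j => K (x i) (y i) * G (y i) (x j) := by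
    ext i j
    simp only [Matrix.add_apply, Matrix.mul_apply, U, V, Matrix.of_apply, Matrix.one_apply]
    simp [hx.eq_iff]
  have h3 : K.det * G.det = 1 := by rw [← Matrix.det_mul, hKG, Matrix.det_one]
  have h4 : (restrictMatrix K x y).det * G.det =
      (∏ i, K (x i) (y i)) * (Matrix.of fun i j => G (y i) (x j)).det := by
    rw [← Matrix.det_mul, h1, Matrix.det_one_add_mul_comm, h2, ← Matrix.det_mul_column]
    rfl
  rw [← h4]
  linear_combination -(restrictMatrix K x y).det * h3

end Restrict

/-! ### The twisted Kasteleyn matrix and its flux generating function. -/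

/-- The weight of the step from `x` to `y`. -/
def stepWeight {R : Type} [AddCommGroupWithOne R] [DecidableEq R] {𝕜 : Type*}
    [CommRing 𝕜] (a b c : 𝕜) (x y : MidEdge R) : 𝕜 :=
  if y = x then 1 else if y = x.addE3 then c else
    if y = x.straight then (match x.1 with
      | Colour.B => a
      | Colour.W => b) else 0

/-- The Kasteleyn matrix on the torus. -/
def torusMatrix (n : ℕ) (a b c : ℂ) : Matrix (MidEdge (ZMod n)) (MidEdge (ZMod n)) ℂ :=
  Matrix.of fun x y => stepWeight a b c x y

section Twisted

variable {n : ℕ} [NeZero n] [Fact (1 < n)]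

theorem prod_stepWeight {𝕜 : Type*} [CommRing 𝕜] (a b c : 𝕜) (ρ : GenSnake (ZMod n)) :
    ∏ x, stepWeight a b c x (ρ.1 x) = a ^ numE1 n ρ * b ^ numE2 n ρ * c ^ numE3 n ρ := by
  have h : ∀ x, stepWeight a b c x (ρ.1 x) = (if ρ.1 x = x.addE1 then a else 1) *
      (if ρ.1 x = x.addE2 then b else 1) * (if ρ.1 x = x.addE3 then c else 1) := by
    rintro ⟨col, p, q⟩
    cases col
    · rcases genSnake_black ρ p q with h | h | h <;>
        simp [h, stepWeight, addE1, addE2, addE3, straight]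
    · rcases genSnake_white ρ p q with h | h | h <;>
        simp [h, stepWeight, addE1, addE2, addE3, straight]
  simp only [h, Finset.prod_mul_distrib, Finset.prod_ite, Finset.prod_const, one_pow, mul_one]
  rfl

theorem det_eq_sum_genSnake (M : Matrix (MidEdge (ZMod n)) (MidEdge (ZMod n)) ℂ)
    (hM : ∀ x y, y ≠ x → y ≠ x.addE3 → y ≠ x.straight → M x y = 0) :
    M.det = ∑ ρ : GenSnake (ZMod n), ((Equiv.Perm.sign ρ.1 : ℤˣ) : ℂ) * ∏ x, M x (ρ.1 x) := by
  classical
  rw [← Matrix.det_transpose, Matrix.det_apply']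
  simp only [Matrix.transpose_apply]
  rw [← Finset.sum_filter_add_sum_filter_not Finset.univ
    (fun σ : Equiv.Perm (MidEdge (ZMod n)) => IsGenSnake σ)]
  rw [Finset.sum_eq_zero (s := Finset.univ.filter fun σ => ¬ IsGenSnake σ), add_zero]
  · exact Finset.sum_subtype _ (by simp) _
  · intro σ hσ
    simp only [Finset.mem_filter, Finset.mem_univ, true_and, IsGenSnake, not_forall, not_or] at hσ
    obtain ⟨x, h1, h2, h3⟩ := hσ
    rw [Finset.prod_eq_zero (Finset.mem_univ x) (hM x (σ x) h1 h2 h3), mul_zero]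

variable {k : ℕ}

/-- The generating function of the fluxes of the configurations with `ρ (x i) = y i`, with signs
that make it a determinant. -/
noncomputable def twistedSum (α β γ : ℝ) (x y : Fin k → MidEdge (ZMod n)) (z₁ z₂ : ℂ) : ℂ :=
  ∑ ρ : GenSnake (ZMod n), if ∀ i, ρ.1 (x i) = y i then
    (snakeWeight n α β γ ρ : ℂ) * fluxSign n (fluxE (moved ρ.1)) (fluxN (moved ρ.1)) *
      z₁ ^ fluxE (moved ρ.1) * z₂ ^ fluxN (moved ρ.1) else 0

/-- In the Leibniz expansion only configurations obeying the constraints survive. `sign_genSnake`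
supplies their signs, and the exponents of v₁ and v₂ are 2n times the fluxes. -/
theorem det_torusMatrix_restrict (α β γ : ℝ) (v₁ v₂ : ℂ) (x y : Fin k → MidEdge (ZMod n)) :
    (restrictMatrix (torusMatrix n (α * v₁ ^ 2) (β * v₂ ^ 2) (γ * v₁ * v₂)) x y).det =
      twistedSum α β γ x y (v₁ ^ (2 * n)) (v₂ ^ (2 * n)) := by
  classical
  rw [det_eq_sum_genSnake]
  · refine Finset.sum_congr rfl fun ρ _ => ?_
    split_ifs with hE
    · have h1 : ∏ u, restrictMatrix (torusMatrix n (α * v₁ ^ 2) (β * v₂ ^ 2) (γ * v₁ * v₂)) x y u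
          (ρ.1 u) = ∏ u, stepWeight (α * v₁ ^ 2) (β * v₂ ^ 2) (γ * v₁ * v₂) u (ρ.1 u) := by
        refine Finset.prod_congr rfl fun u _ => ?_
        rw [restrictMatrix, Matrix.of_apply, if_pos]
        · rfl
        · rintro i rfl
          exact (hE i).symm
      rw [h1, prod_stepWeight]
      have h2 : ((Equiv.Perm.sign ρ.1 : ℤˣ) : ℂ) = (((Equiv.Perm.sign ρ.1 : ℤˣ) : ℤ) : ℂ) := rfl
      rw [h2, sign_genSnake, snakeWeight, ← pow_mul, ← pow_mul, ← two_mul_numE1_add,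
        ← two_mul_numE2_add]
      push_cast
      ring
    · push Not at hE
      obtain ⟨i, hi⟩ := hE
      rw [Finset.prod_eq_zero (Finset.mem_univ (x i)), mul_zero]
      rw [restrictMatrix, Matrix.of_apply, if_neg]
      intro h
      exact hi (h i rfl).symm
  · intro u v h1 h2 h3
    simp [restrictMatrix, torusMatrix, stepWeight, h1, h2, h3]

theorem det_torusMatrix (α β γ : ℝ) (v₁ v₂ : ℂ) :
    (torusMatrix n (α * v₁ ^ 2) (β * v₂ ^ 2) (γ * v₁ * v₂)).det =
      twistedSum α β γ (n := n) (Fin.elim0 : Fin 0 → _) (Fin.elim0 : Fin 0 → _)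
        (v₁ ^ (2 * n)) (v₂ ^ (2 * n)) := by
  rw [← det_torusMatrix_restrict]
  congr 1

/-- The combination of the four twisted sums that removes the flux signs. -/
theorem sum_twistedSum (α β γ : ℝ) (x y : Fin k → MidEdge (ZMod n)) (s : ℂ) :
    ∑ ρ : GenSnake (ZMod n), (if ∀ i, ρ.1 (x i) = y i then
      (snakeWeight n α β γ ρ : ℂ) * s ^ fluxN (moved ρ.1) else 0) =
    (-twistedSum α β γ x y ((-1) ^ n) ((-1) ^ n * s) +
      twistedSum α β γ x y (-(-1) ^ n) ((-1) ^ n * s) +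
      twistedSum α β γ x y ((-1) ^ n) (-(-1) ^ n * s) +
      twistedSum α β γ x y (-(-1) ^ n) (-(-1) ^ n * s)) / 2 := by
  classical
  simp only [twistedSum, ← Finset.sum_neg_distrib, ← Finset.sum_add_distrib]
  rw [Finset.sum_div]
  refine Finset.sum_congr rfl fun ρ _ => ?_
  split_ifs
  · generalize fluxE (moved ρ.1) = P
    generalize fluxN (moved ρ.1) = Q
    rw [fluxSign]
    push_cast
    -- Twisting by (-1)^n absorbs n(P + Q). What is left is the Arf-type identity (-1)^(P+Q+PQ) =
    -- (-1 + (-1)^P + (-1)^Q + (-1)^(P+Q)) / 2.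
    have key : (1 : ℂ) = (-1) ^ (n * (P + Q) + P + Q + P * Q) *
        (-(((-1) ^ n) ^ P * ((-1) ^ n) ^ Q) + (-(-1) ^ n) ^ P * ((-1) ^ n) ^ Q +
        ((-1) ^ n) ^ P * (-(-1) ^ n) ^ Q + (-(-1) ^ n) ^ P * (-(-1) ^ n) ^ Q) / 2 := by
      rcases Nat.even_or_odd n with hn | hn <;> rcases Nat.even_or_odd P with hP | hP <;>
        rcases Nat.even_or_odd Q with hQ | hQ <;>
        simp [pow_add, pow_mul, hn.neg_one_pow, hP.neg_one_pow, hQ.neg_one_pow]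
    simp only [mul_pow]
    linear_combination (snakeWeight n α β γ ρ : ℂ) * s ^ Q * key
  · simp

end Twisted

/-! ### Cancellation among configurations with the same moved set. -/

/-- A signed sum over subsets, weighted by a function of the intersection with `V`, is controlled
by the unweighted sum. -/
theorem abs_sum_powerset_le {ι : Type*} [DecidableEq ι] (F V : Finset ι) (ψ : Finset ι → ℝ)
    (hψ : ∀ T, |ψ T| ≤ 1) (hV : ∀ T ⊆ F, ∀ T' ⊆ F, (∀ v ∈ V, v ∈ T ↔ v ∈ T') → ψ T = ψ T') {x : ℝ}
    (hx0 : 0 ≤ x) (hx1 : x < 1) :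
    |∑ T ∈ F.powerset, ψ T * (-x) ^ T.card| ≤ (2 / (1 - x)) ^ V.card * (1 - x) ^ F.card := by
  have hx : 0 < 1 - x := by linarith
  -- An element outside V is invisible to ψ, so summing over its membership gives the exact factor 1
  -- - x. Only the sum over subsets of F ∩ V is estimated crudely, by their number.
  have h1 : ∀ G : Finset ι, Disjoint G V → ∀ H ⊆ V, G ∪ H ⊆ F →
      ∑ T ∈ (G ∪ H).powerset, ψ T * (-x) ^ T.card =
        (1 - x) ^ G.card * ∑ T ∈ H.powerset, ψ T * (-x) ^ T.card := by
    intro G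
    induction G using Finset.induction_on with
    | empty => intro _ H _ _; simp
    | insert a G ha ih =>
      intro hG H hH hF
      rw [Finset.disjoint_insert_left] at hG
      have haH : a ∉ H := fun h => hG.1 (hH h)
      have haGH : a ∉ G ∪ H := by simp [ha, haH]
      rw [Finset.insert_union] at hF ⊢
      have hF' := (Finset.subset_insert _ _).trans hF
      rw [Finset.sum_powerset_insert haGH, Finset.card_insert_of_notMem ha]
      have h2 : ∑ T ∈ (G ∪ H).powerset, ψ (insert a T) * (-x) ^ (insert a T).card =
          (-x) * ∑ T ∈ (G ∪ H).powerset, ψ T * (-x) ^ T.card := by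
        rw [Finset.mul_sum]
        refine Finset.sum_congr rfl fun T hT => ?_
        have hT' := Finset.mem_powerset.1 hT
        rw [Finset.card_insert_of_notMem (fun h => haGH (hT' h)),
          hV (insert a T) ((Finset.insert_subset_insert a hT').trans hF) T (hT'.trans hF') ?_]
        · ring
        · intro v hv
          have : v ≠ a := fun h => hG.1 (h ▸ hv)
          simp [this]
      rw [h2, ih hG.2 H hH hF']
      ring
  have h2 := h1 (F \ V) Finset.sdiff_disjoint (F ∩ V) Finset.inter_subset_right
    (by rw [Finset.sdiff_union_inter])
  rw [Finset.sdiff_union_inter] at h2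
  rw [h2, abs_mul, abs_of_pos (pow_pos hx _)]
  have h3 : |∑ T ∈ (F ∩ V).powerset, ψ T * (-x) ^ T.card| ≤ 2 ^ (F ∩ V).card := by
    refine (Finset.abs_sum_le_sum_abs _ _).trans ?_
    refine (Finset.sum_le_card_nsmul _ _ 1 fun T _ => ?_).trans ?_
    · rw [abs_mul, abs_pow, abs_neg, abs_of_nonneg hx0]
      exact mul_le_one₀ (hψ T) (by positivity) (pow_le_one₀ hx0 hx1.le)
    · rw [Finset.card_powerset]; simp
  have h4 : (F \ V).card + (F ∩ V).card = F.card := by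
    rw [← Finset.card_union_of_disjoint (Finset.disjoint_sdiff_inter F V),
      Finset.sdiff_union_inter]
  calc (1 - x) ^ (F \ V).card * |∑ T ∈ (F ∩ V).powerset, ψ T * (-x) ^ T.card|
      ≤ (1 - x) ^ (F \ V).card * 2 ^ (F ∩ V).card := by gcongr
    _ = (2 / (1 - x)) ^ (F ∩ V).card * (1 - x) ^ F.card := by
        rw [← h4, pow_add, div_pow]; field_simp
    _ ≤ (2 / (1 - x)) ^ V.card * (1 - x) ^ F.card := by
        gcongr
        · rw [le_div_iff₀ hx]; linarith
        · exact Finset.inter_subset_right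

section Toggle

variable {n : ℕ} [NeZero n] [Fact (1 < n)]

/-- The vertices all of whose incoming mid-edges lie in `Y`. -/
def fullSet (Y : Finset (MidEdge (ZMod n))) : Finset (ZMod n × ZMod n) :=
  Finset.univ.filter fun v => west v ∈ Y ∧ south v ∈ Y

theorem west_cases (ρ : GenSnake (ZMod n)) (v : ZMod n × ZMod n) :
    ρ.1 (west v) = west v ∨ ρ.1 (west v) = north v ∨ ρ.1 (west v) = east v := by
  have := genSnake_black ρ (v.1 - 1) v.2
  rwa [sub_add_cancel] at this

theorem south_cases (ρ : GenSnake (ZMod n)) (v : ZMod n × ZMod n) :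
    ρ.1 (south v) = south v ∨ ρ.1 (south v) = east v ∨ ρ.1 (south v) = north v := by
  have := genSnake_white ρ v.1 (v.2 - 1)
  rwa [sub_add_cancel] at this

theorem incident_ne (v : ZMod n × ZMod n) : west v ≠ east v ∧ west v ≠ north v ∧
    west v ≠ south v ∧ south v ≠ east v ∧ south v ≠ north v ∧ east v ≠ north v := by
  simp [west, east, north, south, Prod.ext_iff]

theorem eq_of_apply_eq_east (ρ : GenSnake (ZMod n)) {u : MidEdge (ZMod n)} {v : ZMod n × ZMod n}
    (h : ρ.1 u = east v) : u = east v ∨ u = west v ∨ u = south v := by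
  obtain ⟨c, a, b⟩ := u
  cases c
  · rcases genSnake_black ρ a b with h' | h' | h' <;> rw [h'] at h <;>
      simp [east, west, south] at h ⊢ <;> grind
  · rcases genSnake_white ρ a b with h' | h' | h' <;> rw [h'] at h <;>
      simp [east, west, south] at h ⊢ <;> grind

theorem eq_of_apply_eq_north (ρ : GenSnake (ZMod n)) {u : MidEdge (ZMod n)} {v : ZMod n × ZMod n}
    (h : ρ.1 u = north v) : u = north v ∨ u = west v ∨ u = south v := by
  obtain ⟨c, a, b⟩ := u
  cases c
  · rcases genSnake_black ρ a b with h' | h' | h' <;> rw [h'] at h <;>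
      simp [north, west, south] at h ⊢ <;> grind
  · rcases genSnake_white ρ a b with h' | h' | h' <;> rw [h'] at h <;>
      simp [north, west, south] at h ⊢ <;> grind

theorem east_mem_moved_iff (ρ : GenSnake (ZMod n)) (v : ZMod n × ZMod n) :
    ρ.1 (east v) ≠ east v ↔ ρ.1 (west v) = east v ∨ ρ.1 (south v) = east v := by
  obtain ⟨h1, h2, h3, h4, h5, h6⟩ := incident_ne v
  constructor
  · intro h
    obtain ⟨u, hu⟩ := ρ.1.surjective (east v)
    rcases eq_of_apply_eq_east ρ hu with rfl | rfl | rfl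
    · exact absurd hu h
    · exact Or.inl hu
    · exact Or.inr hu
  · rintro (h | h) h' <;> have := ρ.1.injective (h.trans h'.symm) <;> contradiction

theorem north_mem_moved_iff (ρ : GenSnake (ZMod n)) (v : ZMod n × ZMod n) :
    ρ.1 (north v) ≠ north v ↔ ρ.1 (west v) = north v ∨ ρ.1 (south v) = north v := by
  obtain ⟨h1, h2, h3, h4, h5, h6⟩ := incident_ne v
  constructor
  · intro h
    obtain ⟨u, hu⟩ := ρ.1.surjective (north v)
    rcases eq_of_apply_eq_north ρ hu with rfl | rfl | rfl
    · exact absurd hu h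
    · exact Or.inl hu
    · exact Or.inr hu
  · rintro (h | h) h' <;> have := ρ.1.injective (h.trans h'.symm) <;> contradiction

/-- The moved set and the crossings determine the configuration locally. -/
theorem local_determined {ρ ρ' : GenSnake (ZMod n)} (hY : moved ρ.1 = moved ρ'.1)
    {v : ZMod n × ZMod n} (hv : v ∈ crossSet ρ.1 ↔ v ∈ crossSet ρ'.1) :
    ρ.1 (west v) = ρ'.1 (west v) ∧ ρ.1 (south v) = ρ'.1 (south v) := by
  have hm : ∀ x, ρ.1 x ≠ x ↔ ρ'.1 x ≠ x := fun x => by rw [← mem_moved, hY, mem_moved]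
  obtain ⟨h1, h2, h3, h4, h5, h6⟩ := incident_ne v
  rw [mem_crossSet, mem_crossSet] at hv
  have e1 := hm (west v)
  have e2 := hm (south v)
  have e3 := (east_mem_moved_iff ρ v).symm.trans ((hm (east v)).trans (east_mem_moved_iff ρ' v))
  have e4 := (north_mem_moved_iff ρ v).symm.trans
    ((hm (north v)).trans (north_mem_moved_iff ρ' v))
  have i1 : ρ.1 (west v) ≠ ρ.1 (south v) := fun h => h3 (ρ.1.injective h)
  have i2 : ρ'.1 (west v) ≠ ρ'.1 (south v) := fun h => h3 (ρ'.1.injective h)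
  have a := west_cases ρ v
  have b := south_cases ρ v
  have c := west_cases ρ' v
  have d := south_cases ρ' v
  clear hm hY
  generalize ρ.1 (west v) = A at *
  generalize ρ.1 (south v) = B at *
  generalize ρ'.1 (west v) = C at *
  generalize ρ'.1 (south v) = D at *
  grind

theorem crossSet_subset_fullSet (ρ : GenSnake (ZMod n)) : crossSet ρ.1 ⊆ fullSet (moved ρ.1) := by
  intro v hv
  obtain ⟨h1, h2, h3, h4, h5, h6⟩ := incident_ne v
  rw [mem_crossSet] at hv
  simp [fullSet, hv, h1.symm, h5.symm]

theorem full_cases {ρ : GenSnake (ZMod n)} {v : ZMod n × ZMod n} (hv : v ∈ fullSet (moved ρ.1)) :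
    (ρ.1 (west v) = east v ∧ ρ.1 (south v) = north v) ∨
      (ρ.1 (west v) = north v ∧ ρ.1 (south v) = east v) := by
  obtain ⟨h1, h2, h3, h4, h5, h6⟩ := incident_ne v
  simp only [fullSet, Finset.mem_filter, Finset.mem_univ, true_and, mem_moved] at hv
  have i1 : ρ.1 (west v) ≠ ρ.1 (south v) := fun h => h3 (ρ.1.injective h)
  have a := west_cases ρ v
  have b := south_cases ρ v
  grind

/-- Exchanging the images of the two mid-edges entering v turns a crossing into two diagonal steps
and conversely, and changes nothing else. -/
theorem exists_toggle {ρ : GenSnake (ZMod n)} {v : ZMod n × ZMod n}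
    (hv : v ∈ fullSet (moved ρ.1)) : ∃ ρ' : GenSnake (ZMod n), moved ρ'.1 = moved ρ.1 ∧
      ∀ u, u ∈ crossSet ρ'.1 ↔ ¬ (u ∈ crossSet ρ.1 ↔ u = v) := by
  obtain ⟨h1, h2, h3, h4, h5, h6⟩ := incident_ne v
  have hf := full_cases hv
  have sw : ∀ x, x ≠ west v → x ≠ south v → (Equiv.swap (west v) (south v)) x = x :=
    fun x => Equiv.swap_apply_of_ne_of_ne
  have st : (west v).straight = east v ∧ (west v).addE3 = north v ∧
      (south v).straight = north v ∧ (south v).addE3 = east v := by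
    simp [west, south, east, north, straight, addE1, addE2, addE3]
  refine ⟨⟨(Equiv.swap (west v) (south v)).trans ρ.1, ?_⟩, ?_, ?_⟩
  · intro x
    by_cases hx : x = west v
    · subst hx
      simp only [Equiv.trans_apply, Equiv.swap_apply_left]
      grind
    by_cases hx' : x = south v
    · subst hx'
      simp only [Equiv.trans_apply, Equiv.swap_apply_right]
      grind
    · simp only [Equiv.trans_apply, sw x hx hx']
      exact ρ.2 x
  · ext x
    simp only [mem_moved, Equiv.trans_apply]
    by_cases hx : x = west v
    · subst hx
      simp only [Equiv.swap_apply_left]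
      grind
    by_cases hx' : x = south v
    · subst hx'
      simp only [Equiv.swap_apply_right]
      grind
    · rw [sw x hx hx']
  · intro u
    simp only [mem_crossSet, Equiv.trans_apply]
    by_cases hu : u = v
    · subst hu
      simp only [Equiv.swap_apply_left, Equiv.swap_apply_right]
      grind
    · have j1 : west u ≠ west v := fun h => hu (by simp [west] at h; exact Prod.ext h.1 h.2)
      have j2 : south u ≠ south v := fun h => hu (by simp [south] at h; exact Prod.ext h.1 h.2)
      have j3 : west u ≠ south v := by simp [west, south]
      have j4 : south u ≠ west v := by simp [west, south]
      rw [sw _ j1 j3, sw _ j4 j2]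
      simp [hu]

theorem exists_crossSet_eq (ρ : GenSnake (ZMod n)) {T : Finset (ZMod n × ZMod n)}
    (hT : T ⊆ fullSet (moved ρ.1)) :
    ∃ ρ' : GenSnake (ZMod n), moved ρ'.1 = moved ρ.1 ∧ crossSet ρ'.1 = T := by
  have key : ∀ S : Finset (ZMod n × ZMod n), S ⊆ fullSet (moved ρ.1) →
      ∃ ρ' : GenSnake (ZMod n), moved ρ'.1 = moved ρ.1 ∧
        ∀ u, u ∈ crossSet ρ'.1 ↔ ¬ (u ∈ crossSet ρ.1 ↔ u ∈ S) := by
    intro S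
    induction S using Finset.induction_on with
    | empty => intro _; exact ⟨ρ, rfl, by simp⟩
    | insert a S ha ih =>
      intro hS
      rw [Finset.insert_subset_iff] at hS
      obtain ⟨ρ', h1, h2⟩ := ih hS.2
      obtain ⟨ρ'', h3, h4⟩ := exists_toggle (ρ := ρ') (v := a) (by rw [h1]; exact hS.1)
      refine ⟨ρ'', h3.trans h1, fun u => ?_⟩
      rw [h4, h2, Finset.mem_insert]
      by_cases hu : u = a
      · subst hu; simp [ha]
      · simp [hu]
  obtain ⟨ρ', h1, h2⟩ := key (symmDiff (crossSet ρ.1) T) (by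
    intro u hu
    rw [Finset.mem_symmDiff] at hu
    rcases hu with h | h
    · exact crossSet_subset_fullSet ρ h.1
    · exact hT h.1)
  refine ⟨ρ', h1, ?_⟩
  ext u
  rw [h2, Finset.mem_symmDiff]
  tauto

end Toggle

section Fibre

variable {n : ℕ} [NeZero n] [Fact (1 < n)]

/-- Every mid-edge enters exactly one vertex, so weights factor over vertices. -/
theorem prod_eq_prod_vertices {M : Type*} [CommMonoid M] (f : MidEdge (ZMod n) → M) :
    ∏ x, f x = ∏ v : ZMod n × ZMod n, f (west v) * f (south v) := by
  have hU : (Finset.univ : Finset Colour) = {Colour.B, Colour.W} := rfl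
  rw [Fintype.prod_prod_type, hU, Finset.prod_pair (by simp), Finset.prod_mul_distrib]
  congr 1
  · exact ((Equiv.prodCongr (Equiv.subRight (1 : ZMod n)) (Equiv.refl (ZMod n))).prod_comp
      (fun p => f (Colour.B, p))).symm
  · exact ((Equiv.prodCongr (Equiv.refl (ZMod n)) (Equiv.subRight (1 : ZMod n))).prod_comp
      (fun p => f (Colour.W, p))).symm

theorem snakeWeight_eq (α β γ : ℝ) (ρ : GenSnake (ZMod n)) :
    snakeWeight n α β γ ρ = (-1) ^ (crossSet ρ.1).card * ∏ x, stepWeight α β γ x (ρ.1 x) := by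
  rw [prod_stepWeight, snakeWeight]
  have : numCrossings n ρ = (crossSet ρ.1).card := rfl
  rw [this]
  ring

/-- A crossing contributes -αβ and the two diagonal steps replacing it contribute γ²; at all other
vertices the two configurations agree by `local_determined`. -/
theorem snakeWeight_uncross {α β γ : ℝ} (hγ : γ ≠ 0) {ρ ρ₀ : GenSnake (ZMod n)}
    (hY : moved ρ.1 = moved ρ₀.1) (h0 : crossSet ρ₀.1 = ∅) :
    snakeWeight n α β γ ρ =
      snakeWeight n α β γ ρ₀ * (-(α * β / γ ^ 2)) ^ (crossSet ρ.1).card := by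
  rw [snakeWeight_eq, snakeWeight_eq, h0, prod_eq_prod_vertices, prod_eq_prod_vertices]
  have h1 : ∀ v, stepWeight α β γ (west v) (ρ.1 (west v)) *
      stepWeight α β γ (south v) (ρ.1 (south v)) =
      stepWeight α β γ (west v) (ρ₀.1 (west v)) * stepWeight α β γ (south v) (ρ₀.1 (south v)) *
        (if v ∈ crossSet ρ.1 then α * β / γ ^ 2 else 1) := by
    intro v
    have h0v : v ∉ crossSet ρ₀.1 := by simp [h0]
    split_ifs with hv
    · have hf := crossSet_subset_fullSet ρ hv
      rw [hY] at hf
      rw [mem_crossSet] at hv h0v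
      rcases full_cases hf with h | h
      · exact absurd h h0v
      · rw [hv.1, hv.2, h.1, h.2]
        simp [stepWeight, west, south, east, north, addE3, straight, addE1, addE2, Prod.ext_iff, eq_sub_iff_add_eq]
        field_simp
    · obtain ⟨e1, e2⟩ := local_determined hY (v := v) (by tauto)
      rw [e1, e2, mul_one]
  simp only [h1]
  rw [Finset.prod_mul_distrib, Finset.prod_ite]
  simp only [Finset.prod_const, Finset.card_empty, pow_zero,
    one_mul, Finset.filter_mem_eq_inter, Finset.univ_inter]
  rw [neg_pow (α * β / γ ^ 2)]
  ring

theorem snakeWeight_pos_of_crossSet_eq_empty {α β γ : ℝ} (hα : 0 < α) (hβ : 0 < β) (hγ : 0 < γ)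
    {ρ : GenSnake (ZMod n)} (h0 : crossSet ρ.1 = ∅) : 0 < snakeWeight n α β γ ρ := by
  have : numCrossings n ρ = 0 := by
    rw [show numCrossings n ρ = (crossSet ρ.1).card from rfl, h0]; rfl
  rw [snakeWeight, this]
  positivity

theorem eq_of_moved_eq {ρ ρ' : GenSnake (ZMod n)} (hY : moved ρ.1 = moved ρ'.1)
    (hc : crossSet ρ.1 = crossSet ρ'.1) : ρ = ρ' := by
  apply Subtype.ext
  ext1 x
  obtain ⟨c, a, b⟩ := x
  cases c
  · have := (local_determined hY (v := (a + 1, b)) (by rw [hc])).1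
    simpa [west] using this
  · have := (local_determined hY (v := (a, b + 1)) (by rw [hc])).2
    simpa [south] using this

open Classical in
/-- The sum over the configurations with a given moved set as a sum over crossing sets. -/
theorem exists_fibre_sum {α β γ : ℝ} (hα : 0 < α) (hβ : 0 < β) (hγ : 0 < γ)
    (Y : Finset (MidEdge (ZMod n)))
    (hY : ∃ ρ : GenSnake (ZMod n), moved ρ.1 = Y) :
    ∃ (w : ℝ) (r : Finset (ZMod n × ZMod n) → GenSnake (ZMod n)), 0 < w ∧
      (∀ T ⊆ fullSet Y, moved (r T).1 = Y ∧ crossSet (r T).1 = T) ∧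
      ∀ ψ : GenSnake (ZMod n) → ℝ,
        ∑ ρ ∈ Finset.univ.filter (fun ρ : GenSnake (ZMod n) => moved ρ.1 = Y),
          snakeWeight n α β γ ρ * ψ ρ =
        w * ∑ T ∈ (fullSet Y).powerset, ψ (r T) * (-(α * β / γ ^ 2)) ^ T.card := by
  obtain ⟨ρ₁, rfl⟩ := hY
  obtain ⟨ρ₀, hρ₀, h0⟩ := exists_crossSet_eq ρ₁ (Finset.empty_subset _)
  have hex : ∀ T : Finset (ZMod n × ZMod n), ∃ ρ' : GenSnake (ZMod n),
      T ⊆ fullSet (moved ρ₁.1) → moved ρ'.1 = moved ρ₁.1 ∧ crossSet ρ'.1 = T := by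
    intro T
    by_cases hT : T ⊆ fullSet (moved ρ₁.1)
    · obtain ⟨ρ', h⟩ := exists_crossSet_eq ρ₁ hT
      exact ⟨ρ', fun _ => h⟩
    · exact ⟨ρ₁, fun h => absurd h hT⟩
  choose r hr using hex
  refine ⟨snakeWeight n α β γ ρ₀, r, snakeWeight_pos_of_crossSet_eq_empty hα hβ hγ h0, hr, ?_⟩
  intro ψ
  rw [Finset.mul_sum]
  symm
  refine Finset.sum_bij (fun T _ => r T) ?_ ?_ ?_ ?_
  · intro T hT
    simp [(hr T (Finset.mem_powerset.1 hT)).1]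
  · intro T hT T' hT' h
    rw [← (hr T (Finset.mem_powerset.1 hT)).2, ← (hr T' (Finset.mem_powerset.1 hT')).2, h]
  · intro ρ hρ
    have hρ' : moved ρ.1 = moved ρ₁.1 := by simpa using hρ
    have hsub : crossSet ρ.1 ⊆ fullSet (moved ρ₁.1) := hρ' ▸ crossSet_subset_fullSet ρ
    refine ⟨crossSet ρ.1, Finset.mem_powerset.2 hsub, ?_⟩
    exact eq_of_moved_eq ((hr _ hsub).1.trans hρ'.symm) (hr _ hsub).2
  · intro T hT
    obtain ⟨h1, h2⟩ := hr T (Finset.mem_powerset.1 hT)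
    rw [snakeWeight_uncross hγ.ne' (h1.trans hρ₀.symm) h0, h2]
    ring

/-- The vertex towards which a mid-edge points. -/
def head (x : MidEdge (ZMod n)) : ZMod n × ZMod n :=
  match x.1 with
  | Colour.B => (x.2.1 + 1, x.2.2)
  | Colour.W => (x.2.1, x.2.2 + 1)

theorem apply_eq_of_local {ρ ρ' : GenSnake (ZMod n)} (hY : moved ρ.1 = moved ρ'.1)
    {x : MidEdge (ZMod n)} (hx : head x ∈ crossSet ρ.1 ↔ head x ∈ crossSet ρ'.1) :
    ρ.1 x = ρ'.1 x := by
  obtain ⟨h1, h2⟩ := local_determined hY hx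
  obtain ⟨c, a, b⟩ := x
  cases c
  · simpa [west, head] using h1
  · simpa [south, head] using h2

variable {α β γ : ℝ} (hα : 0 < α) (hβ : 0 < β) (hγ : 0 < γ) (hαβγ : 0 < γ ^ 2 - α * β)

include hα hβ hγ hαβγ

theorem ratio_bounds : 0 ≤ α * β / γ ^ 2 ∧ α * β / γ ^ 2 < 1 := by
  refine ⟨by positivity, ?_⟩
  rw [div_lt_one (by positivity)]
  linarith

/-- By the binomial theorem the sum is a positive weight times (1 - αβ/γ²) to the number of full
vertices, and γ² > αβ makes the base positive. -/
theorem fibre_sum_nonneg (Y : Finset (MidEdge (ZMod n))) : 0 ≤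
    ∑ ρ ∈ Finset.univ.filter (fun ρ : GenSnake (ZMod n) => moved ρ.1 = Y),
      snakeWeight n α β γ ρ := by
  by_cases hY : ∃ ρ : GenSnake (ZMod n), moved ρ.1 = Y
  · obtain ⟨w, r, hw, -, hs⟩ := exists_fibre_sum hα hβ hγ Y hY
    have := hs (fun _ => 1)
    simp only [mul_one, one_mul] at this
    rw [this]
    refine mul_nonneg hw.le ?_
    have h1 := Finset.sum_pow_mul_eq_add_pow (-(α * β / γ ^ 2)) 1 (fullSet Y)
    simp only [one_pow, mul_one] at h1
    rw [h1]
    obtain ⟨h2, h3⟩ := ratio_bounds hα hβ hγ hαβγ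
    exact pow_nonneg (by linarith) _
  · rw [Finset.sum_eq_zero]
    intro ρ hρ
    exact absurd ⟨ρ, by simpa using hρ⟩ hY

/-- Within a class, the value at x depends only on whether there is a crossing at the vertex `head
x`. So k prescribed values spoil the cancellation at no more than k vertices, each at the price 2 /
(1 - αβ/γ²). -/
theorem fibre_sum_abs_le {k : ℕ} (x y : Fin k → MidEdge (ZMod n))
    (Y : Finset (MidEdge (ZMod n))) :
    |∑ ρ ∈ Finset.univ.filter (fun ρ : GenSnake (ZMod n) => moved ρ.1 = Y),
      snakeWeight n α β γ ρ * (if ∀ i, ρ.1 (x i) = y i then 1 else 0)| ≤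
    (2 / (1 - α * β / γ ^ 2)) ^ k *
      ∑ ρ ∈ Finset.univ.filter (fun ρ : GenSnake (ZMod n) => moved ρ.1 = Y),
        snakeWeight n α β γ ρ := by
  obtain ⟨h2, h3⟩ := ratio_bounds hα hβ hγ hαβγ
  by_cases hY : ∃ ρ : GenSnake (ZMod n), moved ρ.1 = Y
  · obtain ⟨w, r, hw, hr, hs⟩ := exists_fibre_sum hα hβ hγ Y hY
    have h0 := hs (fun _ => 1)
    simp only [mul_one, one_mul] at h0
    have h1 := Finset.sum_pow_mul_eq_add_pow (-(α * β / γ ^ 2)) 1 (fullSet Y)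
    simp only [one_pow, mul_one] at h1
    rw [h0, h1, hs, abs_mul, abs_of_pos hw]
    have h4 := abs_sum_powerset_le (fullSet Y) (Finset.univ.image fun i => head (x i))
      (fun T => if T ⊆ fullSet Y then if ∀ i, (r T).1 (x i) = y i then 1 else 0 else 0)
      (fun T => by split_ifs <;> simp) (by
        intro T hT T' hT' h
        simp only [hT, hT', if_true]
        have : ∀ i, (r T).1 (x i) = (r T').1 (x i) := by
          intro i
          refine apply_eq_of_local ((hr T hT).1.trans (hr T' hT').1.symm) ?_
          rw [(hr T hT).2, (hr T' hT').2]
          exact h _ (Finset.mem_image_of_mem _ (Finset.mem_univ i))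
        simp only [this]) h2 h3
    have h5 : ∑ T ∈ (fullSet Y).powerset, (if ∀ i, (r T).1 (x i) = y i then (1 : ℝ) else 0) *
        (-(α * β / γ ^ 2)) ^ T.card = ∑ T ∈ (fullSet Y).powerset,
        (if T ⊆ fullSet Y then if ∀ i, (r T).1 (x i) = y i then (1 : ℝ) else 0 else 0) *
        (-(α * β / γ ^ 2)) ^ T.card :=
      Finset.sum_congr rfl fun T hT => by rw [if_pos (Finset.mem_powerset.1 hT)]
    rw [h5, mul_left_comm]
    refine mul_le_mul_of_nonneg_left (h4.trans ?_) hw.le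
    rw [neg_add_eq_sub]
    refine mul_le_mul_of_nonneg_right ?_ (pow_nonneg (by linarith) _)
    refine pow_le_pow_right₀ ?_ ?_
    · rw [le_div_iff₀ (by linarith)]; linarith
    · exact Finset.card_image_le.trans (by simp)
  · have : Finset.univ.filter (fun ρ : GenSnake (ZMod n) => moved ρ.1 = Y) = ∅ := by
      rw [Finset.filter_eq_empty_iff]
      intro ρ _ h
      exact hY ⟨ρ, h⟩
    simp [this]

/-- On functions of the moved set alone the signed weight is a positive measure. The fluxes are such
functions, which makes Chernoff's method available for them. -/
theorem sum_weight_mono {φ ψ : Finset (MidEdge (ZMod n)) → ℝ} (h : ∀ Y, φ Y ≤ ψ Y) :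
    ∑ ρ : GenSnake (ZMod n), snakeWeight n α β γ ρ * φ (moved ρ.1) ≤
      ∑ ρ : GenSnake (ZMod n), snakeWeight n α β γ ρ * ψ (moved ρ.1) := by
  rw [← Finset.sum_fiberwise Finset.univ (fun ρ : GenSnake (ZMod n) => moved ρ.1),
    ← Finset.sum_fiberwise Finset.univ (fun ρ : GenSnake (ZMod n) => moved ρ.1)
      (fun ρ => snakeWeight n α β γ ρ * ψ (moved ρ.1))]
  refine Finset.sum_le_sum fun Y _ => ?_
  have e : ∀ χ : Finset (MidEdge (ZMod n)) → ℝ,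
      ∑ ρ ∈ Finset.univ.filter (fun ρ : GenSnake (ZMod n) => moved ρ.1 = Y),
        snakeWeight n α β γ ρ * χ (moved ρ.1) =
      (∑ ρ ∈ Finset.univ.filter (fun ρ : GenSnake (ZMod n) => moved ρ.1 = Y),
        snakeWeight n α β γ ρ) * χ Y := by
    intro χ
    rw [Finset.sum_mul]
    refine Finset.sum_congr rfl fun ρ hρ => ?_
    rw [(Finset.mem_filter.1 hρ).2]
  rw [e, e]
  exact mul_le_mul_of_nonneg_left (h Y) (fibre_sum_nonneg hα hβ hγ hαβγ Y)

/-- Replaces the triangle inequality over configurations, which would forget the cancellation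
between weights of opposite sign; the constant does not depend on n. -/
theorem norm_sum_restrict_le {k : ℕ} (x y : Fin k → MidEdge (ZMod n))
    (φ : Finset (MidEdge (ZMod n)) → ℂ) :
    ‖∑ ρ : GenSnake (ZMod n), (if ∀ i, ρ.1 (x i) = y i then
      (snakeWeight n α β γ ρ : ℂ) * φ (moved ρ.1) else 0)‖ ≤
    (2 / (1 - α * β / γ ^ 2)) ^ k *
      ∑ ρ : GenSnake (ZMod n), snakeWeight n α β γ ρ * ‖φ (moved ρ.1)‖ := by
  rw [← Finset.sum_fiberwise Finset.univ (fun ρ : GenSnake (ZMod n) => moved ρ.1),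
    ← Finset.sum_fiberwise Finset.univ (fun ρ : GenSnake (ZMod n) => moved ρ.1)
      (fun ρ => snakeWeight n α β γ ρ * ‖φ (moved ρ.1)‖), Finset.mul_sum]
  refine (norm_sum_le _ _).trans (Finset.sum_le_sum fun Y _ => ?_)
  have e1 : ∑ ρ ∈ Finset.univ.filter (fun ρ : GenSnake (ZMod n) => moved ρ.1 = Y),
      (if ∀ i, ρ.1 (x i) = y i then (snakeWeight n α β γ ρ : ℂ) * φ (moved ρ.1) else 0) =
      ((∑ ρ ∈ Finset.univ.filter (fun ρ : GenSnake (ZMod n) => moved ρ.1 = Y),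
      snakeWeight n α β γ ρ * (if ∀ i, ρ.1 (x i) = y i then 1 else 0) : ℝ) : ℂ) * φ Y := by
    push_cast
    rw [Finset.sum_mul]
    refine Finset.sum_congr rfl fun ρ hρ => ?_
    rw [(Finset.mem_filter.1 hρ).2]
    split_ifs <;> simp
  have e2 : ∑ ρ ∈ Finset.univ.filter (fun ρ : GenSnake (ZMod n) => moved ρ.1 = Y),
      snakeWeight n α β γ ρ * ‖φ (moved ρ.1)‖ =
      (∑ ρ ∈ Finset.univ.filter (fun ρ : GenSnake (ZMod n) => moved ρ.1 = Y),
      snakeWeight n α β γ ρ) * ‖φ Y‖ := by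
    rw [Finset.sum_mul]
    refine Finset.sum_congr rfl fun ρ hρ => ?_
    rw [(Finset.mem_filter.1 hρ).2]
  rw [e1, e2, norm_mul, Complex.norm_real, Real.norm_eq_abs, ← mul_assoc]
  exact mul_le_mul_of_nonneg_right (fibre_sum_abs_le hα hβ hγ hαβγ x y Y) (norm_nonneg _)

theorem snakePartition_pos_of_fact : 0 < snakePartition n α β γ := by
  classical
  -- Only the identity has empty moved set, and its weight is positive; all other classes are
  -- nonnegative and dropped.
  have h := sum_weight_mono hα hβ hγ hαβγ (n := n) (φ := fun Y => if Y = ∅ then 1 else 0)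
    (ψ := fun _ => 1) (fun Y => by split_ifs <;> simp)
  simp only [mul_one] at h
  refine lt_of_lt_of_le ?_ h
  let ι : GenSnake (ZMod n) := ⟨Equiv.refl _, fun x => Or.inl rfl⟩
  have hι : moved ι.1 = ∅ := by ext x; simp [ι]
  have hc : crossSet ι.1 = ∅ := by
    rw [← Finset.subset_empty]
    refine (crossSet_subset_fullSet ι).trans ?_
    rw [hι]; simp [fullSet]
  rw [Finset.sum_eq_single ι]
  · simp only [hι, if_true, mul_one]
    exact snakeWeight_pos_of_crossSet_eq_empty hα hβ hγ hc
  · intro ρ _ hρ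
    rw [if_neg, mul_zero]
    intro h0
    apply hρ
    refine eq_of_moved_eq (h0.trans hι.symm) ?_
    rw [hc, ← Finset.subset_empty]
    refine (crossSet_subset_fullSet ρ).trans ?_
    rw [h0]; simp [fullSet]
  · simp

end Fibre

/-! ### Fourier diagonalisation on the torus. -/

section Fourier

variable {n : ℕ} [NeZero n]

theorem prod_sub_stdAddChar_mul (x y : ℂ) :
    ∏ k : ZMod n, (x - ZMod.stdAddChar k * y) = x ^ n - y ^ n := by
  rw [IsPrimitiveRoot.pow_sub_pow_eq_prod_sub_mul x y (NeZero.pos n)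
    (Complex.isPrimitiveRoot_exp n (NeZero.ne n))]
  refine Finset.prod_bij (fun k _ => ZMod.stdAddChar k) ?_ ?_ (fun b hb => ?_) (fun _ _ => rfl)
  · intro k _
    rw [Polynomial.mem_nthRootsFinset (NeZero.pos n), ← AddChar.map_nsmul_eq_pow]
    simp
  · intro k _ l _ h
    exact ZMod.injective_stdAddChar h
  · have himg : Finset.univ.image (fun k : ZMod n => ZMod.stdAddChar k) =
        Polynomial.nthRootsFinset n (1 : ℂ) := by
      refine Finset.eq_of_subset_of_card_le ?_ ?_
      · intro z hz
        obtain ⟨k, _, rfl⟩ := Finset.mem_image.1 hz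
        rw [Polynomial.mem_nthRootsFinset (NeZero.pos n), ← AddChar.map_nsmul_eq_pow]
        simp
      · rw [Finset.card_image_of_injective _ ZMod.injective_stdAddChar,
          (Complex.isPrimitiveRoot_exp n (NeZero.ne n)).card_nthRootsFinset]
        simp [ZMod.card]
    rw [← himg] at hb
    obtain ⟨k, hk, rfl⟩ := Finset.mem_image.1 hb
    exact ⟨k, hk, rfl⟩

theorem sum_stdAddChar_mul (d : ZMod n) :
    ∑ k : ZMod n, ZMod.stdAddChar (k * d) = if d = 0 then (n : ℂ) else 0 := by
  rw [AddChar.sum_mulShift d (ZMod.isPrimitive_stdAddChar n)]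
  split_ifs <;> simp [ZMod.card]

/-- The character `p ↦ e(k · p)` of the discrete torus. -/
noncomputable def torusChar (k p : ZMod n × ZMod n) : ℂ :=
  ZMod.stdAddChar (k.1 * p.1 + k.2 * p.2)

theorem torusChar_add (k p q : ZMod n × ZMod n) :
    torusChar k (p + q) = torusChar k p * torusChar k q := by
  rw [torusChar, torusChar, torusChar, ← AddChar.map_add_eq_mul]
  congr 1
  simp; ring

theorem sum_torusChar (p : ZMod n × ZMod n) :
    ∑ k, torusChar k p = if p = 0 then (n : ℂ) ^ 2 else 0 := by
  simp only [torusChar, AddChar.map_add_eq_mul, Fintype.sum_prod_type, ← Finset.mul_sum]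
  rw [← Finset.sum_mul, sum_stdAddChar_mul, sum_stdAddChar_mul]
  rcases p with ⟨a, b⟩
  by_cases ha : a = 0 <;> by_cases hb : b = 0 <;> simp [ha, hb, sq]

/-- The determinant of the symbol of the Kasteleyn matrix. -/
noncomputable def symbolDet (a b c : ℂ) (k : ZMod n × ZMod n) : ℂ :=
  (1 + a * ZMod.stdAddChar k.1) * (1 + b * ZMod.stdAddChar k.2) -
    c ^ 2 * ZMod.stdAddChar k.1 * ZMod.stdAddChar k.2

/-- The symbol of the Kasteleyn matrix. -/
noncomputable def symbolBlock (a b c : ℂ) (k : ZMod n × ZMod n) : Matrix Colour Colour ℂ :=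
  Matrix.of fun x y => match x, y with
    | Colour.B, Colour.B => 1 + a * ZMod.stdAddChar k.1
    | Colour.B, Colour.W => c * ZMod.stdAddChar k.1
    | Colour.W, Colour.B => c * ZMod.stdAddChar k.2
    | Colour.W, Colour.W => 1 + b * ZMod.stdAddChar k.2

theorem sum_colour {M : Type*} [AddCommMonoid M] (f : Colour → M) :
    ∑ c, f c = f Colour.B + f Colour.W := by
  have hU : (Finset.univ : Finset Colour) = {Colour.B, Colour.W} := rfl
  rw [hU, Finset.sum_pair (by simp)]

/-- The equivalence of the colours with `Fin 2`. -/
def colourEquiv : Fin 2 ≃ Colour where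
  toFun := ![Colour.B, Colour.W]
  invFun c := match c with
    | Colour.B => 0
    | Colour.W => 1
  left_inv i := by fin_cases i <;> rfl
  right_inv c := by cases c <;> rfl

theorem det_colour (M : Matrix Colour Colour ℂ) : M.det =
    M Colour.B Colour.B * M Colour.W Colour.W - M Colour.B Colour.W * M Colour.W Colour.B := by
  rw [← Matrix.det_submatrix_equiv_self colourEquiv, Matrix.det_fin_two]
  rfl

theorem det_symbolBlock (a b c : ℂ) (k : ZMod n × ZMod n) :
    (symbolBlock a b c k).det = symbolDet a b c k := by
  rw [det_colour]
  simp only [symbolBlock, symbolDet, Matrix.of_apply]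
  ring

variable [Fact (1 < n)]

theorem sum_stepWeight_mul (a b c : ℂ) (x : MidEdge (ZMod n)) (f : MidEdge (ZMod n) → ℂ) :
    ∑ y, stepWeight a b c x y * f y = f x + c * f x.addE3 +
      (match x.1 with
        | Colour.B => a
        | Colour.W => b) * f x.straight := by
  have h1 : x.addE3 ≠ x ∧ x.straight ≠ x ∧ x.straight ≠ x.addE3 := by
    obtain ⟨col, p, q⟩ := x
    cases col <;> simp [addE3, straight, addE1, addE2]
  have h2 : ∀ y, stepWeight a b c x y * f y = (if y = x then f y else 0) +
      (if y = x.addE3 then c * f y else 0) + (if y = x.straight then (match x.1 with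
        | Colour.B => a
        | Colour.W => b) * f y else 0) := by
    intro y
    unfold stepWeight
    obtain ⟨h3, h4, h5⟩ := h1
    by_cases e1 : y = x
    · subst e1; simp [h3.symm, h4.symm]
    by_cases e2 : y = x.addE3
    · subst e2; simp [h3, h5.symm]
    by_cases e3 : y = x.straight
    · subst e3; simp only [if_neg h4, if_neg h5, if_true, zero_add]
    · simp [e1, e2, e3]
  simp only [h2, Finset.sum_add_distrib, Finset.sum_ite_eq', Finset.mem_univ, if_true]

theorem det_torusMatrix_eq_prod (a b c : ℂ) :
    (torusMatrix n a b c).det = ∏ k : ZMod n × ZMod n, symbolDet a b c k := by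
  let F : Matrix (MidEdge (ZMod n)) (MidEdge (ZMod n)) ℂ :=
    Matrix.of fun x y => if x.1 = y.1 then torusChar y.2 x.2 else 0
  let F' : Matrix (MidEdge (ZMod n)) (MidEdge (ZMod n)) ℂ :=
    Matrix.of fun x y => if x.1 = y.1 then torusChar x.2 (-y.2) else 0
  have h1 : F * F' = (n : ℂ) ^ 2 • 1 := by
    ext ⟨c, p⟩ ⟨c', p'⟩
    rw [Matrix.mul_apply, Fintype.sum_prod_type, sum_colour]
    simp only [F, F', Matrix.of_apply, Matrix.smul_apply, Matrix.one_apply, smul_eq_mul]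
    cases c <;> cases c' <;> simp [← torusChar_add, sum_torusChar, ← sub_eq_add_neg, sub_eq_zero]
  have h2 : torusMatrix n a b c * F = F * Matrix.blockDiagonal (symbolBlock a b c) := by
    ext ⟨col, p⟩ ⟨col', k⟩
    rw [Matrix.mul_apply, Matrix.mul_apply]
    simp only [torusMatrix, Matrix.of_apply]
    rw [sum_stepWeight_mul, Fintype.sum_prod_type, sum_colour]
    simp only [F, Matrix.of_apply, Matrix.blockDiagonal_apply]
    obtain ⟨p₁, p₂⟩ := p
    have e1 : torusChar k (p₁ + 1, p₂) = torusChar k (p₁, p₂) * ZMod.stdAddChar k.1 := by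
      rw [show (p₁ + 1, p₂) = (p₁, p₂) + (1, 0) by simp, torusChar_add]; simp [torusChar]
    have e2 : torusChar k (p₁, p₂ + 1) = torusChar k (p₁, p₂) * ZMod.stdAddChar k.2 := by
      rw [show (p₁, p₂ + 1) = (p₁, p₂) + (0, 1) by simp, torusChar_add]; simp [torusChar]
    cases col <;> cases col' <;>
      simp [addE3, straight, addE1, addE2, symbolBlock, e1, e2] <;> ring
  have h3 : F.det ≠ 0 := by
    intro h
    have := congrArg Matrix.det h1
    rw [Matrix.det_mul, h, zero_mul, Matrix.det_smul, Matrix.det_one, mul_one] at this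
    exact pow_ne_zero _ (pow_ne_zero _ (Nat.cast_ne_zero.2 (NeZero.ne n))) this.symm
  have h4 := congrArg Matrix.det h2
  rw [Matrix.det_mul, Matrix.det_mul, Matrix.det_blockDiagonal, mul_comm] at h4
  rw [mul_left_cancel₀ h3 h4]
  exact Finset.prod_congr rfl fun k _ => det_symbolBlock a b c k

/-- The lattice Green function: the inverse Fourier transform of the reciprocal of the symbol. -/
noncomputable def torusGreen (a b c : ℂ) (d : ZMod n × ZMod n) : ℂ :=
  ((n : ℂ) ^ 2)⁻¹ * ∑ k, torusChar k d / symbolDet a b c k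

/-- The inverse of the Kasteleyn matrix on the torus. -/
noncomputable def torusInverse (a b c : ℂ) : Matrix (MidEdge (ZMod n)) (MidEdge (ZMod n)) ℂ :=
  Matrix.of fun x y => match x.1, y.1 with
    | Colour.B, Colour.B =>
      torusGreen a b c (x.2 - y.2) + b * torusGreen a b c (x.2 - y.2 + (0, 1))
    | Colour.B, Colour.W => -c * torusGreen a b c (x.2 - y.2 + (1, 0))
    | Colour.W, Colour.B => -c * torusGreen a b c (x.2 - y.2 + (0, 1))
    | Colour.W, Colour.W =>
      torusGreen a b c (x.2 - y.2) + a * torusGreen a b c (x.2 - y.2 + (1, 0))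

/-- The left side is multiplication by `symbolDet` in Fourier space, which cancels the denominator
and leaves the orthogonality of characters. -/
theorem torusGreen_recurrence {a b c : ℂ} (h : ∀ k : ZMod n × ZMod n, symbolDet a b c k ≠ 0)
    (d : ZMod n × ZMod n) :
    torusGreen a b c d + a * torusGreen a b c (d + (1, 0)) + b * torusGreen a b c (d + (0, 1)) -
      (c ^ 2 - a * b) * torusGreen a b c (d + (1, 1)) = if d = 0 then 1 else 0 := by
  have hn : (n : ℂ) ^ 2 ≠ 0 := pow_ne_zero _ (Nat.cast_ne_zero.2 (NeZero.ne n))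
  have h1 : ∀ k : ZMod n × ZMod n, torusChar k d =
      torusChar k d / symbolDet a b c k + a * (torusChar k (d + (1, 0)) / symbolDet a b c k) +
      b * (torusChar k (d + (0, 1)) / symbolDet a b c k) -
      (c ^ 2 - a * b) * (torusChar k (d + (1, 1)) / symbolDet a b c k) := by
    intro k
    have e1 : torusChar k (1, 0) = ZMod.stdAddChar k.1 := by simp [torusChar]
    have e2 : torusChar k (0, 1) = ZMod.stdAddChar k.2 := by simp [torusChar]
    have e3 : torusChar k (1, 1) = ZMod.stdAddChar k.1 * ZMod.stdAddChar k.2 := by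
      simp [torusChar, AddChar.map_add_eq_mul]
    have hk := h k
    rw [torusChar_add, torusChar_add, torusChar_add, e1, e2, e3]
    field_simp
    unfold symbolDet
    ring
  have h2 := sum_torusChar d
  rw [Finset.sum_congr rfl fun k _ => h1 k] at h2
  rw [Finset.sum_sub_distrib, Finset.sum_add_distrib, Finset.sum_add_distrib, ← Finset.mul_sum,
    ← Finset.mul_sum, ← Finset.mul_sum] at h2
  have h3 : (if d = 0 then (1 : ℂ) else 0) = ((n : ℂ) ^ 2)⁻¹ * if d = 0 then (n : ℂ) ^ 2 else 0 := by
    split_ifs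
    · rw [inv_mul_cancel₀ hn]
    · simp
  rw [h3, ← h2]
  unfold torusGreen
  ring

/-- The entries of `torusInverse` are those of the adjugate of the symbol over its determinant.
Diagonal blocks give the recurrence, off-diagonal ones cancel. -/
theorem torusMatrix_mul_torusInverse {a b c : ℂ}
    (h : ∀ k : ZMod n × ZMod n, symbolDet a b c k ≠ 0) :
    torusMatrix n a b c * torusInverse a b c = 1 := by
  ext ⟨col, p⟩ ⟨col', q⟩
  rw [Matrix.mul_apply]
  simp only [torusMatrix, Matrix.of_apply]
  rw [sum_stepWeight_mul, Matrix.one_apply]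
  have hrec := torusGreen_recurrence h (p - q)
  obtain ⟨p₁, p₂⟩ := p
  have e1 : ((p₁ + 1, p₂) - q : ZMod n × ZMod n) = (p₁, p₂) - q + (1, 0) := by
    ext <;> simp; ring
  have e2 : ((p₁, p₂ + 1) - q : ZMod n × ZMod n) = (p₁, p₂) - q + (0, 1) := by
    ext <;> simp; ring
  have e3 : ((p₁, p₂) - q + (1, 0) + (0, 1) : ZMod n × ZMod n) = (p₁, p₂) - q + (1, 1) := by
    rw [add_assoc]; simp
  have e4 : ((p₁, p₂) - q + (0, 1) + (1, 0) : ZMod n × ZMod n) = (p₁, p₂) - q + (1, 1) := by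
    rw [add_assoc]; simp
  cases col <;> cases col' <;>
    simp only [torusInverse, Matrix.of_apply, addE3, straight, addE1, addE2, e1, e2, e3, e4]
  · refine Eq.trans ?_ (hrec.trans (if_congr (by simp [sub_eq_zero]) rfl rfl))
    ring
  · rw [if_neg (by simp)]; ring
  · rw [if_neg (by simp)]; ring
  · refine Eq.trans ?_ (hrec.trans (if_congr (by simp [sub_eq_zero]) rfl rfl))
    ring

/-- The determinant of the Kasteleyn matrix after carrying out one of the two products. -/
theorem det_torusMatrix_eq_prod_pow (α β γ : ℝ) (v₁ v₂ : ℂ) :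
    (torusMatrix n (α * v₁ ^ 2) (β * v₂ ^ 2) (γ * v₁ * v₂)).det =
      ∏ k : ZMod n, ((1 + α * (v₁ ^ 2 * ZMod.stdAddChar k)) ^ n -
        v₂ ^ (2 * n) * ((γ ^ 2 - α * β) * (v₁ ^ 2 * ZMod.stdAddChar k) - β) ^ n) := by
  rw [det_torusMatrix_eq_prod, Fintype.prod_prod_type]
  refine Finset.prod_congr rfl fun k _ => ?_
  rw [pow_mul, ← mul_pow, ← prod_sub_stdAddChar_mul]
  refine Finset.prod_congr rfl fun l _ => ?_
  unfold symbolDet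
  ring

end Fourier

/-! ### Riemann sums. -/

/-- Riemann sums over equidistant points of a bounded almost everywhere continuous function
converge to its integral. -/
theorem tendsto_riemann_sum {E : Type*} [NormedAddCommGroup E] [NormedSpace ℝ E] [CompleteSpace E]
    {f : ℝ → E}
    {M : ℝ} (hM : ∀ x, ‖f x‖ ≤ M) (hc : ∀ᵐ x : ℝ, ContinuousAt f x) (s : ℝ) :
    Tendsto (fun n : ℕ => (n : ℝ)⁻¹ • ∑ j ∈ Finset.range n, f ((2 * Real.pi * j + s) / n)) atTop
      (𝓝 ((2 * Real.pi)⁻¹ • ∫ x in 0..2 * Real.pi, f x)) := by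
  have hpi : 0 < 2 * Real.pi := by positivity
  -- On the interval from 2πj/n (excluded) to 2π(j+1)/n (included), `F n` takes the value of f at
  -- the j-th sample point, so its integral is the Riemann sum and dominated convergence applies.
  let F : ℕ → ℝ → E := fun n x =>
    f ((2 * Real.pi * ((⌈n * x / (2 * Real.pi)⌉ - 1 : ℤ) : ℝ) + s) / n)
  have hmeas : ∀ n, StronglyMeasurable (F n) := by
    intro n
    have h1 : Measurable fun x : ℝ => ⌈n * x / (2 * Real.pi)⌉ :=
      Int.measurable_ceil.comp (by fun_prop)
    have h2 : StronglyMeasurable fun k : ℤ => f ((2 * Real.pi * ((k - 1 : ℤ) : ℝ) + s) / n) :=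
      StronglyMeasurable.of_discrete
    exact h2.comp_measurable h1
  have hconv : ∀ x, ContinuousAt f x → Tendsto (fun n : ℕ => F n x) atTop (𝓝 (f x)) := by
    intro x hx
    refine Tendsto.comp (f := fun n : ℕ =>
      (2 * Real.pi * ((⌈n * x / (2 * Real.pi)⌉ - 1 : ℤ) : ℝ) + s) / n) hx ?_
    rw [tendsto_iff_norm_sub_tendsto_zero]
    have hb : ∀ᶠ n : ℕ in atTop, ‖(2 * Real.pi * ((⌈n * x / (2 * Real.pi)⌉ - 1 : ℤ) : ℝ) + s) / n - x‖
        ≤ (2 * Real.pi + |s|) / n := by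
      filter_upwards [eventually_gt_atTop 0] with n hn
      have hn' : (0 : ℝ) < n := by exact_mod_cast hn
      have h1 := Int.le_ceil (n * x / (2 * Real.pi))
      have h2 := Int.ceil_lt_add_one (n * x / (2 * Real.pi))
      rw [div_le_iff₀ hpi] at h1
      rw [← sub_lt_iff_lt_add, lt_div_iff₀ hpi] at h2
      rw [Real.norm_eq_abs, div_sub' hn'.ne', abs_div, abs_of_pos hn']
      gcongr
      push_cast
      have h3 := abs_le.1 (le_refl |s|)
      rw [abs_le]
      constructor <;> nlinarith
    refine squeeze_zero' (Eventually.of_forall fun _ => norm_nonneg _) hb ?_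
    exact tendsto_const_nhds.div_atTop tendsto_natCast_atTop_atTop
  have hint : Tendsto (fun n => ∫ x in 0..2 * Real.pi, F n x) atTop
      (𝓝 (∫ x in 0..2 * Real.pi, f x)) := by
    refine intervalIntegral.tendsto_integral_filter_of_dominated_convergence (fun _ => M)
      (Eventually.of_forall fun n => (hmeas n).aestronglyMeasurable)
      (Eventually.of_forall fun n => Eventually.of_forall fun x _ => hM _)
      intervalIntegrable_const ?_
    filter_upwards [hc] with x hx _ using hconv x hx
  refine Tendsto.congr' ?_ (hint.const_smul (2 * Real.pi)⁻¹)
  filter_upwards [eventually_gt_atTop 0] with n hn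
  have hn' : (0 : ℝ) < n := by exact_mod_cast hn
  have hFi : ∀ a b, IntervalIntegrable (F n) volume a b := fun a b =>
    (intervalIntegrable_const (c := M)).mono_fun (hmeas n).aestronglyMeasurable
      (Eventually.of_forall fun x => (hM _).trans (le_abs_self M))
  have h1 : ∀ j : ℕ, ∫ x in (2 * Real.pi * j / n)..(2 * Real.pi * (j + 1 : ℕ) / n), F n x =
      (2 * Real.pi / n) • f ((2 * Real.pi * j + s) / n) := by
    intro j
    have hle : 2 * Real.pi * j / n ≤ 2 * Real.pi * (j + 1 : ℕ) / n := by
      push_cast; gcongr; linarith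
    have h2 : ∫ x in (2 * Real.pi * j / n)..(2 * Real.pi * (j + 1 : ℕ) / n), F n x =
        ∫ x in (2 * Real.pi * j / n)..(2 * Real.pi * (j + 1 : ℕ) / n),
          f ((2 * Real.pi * j + s) / n) := by
      refine intervalIntegral.integral_congr_ae (Eventually.of_forall fun x hx => ?_)
      rw [Set.uIoc_of_le hle, Set.mem_Ioc, div_lt_iff₀ hn', le_div_iff₀ hn'] at hx
      have hceil : ⌈n * x / (2 * Real.pi)⌉ = (j : ℤ) + 1 := by
        rw [Int.ceil_eq_iff]
        push_cast at hx ⊢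
        rw [lt_div_iff₀ hpi, div_le_iff₀ hpi]
        constructor <;> linarith
      simp only [F, hceil]
      push_cast
      simp
    rw [h2, intervalIntegral.integral_const]
    congr 1
    push_cast
    field_simp
    ring
  have h3 := intervalIntegral.sum_integral_adjacent_intervals (μ := volume) (f := F n)
    (a := fun j : ℕ => 2 * Real.pi * j / n) (n := n) (fun j _ => hFi _ _)
  simp only [h1] at h3
  have h4 : 2 * Real.pi * ((n : ℕ) : ℝ) / n = 2 * Real.pi := by field_simp
  rw [h4] at h3
  simp only [Nat.cast_zero, mul_zero, zero_div] at h3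
  rw [← h3, ← Finset.smul_sum, smul_smul]
  congr 1
  field_simp

theorem ae_cos_ne (c : ℝ) : ∀ᵐ x : ℝ, Real.cos x ≠ c := by
  have h : {x : ℝ | Real.cos x = c}.Countable := by
    by_cases hc : ∃ x₀, Real.cos x₀ = c
    · obtain ⟨x₀, rfl⟩ := hc
      refine ((Set.countable_range fun k : ℤ => 2 * k * Real.pi + x₀).union
        (Set.countable_range fun k : ℤ => 2 * k * Real.pi - x₀)).mono ?_
      intro x hx
      have hx' : Real.cos x₀ = Real.cos x := (show Real.cos x = Real.cos x₀ from hx).symm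
      obtain ⟨k, hk | hk⟩ := Real.cos_eq_cos_iff.1 hx'
      · exact Or.inl ⟨k, hk.symm⟩
      · exact Or.inr ⟨k, hk.symm⟩
    · have : {x : ℝ | Real.cos x = c} = ∅ := by
        ext x; simp; exact fun h => hc ⟨x, h⟩
      rw [this]; exact Set.countable_empty
  have := h.measure_zero volume
  rw [ae_iff]
  simpa using this

/-! ### The two coefficients of the symbol on the unit circle. -/

section Coefficients

variable {α β γ : ℝ}

/-- The constant coefficient in `w₂` of the determinant of the symbol. -/
noncomputable def coefA (α : ℝ) (w : ℂ) : ℂ := 1 + α * w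

/-- Minus the linear coefficient in `w₂` of the determinant of the symbol. -/
noncomputable def coefB (α β γ : ℝ) (w : ℂ) : ℂ := (γ ^ 2 - α * β) * w - β

theorem normSq_coefA (θ : ℝ) :
    ‖coefA α (Complex.exp (θ * Complex.I))‖ ^ 2 = 1 + α ^ 2 + 2 * α * Real.cos θ := by
  rw [Complex.sq_norm, Complex.normSq_apply, coefA]
  simp [Complex.exp_ofReal_mul_I_re, Complex.exp_ofReal_mul_I_im]
  linear_combination α ^ 2 * Real.sin_sq_add_cos_sq θ

theorem normSq_coefB (θ : ℝ) :
    ‖coefB α β γ (Complex.exp (θ * Complex.I))‖ ^ 2 =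
      (γ ^ 2 - α * β) ^ 2 + β ^ 2 - 2 * (γ ^ 2 - α * β) * β * Real.cos θ := by
  rw [Complex.sq_norm, Complex.normSq_apply, coefB]
  have : ((γ : ℂ) ^ 2 - α * β) = ((γ ^ 2 - α * β : ℝ) : ℂ) := by push_cast; rfl
  rw [this]
  simp only [Complex.sub_re, Complex.sub_im, Complex.re_ofReal_mul, Complex.im_ofReal_mul,
    Complex.exp_ofReal_mul_I_re, Complex.exp_ofReal_mul_I_im, Complex.ofReal_re,
    Complex.ofReal_im]
  linear_combination (γ ^ 2 - α * β) ^ 2 * Real.sin_sq_add_cos_sq θ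

/-- The slope in `cos θ` of `‖A‖² - ‖B‖²`. -/
def cosSlope (α β γ : ℝ) : ℝ := 2 * (α + (γ ^ 2 - α * β) * β)

/-- The zero in `cos θ` of `‖A‖² - ‖B‖²`. -/
noncomputable def critCos (α β γ : ℝ) : ℝ :=
  ((γ ^ 2 - α * β) ^ 2 + β ^ 2 - 1 - α ^ 2) / cosSlope α β γ

variable (hα : 0 < α) (hβ : 0 < β) (hαβγ : 0 < γ ^ 2 - α * β)

include hα hβ hαβγ

theorem cosSlope_pos : 0 < cosSlope α β γ := by unfold cosSlope; positivity

/-- The norms of the coefficients can coincide for a single value of cos θ only. This confines the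
degenerate frequencies to at most two angles, with quantitative control near them. -/
theorem normSq_sub (θ : ℝ) :
    ‖coefA α (Complex.exp (θ * Complex.I))‖ ^ 2 - ‖coefB α β γ (Complex.exp (θ * Complex.I))‖ ^ 2 =
      cosSlope α β γ * (Real.cos θ - critCos α β γ) := by
  have h := (cosSlope_pos hα hβ hαβγ).ne'
  rw [normSq_coefA, normSq_coefB, critCos, mul_sub (cosSlope α β γ), mul_div_cancel₀ _ h]
  unfold cosSlope
  ring

/-- The two coefficients are not small simultaneously. -/
theorem exists_max_norm_ge : ∃ c : ℝ, 0 < c ∧ ∀ θ : ℝ,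
    c ≤ max ‖coefA α (Complex.exp (θ * Complex.I))‖ ‖coefB α β γ (Complex.exp (θ * Complex.I))‖ := by
  set D := γ ^ 2 - α * β with hD
  -- The combination (D/α) A - B is free of w and equals D/α + β, so A and B cannot both be small.
  refine ⟨(D / α + β) / (D / α + 1), by positivity, fun θ => ?_⟩
  set w := Complex.exp (θ * Complex.I) with hw
  have hα' : (α : ℂ) ≠ 0 := by exact_mod_cast hα.ne'
  have h1 : ((D / α : ℝ) : ℂ) * coefA α w - coefB α β γ w = ((D / α + β : ℝ) : ℂ) := by
    unfold coefA coefB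
    rw [hD]
    push_cast
    field_simp
    ring
  have h2 : D / α + β ≤ D / α * ‖coefA α w‖ + ‖coefB α β γ w‖ := by
    have h3 := norm_sub_le (((D / α : ℝ) : ℂ) * coefA α w) (coefB α β γ w)
    rw [h1, norm_mul, Complex.norm_real, Complex.norm_real, Real.norm_eq_abs, Real.norm_eq_abs,
      abs_of_pos (by positivity), abs_of_pos (by positivity)] at h3
    exact h3
  rw [div_le_iff₀ (by positivity)]
  refine h2.trans ?_
  have h3 : 0 < D / α := by positivity
  have h4 := le_max_left ‖coefA α w‖ ‖coefB α β γ w‖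
  have h5 := le_max_right ‖coefA α w‖ ‖coefB α β γ w‖
  nlinarith

end Coefficients

/-! ### Bounds for the partition function and for the moments of the flux. -/

/-- If a product of linear polynomials is bounded on the unit circle, so is the product of the
larger coefficients. -/
theorem prod_max_le_of_circle_bound {ι : Type*} (s : Finset ι) (a b : ι → ℂ) {M : ℝ}
    (hM : ∀ z : ℂ, ‖z‖ = 1 → ‖∏ i ∈ s, (a i - z * b i)‖ ≤ M) :
    ∏ i ∈ s, max ‖a i‖ ‖b i‖ ≤ M := by
  -- A factor with ‖b‖ > ‖a‖ is replaced by its reflection in the circle, b̄ - z ā. This keeps the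
  -- modulus on the circle and gives the value at 0 modulus max(‖a‖, ‖b‖), so the maximum principle
  -- finishes.
  let c : ι → ℂ := fun i => if ‖b i‖ ≤ ‖a i‖ then a i else (starRingEnd ℂ) (b i)
  let d : ι → ℂ := fun i => if ‖b i‖ ≤ ‖a i‖ then b i else (starRingEnd ℂ) (a i)
  have h1 : ∀ z : ℂ, ‖z‖ = 1 → ∀ i, ‖c i - z * d i‖ = ‖a i - z * b i‖ := by
    intro z hz i
    by_cases h : ‖b i‖ ≤ ‖a i‖
    · simp [c, d, h]
    · simp only [c, d, h, if_false]
      have hzz : z * (starRingEnd ℂ) z = 1 := by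
        rw [Complex.mul_conj, Complex.normSq_eq_norm_sq, hz]; simp
      have : (starRingEnd ℂ) (b i) - z * (starRingEnd ℂ) (a i) =
          -z * (starRingEnd ℂ) (a i - z * b i) := by
        rw [map_sub, map_mul]
        linear_combination (-(starRingEnd ℂ) (b i)) * hzz
      rw [this, norm_mul, norm_neg, hz, one_mul, RCLike.norm_conj]
  have h2 : ‖∏ i ∈ s, (c i - 0 * d i)‖ ≤ M := by
    refine Complex.norm_le_of_forall_mem_frontier_norm_le (U := Metric.ball 0 1)
      (f := fun z => ∏ i ∈ s, (c i - z * d i)) Metric.isBounded_ball ?_ ?_ ?_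
    · exact (Differentiable.diffContOnCl (by fun_prop))
    · intro z hz
      rw [frontier_ball _ one_ne_zero, mem_sphere_zero_iff_norm] at hz
      rw [norm_prod, Finset.prod_congr rfl fun i _ => h1 z hz i, ← norm_prod]
      exact hM z hz
    · exact subset_closure (Metric.mem_ball_self one_pos)
  rw [norm_prod] at h2
  refine le_trans (le_of_eq (Finset.prod_congr rfl fun i _ => ?_)) h2
  simp only [c, zero_mul, sub_zero]
  split_ifs with h
  · exact max_eq_left h
  · rw [RCLike.norm_conj]
    exact max_eq_right (not_le.1 h).le

theorem prod_zmod_val {n : ℕ} [NeZero n] {M : Type*} [CommMonoid M] (f : ℕ → M) :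
    ∏ k : ZMod n, f k.val = ∏ j ∈ Finset.range n, f j := by
  refine Finset.prod_bij (fun k _ => k.val) ?_ ?_ ?_ (fun _ _ => rfl)
  · intro k _; exact Finset.mem_range.2 (ZMod.val_lt k)
  · intro k _ l _ h; exact ZMod.val_injective n h
  · intro j hj
    exact ⟨(j : ZMod n), Finset.mem_univ _, ZMod.val_cast_of_lt (Finset.mem_range.1 hj)⟩

theorem sum_zmod_val {n : ℕ} [NeZero n] {M : Type*} [AddCommMonoid M] (f : ℕ → M) :
    ∑ k : ZMod n, f k.val = ∑ j ∈ Finset.range n, f j :=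
  prod_zmod_val (M := Multiplicative M) f

/-- The points `w` of the unit circle with `w ^ n = exp (i σ)`. -/
noncomputable def gridPoint (n : ℕ) (σ : ℝ) (j : ℕ) : ℂ :=
  Complex.exp (((2 * Real.pi * j + σ) / n : ℝ) * Complex.I)

theorem gridPoint_eq {n : ℕ} [NeZero n] (σ : ℝ) (k : ZMod n) :
    Complex.exp ((σ / n : ℝ) * Complex.I) * ZMod.stdAddChar k = gridPoint n σ k.val := by
  rw [ZMod.stdAddChar_apply, ZMod.toCircle_apply, ← Complex.exp_add, gridPoint]
  congr 1
  push_cast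
  ring

/-- The half-angle phase whose `2n`-th power is `exp (i σ)`. -/
noncomputable def halfPhase (n : ℕ) (σ : ℝ) : ℂ := Complex.exp ((σ / (2 * n) : ℝ) * Complex.I)

theorem halfPhase_pow {n : ℕ} [NeZero n] (σ : ℝ) :
    halfPhase n σ ^ (2 * n) = Complex.exp (σ * Complex.I) := by
  have hn : (n : ℂ) ≠ 0 := Nat.cast_ne_zero.2 (NeZero.ne n)
  rw [halfPhase, ← Complex.exp_nat_mul]
  congr 1
  push_cast
  field_simp

theorem halfPhase_sq {n : ℕ} [NeZero n] (σ : ℝ) :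
    halfPhase n σ ^ 2 = Complex.exp ((σ / n : ℝ) * Complex.I) := by
  have hn : (n : ℂ) ≠ 0 := Nat.cast_ne_zero.2 (NeZero.ne n)
  rw [halfPhase, ← Complex.exp_nat_mul]
  congr 1
  push_cast
  field_simp

section FluxLaw

variable {n : ℕ} [NeZero n] [Fact (1 < n)]

/-- Every complex z is a 2n-th power, so the product formula is not restricted to unit twists; the
exponential moments of the flux need other moduli. -/
theorem twistedSum_eq_prod (α β γ σ : ℝ) (z : ℂ) :
    twistedSum α β γ (n := n) (Fin.elim0 : Fin 0 → _) (Fin.elim0 : Fin 0 → _)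
      (Complex.exp (σ * Complex.I)) z =
    ∏ j ∈ Finset.range n, (coefA α (gridPoint n σ j) ^ n -
      z * coefB α β γ (gridPoint n σ j) ^ n) := by
  obtain ⟨v, hv⟩ := IsAlgClosed.exists_pow_nat_eq z (n := 2 * n) (by have := NeZero.pos n; omega)
  rw [← halfPhase_pow (n := n), ← hv, ← det_torusMatrix, det_torusMatrix_eq_prod_pow,
    ← prod_zmod_val]
  refine Finset.prod_congr rfl fun k _ => ?_
  rw [halfPhase_sq, gridPoint_eq, coefA, coefB]

variable {α β γ : ℝ} (hα : 0 < α) (hβ : 0 < β) (hγ : 0 < γ) (hαβγ : 0 < γ ^ 2 - α * β)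

include hα hβ hγ hαβγ

theorem norm_twistedSum_le {k : ℕ} (x y : Fin k → MidEdge (ZMod n)) {z₁ z₂ : ℂ} (h₁ : ‖z₁‖ = 1)
    (h₂ : ‖z₂‖ = 1) : ‖twistedSum α β γ x y z₁ z₂‖ ≤
      (2 / (1 - α * β / γ ^ 2)) ^ k * snakePartition n α β γ := by
  have h := norm_sum_restrict_le hα hβ hγ hαβγ x y
    (fun Y => (fluxSign n (fluxE Y) (fluxN Y) : ℂ) * z₁ ^ fluxE Y * z₂ ^ fluxN Y)
  have e : ∀ Y : Finset (MidEdge (ZMod n)),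
      ‖(fluxSign n (fluxE Y) (fluxN Y) : ℂ) * z₁ ^ fluxE Y * z₂ ^ fluxN Y‖ = 1 := by
    intro Y
    rw [norm_mul, norm_mul, norm_pow, norm_pow, h₁, h₂, one_pow, one_pow, fluxSign]
    push_cast
    rw [norm_pow]; simp
  simp only [e, mul_one] at h
  refine le_trans (le_of_eq ?_) h
  unfold twistedSum
  congr 1
  refine Finset.sum_congr rfl fun ρ _ => ?_
  split_ifs <;> ring

/-- The lower bound for the partition function against which the exponential moments are measured.
-/
theorem prod_max_le_snakePartition (σ : ℝ) :
    ∏ j ∈ Finset.range n, max ‖coefA α (gridPoint n σ j)‖ ‖coefB α β γ (gridPoint n σ j)‖ ^ n ≤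
      snakePartition n α β γ := by
  have h := prod_max_le_of_circle_bound (Finset.range n) (fun j => coefA α (gridPoint n σ j) ^ n)
    (fun j => coefB α β γ (gridPoint n σ j) ^ n) (M := snakePartition n α β γ) (by
      intro z hz
      rw [← twistedSum_eq_prod]
      have := norm_twistedSum_le hα hβ hγ hαβγ (n := n) (Fin.elim0 : Fin 0 → _)
        (Fin.elim0 : Fin 0 → _) (Complex.norm_exp_ofReal_mul_I σ) hz
      simpa using this)
  refine le_trans (le_of_eq (Finset.prod_congr rfl fun j _ => ?_)) h
  rw [norm_pow, norm_pow]
  exact (pow_left_monotoneOn (n := n)).map_max (norm_nonneg _) (norm_nonneg _)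

/-- The exponential moments of the flux. -/
theorem flux_moment_le {s : ℝ} (hs : 0 < s) :
    ∑ ρ : GenSnake (ZMod n), snakeWeight n α β γ ρ * s ^ fluxN (moved ρ.1) ≤
      (∏ j ∈ Finset.range n, (‖coefA α (gridPoint n 0 j)‖ ^ n +
        s * ‖coefB α β γ (gridPoint n 0 j)‖ ^ n)) +
      ∏ j ∈ Finset.range n, (‖coefA α (gridPoint n Real.pi j)‖ ^ n +
        s * ‖coefB α β γ (gridPoint n Real.pi j)‖ ^ n) := by
  have hT : ∀ (σ : ℝ) (z : ℂ), ‖z‖ = s →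
      ‖twistedSum α β γ (n := n) (Fin.elim0 : Fin 0 → _) (Fin.elim0 : Fin 0 → _)
        (Complex.exp (σ * Complex.I)) z‖ ≤ ∏ j ∈ Finset.range n,
          (‖coefA α (gridPoint n σ j)‖ ^ n + s * ‖coefB α β γ (gridPoint n σ j)‖ ^ n) := by
    intro σ z hz
    rw [twistedSum_eq_prod, norm_prod]
    refine Finset.prod_le_prod (fun _ _ => norm_nonneg _) fun j _ => ?_
    refine (norm_sub_le _ _).trans ?_
    rw [norm_mul, norm_pow, norm_pow, hz]
  have h0 : ∀ z : ℂ, ‖z‖ = s → _ := hT 0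
  have h1 : ∀ z : ℂ, ‖z‖ = s → _ := hT Real.pi
  simp only [Complex.ofReal_zero, zero_mul, Complex.exp_zero, Complex.exp_pi_mul_I] at h0 h1
  have h := sum_twistedSum α β γ (n := n) (Fin.elim0 : Fin 0 → _) (Fin.elim0 : Fin 0 → _) (s : ℂ)
  simp only [IsEmpty.forall_iff, if_true] at h
  have hre : ((∑ ρ : GenSnake (ZMod n), snakeWeight n α β γ ρ * s ^ fluxN (moved ρ.1) : ℝ) : ℂ) =
      ∑ ρ : GenSnake (ZMod n), (snakeWeight n α β γ ρ : ℂ) * (s : ℂ) ^ fluxN (moved ρ.1) := by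
    push_cast; rfl
  rw [← hre] at h
  have hs1 : ‖(s : ℂ)‖ = s := by rw [Complex.norm_real, Real.norm_eq_abs, abs_of_pos hs]
  have hs2 : ‖-(s : ℂ)‖ = s := by rw [norm_neg, hs1]
  refine (le_abs_self _).trans ?_
  rw [← Real.norm_eq_abs, ← Complex.norm_real, h]
  have a1 := h0 _ hs1
  have a2 := h0 _ hs2
  have a3 := h1 _ hs1
  have a4 := h1 _ hs2
  have tri : ∀ p q r t : ℂ, ‖(-p + q + r + t) / 2‖ ≤ (‖p‖ + ‖q‖ + ‖r‖ + ‖t‖) / 2 := by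
    intro p q r t
    rw [norm_div, Complex.norm_two]
    gcongr
    have := norm_add_le (-p + q + r) t
    have := norm_add_le (-p + q) r
    have := norm_add_le (-p) q
    rw [norm_neg] at this
    linarith
  refine (tri _ _ _ _).trans ?_
  rcases neg_one_pow_eq_or ℂ n with hn | hn <;>
    simp only [hn, one_mul, neg_mul, neg_neg] <;> linarith

end FluxLaw

/-! ### Large deviations of the flux. -/

/-- The effect on `log (max a b)` of tilting `b` by `exp t`. -/
noncomputable def logTilt (t a b : ℝ) : ℝ := Real.log (max a (Real.exp t * b)) - Real.log (max a b)

theorem max_tilt_pos {a b : ℝ} (h : 0 < max a b) (t : ℝ) : 0 < max a (Real.exp t * b) := by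
  rcases lt_max_iff.1 h with h | h
  · exact lt_max_of_lt_left h
  · exact lt_max_of_lt_right (by positivity)

theorem abs_logTilt_sub_le {a b : ℝ} (ha : 0 ≤ a) (hb : 0 ≤ b) (h : 0 < max a b) (t t' : ℝ) :
    |logTilt t a b - logTilt t' a b| ≤ |t - t'| := by
  wlog htt : t' ≤ t generalizing t t'
  · rw [abs_sub_comm, abs_sub_comm t]; exact this t' t (not_le.1 htt).le
  have h1 := max_tilt_pos h t
  have h2 := max_tilt_pos h t'
  have h3 : max a (Real.exp t' * b) ≤ max a (Real.exp t * b) := by gcongr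
  have h4 : max a (Real.exp t * b) ≤ Real.exp (t - t') * max a (Real.exp t' * b) := by
    rw [mul_max_of_nonneg _ _ (Real.exp_pos _).le, ← mul_assoc, ← Real.exp_add, sub_add_cancel]
    refine max_le_max_right _ ?_
    nlinarith [Real.one_le_exp (sub_nonneg.2 htt)]
  have h5 := Real.log_le_log h2 h3
  have h6 := Real.log_le_log h1 h4
  rw [Real.log_mul (Real.exp_pos _).ne' h2.ne', Real.log_exp] at h6
  unfold logTilt
  rw [abs_of_nonneg (by linarith), abs_of_nonneg (by linarith)]
  linarith

theorem logTilt_zero (a b : ℝ) : logTilt 0 a b = 0 := by simp [logTilt]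

theorem abs_logTilt_le {a b : ℝ} (ha : 0 ≤ a) (hb : 0 ≤ b) (h : 0 < max a b) (t : ℝ) :
    |logTilt t a b| ≤ |t| := by
  have := abs_logTilt_sub_le ha hb h t 0
  rwa [logTilt_zero, sub_zero, sub_zero] at this

/-- For small t the maximum remains with the same entry, so the function is t or 0 near the origin.
-/
theorem hasDerivAt_logTilt {a b : ℝ} (ha : 0 ≤ a) (hab : a ≠ b) :
    HasDerivAt (fun t => logTilt t a b) (if a < b then 1 else 0) 0 := by
  have hc : ContinuousAt (fun t : ℝ => Real.exp t * b) 0 := by fun_prop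
  have h0 : Real.exp 0 * b = b := by simp
  split_ifs with h
  · have hev : ∀ᶠ t in 𝓝 (0 : ℝ), logTilt t a b = t := by
      have : ∀ᶠ t in 𝓝 (0 : ℝ), a < Real.exp t * b :=
        hc.eventually (lt_mem_nhds (by show a < Real.exp 0 * b; rw [h0]; exact h))
      filter_upwards [this] with t ht
      have hb : 0 < b := ha.trans_lt h
      rw [logTilt, max_eq_right ht.le, max_eq_right h.le, Real.log_mul (Real.exp_pos _).ne' hb.ne',
        Real.log_exp]
      ring
    exact (hasDerivAt_id 0).congr_of_eventuallyEq hev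
  · have h' : b < a := lt_of_le_of_ne (not_lt.1 h) hab.symm
    have hev : ∀ᶠ t in 𝓝 (0 : ℝ), logTilt t a b = 0 := by
      have : ∀ᶠ t in 𝓝 (0 : ℝ), Real.exp t * b < a :=
        hc.eventually (gt_mem_nhds (by show Real.exp 0 * b < a; rw [h0]; exact h'))
      filter_upwards [this] with t ht
      rw [logTilt, max_eq_left ht.le, max_eq_left h'.le, sub_self]
    exact (hasDerivAt_const (0 : ℝ) (0 : ℝ)).congr_of_eventuallyEq hev

theorem pow_add_tilt_le {a b : ℝ} (ha : 0 ≤ a) (hb : 0 ≤ b) (h : 0 < max a b) (t : ℝ) (n : ℕ) :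
    a ^ n + Real.exp (n * t) * b ^ n ≤ 2 * (Real.exp (n * logTilt t a b) * max a b ^ n) := by
  have h1 := max_tilt_pos h t
  have h2 : Real.exp (n * logTilt t a b) * max a b ^ n = max a (Real.exp t * b) ^ n := by
    rw [Real.exp_nat_mul, ← mul_pow, logTilt, Real.exp_sub, Real.exp_log h1, Real.exp_log h,
      div_mul_cancel₀ _ h.ne']
  rw [h2, Real.exp_nat_mul, ← mul_pow, two_mul]
  have h3 : 0 ≤ Real.exp t * b := by positivity
  exact add_le_add (pow_le_pow_left₀ ha (le_max_left _ _) n)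
    (pow_le_pow_left₀ h3 (le_max_right _ _) n)

section FluxLaw

variable {α β γ : ℝ}

/-- The norm of the constant coefficient at angle `θ`. -/
noncomputable def absA (α θ : ℝ) : ℝ := ‖coefA α (Complex.exp (θ * Complex.I))‖

/-- The norm of the linear coefficient at angle `θ`. -/
noncomputable def absB (α β γ θ : ℝ) : ℝ := ‖coefB α β γ (Complex.exp (θ * Complex.I))‖

theorem continuous_absA : Continuous (absA α) := by unfold absA coefA; fun_prop

theorem continuous_absB : Continuous (absB α β γ) := by unfold absB coefB; fun_prop

variable (hα : 0 < α) (hβ : 0 < β) (hγ : 0 < γ) (hαβγ : 0 < γ ^ 2 - α * β)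

include hα hβ hαβγ

theorem max_abs_pos (θ : ℝ) : 0 < max (absA α θ) (absB α β γ θ) := by
  obtain ⟨c, hc, h⟩ := exists_max_norm_ge hα hβ hαβγ
  exact hc.trans_le (h θ)

theorem ae_absA_ne_absB : ∀ᵐ θ : ℝ, absA α θ ≠ absB α β γ θ := by
  filter_upwards [ae_cos_ne (critCos α β γ)] with θ hθ h
  have h1 := normSq_sub hα hβ hαβγ θ
  have h2 : absA α θ ^ 2 - absB α β γ θ ^ 2 = 0 := by rw [h]; ring
  rw [absA, absB] at h2
  rw [h2] at h1
  rcases mul_eq_zero.1 h1.symm with h3 | h3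
  · exact (cosSlope_pos hα hβ hαβγ).ne' h3
  · exact hθ (sub_eq_zero.1 h3)

theorem continuous_logTilt (t : ℝ) :
    Continuous fun θ => logTilt t (absA α θ) (absB α β γ θ) := by
  unfold logTilt
  have hA := continuous_absA (α := α)
  have hB := continuous_absB (α := α) (β := β) (γ := γ)
  refine Continuous.sub (Continuous.log (by fun_prop) fun θ => ?_)
    (Continuous.log (by fun_prop) fun θ => ?_)
  · exact (max_tilt_pos (max_abs_pos hα hβ hαβγ θ) t).ne'
  · exact (max_abs_pos hα hβ hαβγ θ).ne'

/-- The derivative is the proportion of frequencies with |A| < |B|. It exists because the norms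
agree only on a null set, and it turns out to be the mean flux divided by n. -/
theorem exists_hasDerivAt_mean : ∃ μ : ℝ, HasDerivAt
    (fun t => (2 * Real.pi)⁻¹ • ∫ θ in 0..2 * Real.pi, logTilt t (absA α θ) (absB α β γ θ))
      μ 0 := by
  have h := intervalIntegral.hasDerivAt_integral_of_dominated_loc_of_lip
    (μ := volume) (a := 0) (b := 2 * Real.pi) (s := Set.univ) (x₀ := (0 : ℝ)) (𝕜 := ℝ)
    (F := fun t θ => logTilt t (absA α θ) (absB α β γ θ))
    (F' := fun θ => if absA α θ < absB α β γ θ then 1 else 0) (bound := fun _ => 1)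
    Filter.univ_mem
    (Eventually.of_forall fun t =>
      (continuous_logTilt hα hβ hαβγ t).aestronglyMeasurable)
    ((continuous_logTilt hα hβ hαβγ 0).intervalIntegrable _ _)
    (by
      refine StronglyMeasurable.aestronglyMeasurable ?_
      refine StronglyMeasurable.ite (measurableSet_lt continuous_absA.measurable
        continuous_absB.measurable) stronglyMeasurable_const stronglyMeasurable_const)
    (Eventually.of_forall fun θ _ => by
      rw [lipschitzOnWith_iff_dist_le_mul]
      intro t _ t' _
      rw [Real.dist_eq, Real.dist_eq]
      rw [show ((Real.nnabs 1 : NNReal) : ℝ) = 1 by simp, one_mul]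
      exact abs_logTilt_sub_le (a := absA α θ) (b := absB α β γ θ) (norm_nonneg _) (norm_nonneg _)
        (max_abs_pos hα hβ hαβγ θ) t t')
    intervalIntegrable_const
    (by
      filter_upwards [ae_absA_ne_absB hα hβ hαβγ] with θ hθ _
      exact hasDerivAt_logTilt (norm_nonneg _) hθ)
  exact ⟨_, h.2.const_smul (2 * Real.pi)⁻¹⟩

include hγ

/-- Each factor a^n + e^(nt) b^n is at most twice max(a, e^t b)^n. The loss 2^n is negligible at the
scale exp(n²), and the untilted product left over is at most the partition function. -/
theorem flux_moment_le_exp {n : ℕ} [NeZero n] [Fact (1 < n)] (t : ℝ) {Λ : ℝ}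
    (hΛ : ∀ σ : ℝ, σ = 0 ∨ σ = Real.pi → ∑ j ∈ Finset.range n,
      logTilt t (absA α ((2 * Real.pi * j + σ) / n)) (absB α β γ ((2 * Real.pi * j + σ) / n)) ≤
        n * Λ) :
    ∑ ρ : GenSnake (ZMod n), snakeWeight n α β γ ρ * Real.exp (n * t) ^ fluxN (moved ρ.1) ≤
      2 ^ (n + 1) * Real.exp (n ^ 2 * Λ) * snakePartition n α β γ := by
  have h1 : ∀ σ : ℝ, σ = 0 ∨ σ = Real.pi → ∏ j ∈ Finset.range n,
      (‖coefA α (gridPoint n σ j)‖ ^ n + Real.exp (n * t) * ‖coefB α β γ (gridPoint n σ j)‖ ^ n) ≤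
      2 ^ n * Real.exp (n ^ 2 * Λ) * snakePartition n α β γ := by
    intro σ hσ
    have h2 : ∀ j ∈ Finset.range n, ‖coefA α (gridPoint n σ j)‖ ^ n +
        Real.exp (n * t) * ‖coefB α β γ (gridPoint n σ j)‖ ^ n ≤
        2 * (Real.exp (n * logTilt t (absA α ((2 * Real.pi * j + σ) / n))
          (absB α β γ ((2 * Real.pi * j + σ) / n))) *
          max ‖coefA α (gridPoint n σ j)‖ ‖coefB α β γ (gridPoint n σ j)‖ ^ n) := fun j _ =>
      pow_add_tilt_le (norm_nonneg _) (norm_nonneg _) (max_abs_pos hα hβ hαβγ _) t n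
    refine (Finset.prod_le_prod (fun j _ => by positivity) h2).trans ?_
    rw [Finset.prod_mul_distrib, Finset.prod_mul_distrib, ← Real.exp_sum, ← Finset.mul_sum,
      Finset.prod_const, Finset.card_range, mul_assoc]
    have h3 := prod_max_le_snakePartition hα hβ hγ hαβγ (n := n) σ
    have h4 : Real.exp (n * ∑ j ∈ Finset.range n, logTilt t (absA α ((2 * Real.pi * j + σ) / n))
        (absB α β γ ((2 * Real.pi * j + σ) / n))) ≤ Real.exp (n ^ 2 * Λ) := by
      rw [Real.exp_le_exp, sq, mul_assoc]
      exact mul_le_mul_of_nonneg_left (hΛ σ hσ) (Nat.cast_nonneg n)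
    have h5 : 0 ≤ ∏ j ∈ Finset.range n,
        max ‖coefA α (gridPoint n σ j)‖ ‖coefB α β γ (gridPoint n σ j)‖ ^ n :=
      Finset.prod_nonneg fun j _ => by positivity
    gcongr
  refine (flux_moment_le hα hβ hγ hαβγ (Real.exp_pos _)).trans ?_
  refine (add_le_add (h1 0 (Or.inl rfl)) (h1 Real.pi (Or.inr rfl))).trans (le_of_eq ?_)
  ring

/-- Chernoff's bound for the flux. -/
theorem flux_tail_le {n : ℕ} [NeZero n] [Fact (1 < n)] {t μ η Λ : ℝ}
    (hΛ : ∀ σ : ℝ, σ = 0 ∨ σ = Real.pi → ∑ j ∈ Finset.range n,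
      logTilt t (absA α ((2 * Real.pi * j + σ) / n)) (absB α β γ ((2 * Real.pi * j + σ) / n)) ≤
        n * Λ) :
    ∑ ρ : GenSnake (ZMod n), snakeWeight n α β γ ρ *
      (if η * n ≤ t * (fluxN (moved ρ.1) - n * μ) then 1 else 0) ≤
      2 ^ (n + 1) * Real.exp (n ^ 2 * (Λ - t * μ - η)) * snakePartition n α β γ := by
  have h1 := sum_weight_mono hα hβ hγ hαβγ (n := n)
    (φ := fun Y => if η * n ≤ t * (fluxN Y - n * μ) then 1 else 0)
    (ψ := fun Y => Real.exp (n ^ 2 * (-t * μ - η)) * Real.exp (n * t) ^ fluxN Y) (by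
      intro Y
      rw [← Real.exp_nat_mul, ← Real.exp_add]
      split_ifs with h
      · rw [Real.one_le_exp_iff]
        have h2 : (0 : ℝ) ≤ n := Nat.cast_nonneg n
        nlinarith
      · positivity)
  refine h1.trans ?_
  have h2 := flux_moment_le_exp hα hβ hγ hαβγ t hΛ
  have h3 : ∑ ρ : GenSnake (ZMod n), snakeWeight n α β γ ρ *
      (Real.exp (n ^ 2 * (-t * μ - η)) * Real.exp (n * t) ^ fluxN (moved ρ.1)) =
      Real.exp (n ^ 2 * (-t * μ - η)) * ∑ ρ : GenSnake (ZMod n),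
        snakeWeight n α β γ ρ * Real.exp (n * t) ^ fluxN (moved ρ.1) := by
    rw [Finset.mul_sum]
    exact Finset.sum_congr rfl fun ρ _ => by ring
  rw [h3]
  refine (mul_le_mul_of_nonneg_left h2 (Real.exp_pos _).le).trans (le_of_eq ?_)
  rw [show (n : ℝ) ^ 2 * (Λ - t * μ - η) = n ^ 2 * (-t * μ - η) + n ^ 2 * Λ by ring, Real.exp_add]
  ring

/-- The law of large numbers for the flux. -/
theorem exists_flux_lln : ∃ μ : ℝ, ∀ η > 0, ∀ ε > 0, ∀ᶠ n : ℕ in atTop,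
    ∀ [NeZero n] [Fact (1 < n)], ∑ ρ : GenSnake (ZMod n), snakeWeight n α β γ ρ *
      (if η * n ≤ |(fluxN (moved ρ.1) : ℝ) - n * μ| then 1 else 0) ≤
        ε * snakePartition n α β γ := by
  obtain ⟨μ, hμ⟩ := exists_hasDerivAt_mean hα hβ hαβγ
  refine ⟨μ, fun η hη ε hε => ?_⟩
  set 𝒢 : ℝ → ℝ := fun t =>
    (2 * Real.pi)⁻¹ • ∫ θ in 0..2 * Real.pi, logTilt t (absA α θ) (absB α β γ θ) with h𝒢
  have h𝒢0 : 𝒢 0 = 0 := by simp [h𝒢, logTilt_zero]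
  have hlin : ∀ᶠ t in 𝓝 (0 : ℝ), |𝒢 t - t * μ| ≤ η / 4 * |t| := by
    have h := (hasDerivAt_iff_isLittleO.1 hμ).def (show (0 : ℝ) < η / 4 by positivity)
    filter_upwards [h] with t ht
    simpa [h𝒢0] using ht
  obtain ⟨r, hr, hball⟩ := Metric.eventually_nhds_iff.1 hlin
  -- The linearisation at 0 and the Riemann sum each cost η|t|/4 of the available η|t|. The exponent
  -- left is -n² η|t|/2, which beats 2^(n+1).
  have htail : ∀ t : ℝ, t ≠ 0 → |t| < r → ∀ᶠ n : ℕ in atTop,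
      ∀ [NeZero n] [Fact (1 < n)], ∑ ρ : GenSnake (ZMod n), snakeWeight n α β γ ρ *
        (if |t| * η * n ≤ t * ((fluxN (moved ρ.1) : ℝ) - n * μ) then 1 else 0) ≤
          ε / 2 * snakePartition n α β γ := by
    intro t ht htr
    have ht' : 0 < |t| := abs_pos.2 ht
    have hG : 𝒢 t ≤ t * μ + η / 4 * |t| := by
      have := hball (y := t) (by rwa [Real.dist_eq, sub_zero])
      linarith [le_abs_self (𝒢 t - t * μ)]
    have hR : ∀ σ : ℝ, ∀ᶠ n : ℕ in atTop, ∑ j ∈ Finset.range n,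
        logTilt t (absA α ((2 * Real.pi * j + σ) / n)) (absB α β γ ((2 * Real.pi * j + σ) / n)) ≤
        n * (𝒢 t + η / 4 * |t|) := by
      intro σ
      have h := tendsto_riemann_sum (f := fun θ => logTilt t (absA α θ) (absB α β γ θ)) (M := |t|)
        (fun θ => abs_logTilt_le (norm_nonneg _) (norm_nonneg _) (max_abs_pos hα hβ hαβγ θ) t)
        (Eventually.of_forall fun θ => (continuous_logTilt hα hβ hαβγ t).continuousAt) σ
      have h2 := h.eventually (gt_mem_nhds (show 𝒢 t < 𝒢 t + η / 4 * |t| by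
        have : 0 < η / 4 * |t| := by positivity
        linarith))
      filter_upwards [h2, eventually_gt_atTop 0] with n hn hn0
      have hn' : (0 : ℝ) < n := by exact_mod_cast hn0
      rw [smul_eq_mul, inv_mul_lt_iff₀ hn'] at hn
      exact hn.le
    have hexp : ∀ᶠ n : ℕ in atTop,
        (2 : ℝ) ^ (n + 1) * Real.exp (n ^ 2 * (-(η / 2 * |t|))) ≤ ε / 2 := by
      have hc : 0 < η / 2 * |t| := by positivity
      obtain ⟨m, hm⟩ := exists_nat_gt ((1 + |Real.log (ε / 2)|) / (η / 2 * |t|) +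
        2 / (η / 2 * |t|))
      filter_upwards [eventually_ge_atTop (max m 1)] with n hn
      have hn1 : (1 : ℝ) ≤ n := by exact_mod_cast (le_max_right m 1).trans hn
      have hnm : (m : ℝ) ≤ n := by exact_mod_cast (le_max_left m 1).trans hn
      rw [← add_div, div_lt_iff₀ hc] at hm
      have h1 : (2 : ℝ) ^ (n + 1) ≤ Real.exp (n + 1) := by
        have : (2 : ℝ) ≤ Real.exp 1 := by linarith [Real.add_one_le_exp (1 : ℝ)]
        calc (2 : ℝ) ^ (n + 1) ≤ Real.exp 1 ^ (n + 1) := by gcongr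
          _ = Real.exp (n + 1) := by rw [← Real.exp_nat_mul]; push_cast; ring_nf
      calc (2 : ℝ) ^ (n + 1) * Real.exp (n ^ 2 * (-(η / 2 * |t|)))
          ≤ Real.exp (n + 1) * Real.exp (n ^ 2 * (-(η / 2 * |t|))) := by gcongr
        _ = Real.exp (n + 1 - n * (n * (η / 2 * |t|))) := by rw [← Real.exp_add]; ring_nf
        _ ≤ Real.exp (Real.log (ε / 2)) := by
            rw [Real.exp_le_exp]
            have h2 : 1 + |Real.log (ε / 2)| + 2 ≤ n * (η / 2 * |t|) :=
              hm.le.trans (mul_le_mul_of_nonneg_right hnm hc.le)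
            have h3 := neg_abs_le (Real.log (ε / 2))
            nlinarith [abs_nonneg (Real.log (ε / 2))]
        _ = ε / 2 := Real.exp_log (by positivity)
    filter_upwards [hR 0, hR Real.pi, hexp] with n h0 hpi he
    intro _ _
    have hZ := snakePartition_pos_of_fact hα hβ hγ hαβγ (n := n)
    refine (flux_tail_le hα hβ hγ hαβγ (μ := μ) (Λ := 𝒢 t + η / 4 * |t|) (by
      rintro σ (rfl | rfl)
      · exact h0
      · exact hpi)).trans ?_
    refine mul_le_mul_of_nonneg_right (le_trans ?_ he) hZ.le
    gcongr
    linarith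
  have hr2 : |r / 2| < r := by rw [abs_of_pos (by positivity)]; linarith
  filter_upwards [htail (r / 2) (by positivity) hr2,
    htail (-(r / 2)) (by simp [hr.ne']) (by rwa [abs_neg])] with n h1 h2
  intro _ _
  have hmono := sum_weight_mono hα hβ hγ hαβγ (n := n)
    (φ := fun Y => if η * n ≤ |(fluxN Y : ℝ) - n * μ| then 1 else 0)
    (ψ := fun Y => (if |r / 2| * η * n ≤ r / 2 * ((fluxN Y : ℝ) - n * μ) then 1 else 0) +
      if |-(r / 2)| * η * n ≤ -(r / 2) * ((fluxN Y : ℝ) - n * μ) then 1 else 0) (by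
      intro Y
      rw [abs_neg, abs_of_pos (show 0 < r / 2 by positivity)]
      by_cases h : η * n ≤ |(fluxN Y : ℝ) - n * μ|
      · rw [if_pos h]
        rcases le_abs.1 h with h | h
        · rw [if_pos (show r / 2 * η * n ≤ r / 2 * ((fluxN Y : ℝ) - n * μ) by
            rw [mul_assoc]; gcongr)]
          split_ifs <;> norm_num
        · rw [if_pos (show r / 2 * η * n ≤ -(r / 2) * ((fluxN Y : ℝ) - n * μ) by
            rw [mul_assoc, neg_mul, ← mul_neg]; gcongr)]
          split_ifs <;> norm_num
      · rw [if_neg h]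
        split_ifs <;> norm_num)
  refine hmono.trans ?_
  simp only [mul_add, Finset.sum_add_distrib]
  have := add_le_add (h1) (h2)
  refine this.trans (le_of_eq (by ring))

end FluxLaw

/-! ### Coefficients of 1/(a - ωb), cyclic and Laurent. -/

section Kernel

/-- The coefficient of `ω ^ m` in the inverse of `a - ω b` modulo `ω ^ n = z`. -/
noncomputable def cyclicCoeff (n m : ℕ) (a b z : ℂ) : ℂ := a ^ (n - 1 - m) * b ^ m / (a ^ n - z * b ^ n)

/-- The coefficient of `ω ^ m` in the Laurent expansion of the inverse of `a - ω b` on the unit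
circle. -/
noncomputable def laurentCoeff (m : ℕ) (a b : ℂ) : ℂ := if ‖b‖ < ‖a‖ then b ^ m / a ^ (m + 1) else 0

/-- At an n-th root of unity ω, the geometric sum writes 1/(a - ωb) as a polynomial in ω of degree
below n; orthogonality of characters extracts one coefficient. -/
theorem sum_inv_sub_stdAddChar {n : ℕ} [NeZero n] {a b : ℂ} (h : a ^ n ≠ b ^ n) {m : ℕ}
    (hm : m < n) : (n : ℂ)⁻¹ * ∑ k : ZMod n, ZMod.stdAddChar (k * -(m : ZMod n)) /
      (a - ZMod.stdAddChar k * b) = cyclicCoeff n m a b 1 := by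
  have hn : (n : ℂ) ≠ 0 := Nat.cast_ne_zero.2 (NeZero.ne n)
  have h0 : a ^ n - b ^ n ≠ 0 := sub_ne_zero.2 h
  have h1 : ∀ k : ZMod n, ZMod.stdAddChar (k * -(m : ZMod n)) / (a - ZMod.stdAddChar k * b) =
      ∑ j ∈ Finset.range n, (a ^ (n - 1 - j) * b ^ j / (a ^ n - b ^ n)) *
        ZMod.stdAddChar (k * ((j : ZMod n) - (m : ZMod n))) := by
    intro k
    have hk : (ZMod.stdAddChar k : ℂ) ^ n = 1 := by
      rw [← AddChar.map_nsmul_eq_pow]; simp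
    have hg := Commute.mul_geom_sum₂ (Commute.all (ZMod.stdAddChar k * b) a) n
    rw [mul_pow, hk, one_mul] at hg
    have h2 : a - ZMod.stdAddChar k * b ≠ 0 := by
      intro h3
      apply h0
      rw [← neg_sub, ← hg, ← neg_sub a, h3]; simp
    rw [div_eq_iff h2]
    have h4 : ∀ j : ℕ, ZMod.stdAddChar (k * ((j : ZMod n) - (m : ZMod n))) =
        ZMod.stdAddChar (k * -(m : ZMod n)) * (ZMod.stdAddChar k : ℂ) ^ j := by
      intro j
      rw [← AddChar.map_nsmul_eq_pow, ← AddChar.map_add_eq_mul]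
      congr 1
      rw [nsmul_eq_mul]; ring
    simp only [h4]
    have h5 : ∑ j ∈ Finset.range n, a ^ (n - 1 - j) * b ^ j / (a ^ n - b ^ n) *
        (ZMod.stdAddChar (k * -(m : ZMod n)) * (ZMod.stdAddChar k : ℂ) ^ j) =
        ZMod.stdAddChar (k * -(m : ZMod n)) / (a ^ n - b ^ n) *
          ∑ j ∈ Finset.range n, (ZMod.stdAddChar k * b) ^ j * a ^ (n - 1 - j) := by
      rw [Finset.mul_sum]
      refine Finset.sum_congr rfl fun j _ => ?_
      rw [mul_pow]; ring
    rw [h5, mul_assoc, mul_comm (Finset.sum _ _), ← neg_sub (ZMod.stdAddChar k * b), neg_mul, hg]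
    field_simp
    ring
  simp only [h1]
  rw [Finset.sum_comm]
  simp only [← Finset.mul_sum, sum_stdAddChar_mul]
  rw [Finset.sum_eq_single m]
  · rw [if_pos (sub_self _), cyclicCoeff, one_mul]
    field_simp
  · intro j hj hjm
    rw [if_neg, mul_zero]
    intro h2
    rw [sub_eq_zero, ZMod.natCast_eq_natCast_iff', Nat.mod_eq_of_lt (Finset.mem_range.1 hj),
      Nat.mod_eq_of_lt hm] at h2
    exact hjm h2
  · intro h2; exact absurd (Finset.mem_range.2 hm) h2

/-- N r^N is at most 1 + r + ... + r^(N-1) = (1 - r^N)/(1 - r), and r^n ≤ r^N. -/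
theorem pow_div_one_sub_pow_le {r : ℝ} (h0 : 0 ≤ r) (h1 : r < 1) {N n : ℕ} (hN : 0 < N)
    (hn : N ≤ n) : r ^ N / (1 - r ^ n) ≤ 1 / (N * (1 - r)) := by
  have hN' : (0 : ℝ) < N := Nat.cast_pos.2 hN
  have h2 : r ^ n ≤ r ^ N := pow_le_pow_of_le_one h0 h1.le hn
  have h3 : r ^ N < 1 := pow_lt_one₀ h0 h1 hN.ne'
  have h4 : (N : ℝ) * (1 - r) * r ^ N ≤ 1 - r ^ N := by
    have h5 := mul_neg_geom_sum r N
    have h6 : (N : ℝ) * r ^ N ≤ ∑ i ∈ Finset.range N, r ^ i := by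
      have : ∑ i ∈ Finset.range N, r ^ N ≤ ∑ i ∈ Finset.range N, r ^ i :=
        Finset.sum_le_sum fun i hi =>
          pow_le_pow_of_le_one h0 h1.le (Finset.mem_range.1 hi).le
      simpa using this
    nlinarith
  have h7 : 0 < 1 - r := by linarith
  rw [div_le_div_iff₀ (by linarith) (by positivity)]
  nlinarith

/-- With r the ratio of the smaller norm to the larger, the error has the form r^N/(1 - r^n). The
bound is uniform in the twist and blows up only like the reciprocal of the gap, which suits
frequencies at a moderate distance from degeneracy. -/
theorem norm_cyclicCoeff_sub_laurentCoeff_le {n m : ℕ} (hm : m + 1 < n) {a b z : ℂ} (hz : ‖z‖ = 1)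
    (hab : ‖a‖ ≠ ‖b‖) : ‖cyclicCoeff n m a b z - laurentCoeff m a b‖ ≤
      1 / ((n - 1 - m : ℕ) * |‖a‖ - ‖b‖|) := by
  have hN : 0 < n - 1 - m := by omega
  have hlow : ∀ N : ℕ, ∀ u v : ℝ, 0 ≤ v → v < u → 0 < N → N ≤ n →
      v ^ N / u ^ N / (u * (1 - (v / u) ^ n)) ≤ 1 / (N * |u - v|) := by
    intro N u v hv hvu hN0 hNn
    have hu : 0 < u := hv.trans_lt hvu
    have h1 := pow_div_one_sub_pow_le (div_nonneg hv hu.le) ((div_lt_one hu).2 hvu) hN0 hNn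
    have hN' : (0 : ℝ) < N := Nat.cast_pos.2 hN0
    rw [abs_of_pos (sub_pos.2 hvu), ← div_pow, ← div_div, div_right_comm, div_le_iff₀ hu]
    refine h1.trans (le_of_eq ?_)
    have : u - v ≠ 0 := (sub_pos.2 hvu).ne'
    have : 1 - v / u ≠ 0 := by
      rw [one_sub_div hu.ne']; exact div_ne_zero this hu.ne'
    field_simp
  rcases lt_or_gt_of_ne hab with h | h
  · rw [laurentCoeff, if_neg (not_lt.2 h.le), sub_zero, cyclicCoeff, norm_div, norm_mul, norm_pow,
      norm_pow]
    have hb : 0 < ‖b‖ := (norm_nonneg _).trans_lt h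
    have hpow : ‖a‖ ^ n < ‖b‖ ^ n := pow_lt_pow_left₀ h (norm_nonneg _) (by omega)
    have h1 : ‖b‖ ^ n - ‖a‖ ^ n ≤ ‖a ^ n - z * b ^ n‖ := by
      have := norm_sub_norm_le (z * b ^ n) (a ^ n)
      rw [norm_mul, hz, one_mul, norm_pow, norm_pow, norm_sub_rev] at this
      exact this
    refine (div_le_div_of_nonneg_left (by positivity) (by linarith) h1).trans ?_
    refine le_trans (le_of_eq ?_) ((hlow (n - 1 - m) ‖b‖ ‖a‖ (norm_nonneg _) h hN
      (by omega)).trans (by rw [abs_sub_comm]))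
    rw [div_pow, one_sub_div (by positivity)]
    have h2 : ‖b‖ ^ n - ‖a‖ ^ n ≠ 0 := by linarith
    have h3 : ‖b‖ ^ n = ‖b‖ ^ (n - 1 - m) * ‖b‖ ^ m * ‖b‖ := by
      rw [← pow_add, ← pow_succ]; congr 1; omega
    rw [div_div, mul_div_assoc', mul_div_assoc', div_div_eq_mul_div, div_eq_div_iff h2
      (by positivity)]
    linear_combination (-‖a‖ ^ (n - 1 - m) * (‖b‖ ^ n - ‖a‖ ^ n)) * h3
  · have ha : 0 < ‖a‖ := (norm_nonneg _).trans_lt h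
    have ha' : a ≠ 0 := norm_pos_iff.1 ha
    have hpow : ‖b‖ ^ n < ‖a‖ ^ n := pow_lt_pow_left₀ h (norm_nonneg _) (by omega)
    have h1 : ‖a‖ ^ n - ‖b‖ ^ n ≤ ‖a ^ n - z * b ^ n‖ := by
      have := norm_sub_norm_le (a ^ n) (z * b ^ n)
      rw [norm_mul, hz, one_mul, norm_pow, norm_pow] at this
      exact this
    have hne : a ^ n - z * b ^ n ≠ 0 := by
      rw [← norm_pos_iff]; linarith
    have h2 : cyclicCoeff n m a b z - laurentCoeff m a b =
        z * b ^ (n + m) / (a ^ (m + 1) * (a ^ n - z * b ^ n)) := by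
      rw [laurentCoeff, if_pos h, cyclicCoeff, div_sub_div _ _ hne (pow_ne_zero _ ha'),
        mul_comm (a ^ (m + 1))]
      congr 1
      have : a ^ n = a ^ (n - 1 - m) * a ^ (m + 1) := by
        rw [← pow_add]; congr 1; omega
      rw [pow_add b, this]
      ring
    have h4 : ‖b‖ ^ m ≤ ‖a‖ ^ m := pow_le_pow_left₀ (norm_nonneg _) h.le m
    have h5 := hlow n ‖a‖ ‖b‖ (norm_nonneg _) h (by omega) le_rfl
    have h6 : 0 < ‖a‖ - ‖b‖ := sub_pos.2 h
    calc ‖cyclicCoeff n m a b z - laurentCoeff m a b‖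
        = ‖b‖ ^ n * ‖b‖ ^ m / (‖a‖ ^ m * ‖a‖ * ‖a ^ n - z * b ^ n‖) := by
          rw [h2, norm_div, norm_mul, norm_mul, hz, one_mul, norm_pow, norm_pow, pow_add, pow_succ]
      _ ≤ ‖b‖ ^ n * ‖a‖ ^ m / (‖a‖ ^ m * ‖a‖ * (‖a‖ ^ n - ‖b‖ ^ n)) := by
          have : 0 < ‖a‖ ^ n - ‖b‖ ^ n := by linarith
          gcongr
      _ = ‖b‖ ^ n / ‖a‖ ^ n / (‖a‖ * (1 - (‖b‖ / ‖a‖) ^ n)) := by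
          have : ‖a‖ ^ n - ‖b‖ ^ n ≠ 0 := by linarith
          rw [div_pow, one_sub_div (by positivity)]
          field_simp
      _ ≤ 1 / (n * |‖a‖ - ‖b‖|) := h5
      _ ≤ 1 / ((n - 1 - m : ℕ) * |‖a‖ - ‖b‖|) := by
          have : ((n - 1 - m : ℕ) : ℝ) ≤ n := by exact_mod_cast (by omega)
          have h7 : (0 : ℝ) < (n - 1 - m : ℕ) := Nat.cast_pos.2 hN
          rw [abs_of_pos h6]
          gcongr

theorem norm_laurentCoeff_le (m : ℕ) (a b : ℂ) (h : 0 < max ‖a‖ ‖b‖) :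
    ‖laurentCoeff m a b‖ ≤ 1 / max ‖a‖ ‖b‖ := by
  unfold laurentCoeff
  split_ifs with h1
  · have ha : 0 < ‖a‖ := (norm_nonneg _).trans_lt h1
    rw [max_eq_left h1.le, norm_div, norm_pow, norm_pow, pow_succ, div_le_div_iff₀ (by positivity) ha]
    have := pow_le_pow_left₀ (norm_nonneg _) h1.le m
    nlinarith
  · rw [norm_zero]; positivity

/-- Serves the nearly degenerate frequencies, where κ comes from the choice of the twist. -/
theorem norm_cyclicCoeff_le {n m : ℕ} (hm : m < n) {a b z : ℂ} {κ : ℝ} (hκ : 0 < κ)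
    (h : 0 < max ‖a‖ ‖b‖) (hab : κ * max ‖a‖ ‖b‖ ^ n ≤ ‖a ^ n - z * b ^ n‖) :
    ‖cyclicCoeff n m a b z‖ ≤ 1 / (κ * max ‖a‖ ‖b‖) := by
  have h1 : ‖a‖ ^ (n - 1 - m) * ‖b‖ ^ m ≤ max ‖a‖ ‖b‖ ^ (n - 1) := by
    calc ‖a‖ ^ (n - 1 - m) * ‖b‖ ^ m ≤ max ‖a‖ ‖b‖ ^ (n - 1 - m) * max ‖a‖ ‖b‖ ^ m := by
          gcongr
          · exact le_max_left _ _
          · exact le_max_right _ _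
      _ = _ := by rw [← pow_add]; congr 1; omega
  have h2 : max ‖a‖ ‖b‖ ^ n = max ‖a‖ ‖b‖ ^ (n - 1) * max ‖a‖ ‖b‖ := by
    rw [← pow_succ]; congr 1; omega
  rw [cyclicCoeff, norm_div, norm_mul, norm_pow, norm_pow]
  calc _ ≤ max ‖a‖ ‖b‖ ^ (n - 1) / (κ * max ‖a‖ ‖b‖ ^ n) := by gcongr
    _ = _ := by rw [h2]; field_simp

end Kernel

/-! ### Distance of grid points from a fixed angle. -/

section Spacing

/-- The separation of a grid point of the discrete circle from the fixed angle `t`: the rank of the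
point, counted from `t` in the nearer direction. -/
noncomputable def angularRank (n : ℕ) (σ t : ℝ) (k : ZMod n) : ℕ :=
  let i := (k + (⌊(σ - n * t) / (2 * Real.pi)⌋ : ℤ)).val
  min i (n - 1 - i)

/-- Modulo π the half-angle is π(i + f)/n, with i the cyclic index counted from t and 0 ≤ f < 1.
Jordan's inequality is applied from whichever end of [0, π] is nearer. -/
theorem abs_sin_grid_ge {n : ℕ} [NeZero n] (σ t : ℝ) (k : ZMod n) :
    2 * (angularRank n σ t k : ℝ) / n ≤
      |Real.sin (((2 * Real.pi * k.val + σ) / n - t) / 2)| := by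
  have hn : (0 : ℝ) < n := Nat.cast_pos.2 (NeZero.pos n)
  set s := (σ - n * t) / (2 * Real.pi) with hs
  set i := (k + (⌊s⌋ : ℤ)).val with hi
  have hin : i < n := ZMod.val_lt _
  obtain ⟨l, hl⟩ : ∃ l : ℤ, (k.val : ℤ) + ⌊s⌋ = i + n * l := by
    have h1 : (((k.val : ℤ) + ⌊s⌋ : ℤ) : ZMod n) = ((i : ℤ) : ZMod n) := by
      push_cast
      rw [ZMod.natCast_zmod_val, hi, ZMod.natCast_zmod_val]
    rw [ZMod.intCast_eq_intCast_iff_dvd_sub] at h1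
    obtain ⟨l, hl⟩ := h1
    exact ⟨-l, by linarith⟩
  have hl' : (k.val : ℝ) + ⌊s⌋ = i + n * l := by exact_mod_cast hl
  have hang : ((2 * Real.pi * k.val + σ) / n - t) / 2 =
      Real.pi * ((i + Int.fract s) / n) + l * Real.pi := by
    have h2 : s = ⌊s⌋ + Int.fract s := (Int.floor_add_fract s).symm
    have h3 : σ - n * t = 2 * Real.pi * s := by rw [hs]; field_simp
    have h4 : (k.val : ℝ) + s = i + Int.fract s + n * l := by linarith
    have h5 : ((2 * Real.pi * k.val + σ) / n - t) / 2 = Real.pi * ((k.val + s) / n) := by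
      field_simp
      linarith
    rw [h5, h4]
    field_simp
  have hf0 := Int.fract_nonneg s
  have hf1 := (Int.fract_lt_one s).le
  set x := ((i : ℝ) + Int.fract s) / n with hx
  have hi1 : (i : ℝ) + 1 ≤ n := by exact_mod_cast hin
  have hx0 : 0 ≤ x := by positivity
  have hx1 : x ≤ 1 := by rw [hx, div_le_one hn]; linarith
  have hr1 : (angularRank n σ t k : ℝ) / n ≤ x := by
    rw [hx]
    gcongr
    have : (angularRank n σ t k : ℝ) ≤ i := by exact_mod_cast min_le_left _ _
    linarith
  have hr2 : (angularRank n σ t k : ℝ) / n ≤ 1 - x := by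
    rw [hx, one_sub_div hn.ne']
    gcongr
    have h1 : angularRank n σ t k ≤ n - 1 - i := min_le_right _ _
    have h2 : angularRank n σ t k + (1 + i) ≤ n := by omega
    have : (angularRank n σ t k : ℝ) + (1 + i) ≤ n := by exact_mod_cast h2
    linarith
  rw [hang, Real.sin_add_int_mul_pi, abs_mul, abs_zpow, abs_neg, abs_one, one_zpow, one_mul]
  rw [mul_div_assoc]
  have hpi := Real.pi_pos
  rcases le_total x (1 / 2) with h | h
  · have h1 := Real.mul_le_sin (x := Real.pi * x) (by positivity) (by nlinarith)
    refine le_trans ?_ (h1.trans (le_abs_self _))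
    rw [← mul_assoc, div_mul_cancel₀ _ hpi.ne']
    linarith
  · have h1 := Real.mul_le_sin (x := Real.pi * (1 - x)) (by nlinarith) (by nlinarith)
    rw [show Real.pi * (1 - x) = Real.pi - Real.pi * x by ring, Real.sin_pi_sub] at h1
    refine le_trans ?_ (h1.trans (le_abs_self _))
    rw [show Real.pi - Real.pi * x = Real.pi * (1 - x) by ring, ← mul_assoc,
      div_mul_cancel₀ _ hpi.ne']
    linarith

theorem sum_angularRank {n : ℕ} [NeZero n] {M : Type*} [AddCommMonoid M] (σ t : ℝ) (f : ℕ → M) :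
    ∑ k : ZMod n, f (angularRank n σ t k) = ∑ i ∈ Finset.range n, f (min i (n - 1 - i)) := by
  rw [← sum_zmod_val (fun i => f (min i (n - 1 - i)))]
  exact Fintype.sum_equiv (Equiv.addRight ((⌊(σ - n * t) / (2 * Real.pi)⌋ : ℤ) : ZMod n)) _ _
    fun k => rfl

theorem card_angularRank_lt {n : ℕ} [NeZero n] (σ t : ℝ) (J : ℕ) :
    (Finset.univ.filter fun k : ZMod n => angularRank n σ t k < J).card ≤ 2 * J := by
  rw [Finset.card_filter, sum_angularRank σ t (fun r => if r < J then 1 else 0),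
    ← Finset.card_filter]
  have h : (Finset.range n).filter (fun i => min i (n - 1 - i) < J) ⊆
      Finset.range J ∪ (Finset.range J).image (fun i => n - 1 - i) := by
    intro i hi
    simp only [Finset.mem_filter, Finset.mem_range] at hi
    simp only [Finset.mem_union, Finset.mem_range, Finset.mem_image]
    by_cases h1 : i < J
    · exact Or.inl h1
    · exact Or.inr ⟨n - 1 - i, by omega, by omega⟩
  refine (Finset.card_le_card h).trans ((Finset.card_union_le _ _).trans ?_)
  have := Finset.card_image_le (s := Finset.range J) (f := fun i => n - 1 - i)
  rw [Finset.card_range] at *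
  omega

theorem sum_inv_sq_le {J : ℕ} (hJ : 0 < J) (N : ℕ) :
    ∑ i ∈ Finset.range N, (if i < J then (0 : ℝ) else 1 / (i : ℝ) ^ 2) ≤ 2 / J := by
  have hJ' : (0 : ℝ) < J := Nat.cast_pos.2 hJ
  have key : ∀ N : ℕ, J ≤ N → ∑ i ∈ Finset.range N, (if i < J then (0 : ℝ) else 1 / (i : ℝ) ^ 2) ≤
      2 / J - 2 / N := by
    intro N hN
    induction N, hN using Nat.le_induction with
    | base =>
      rw [Finset.sum_eq_zero, sub_self]
      intro i hi; rw [if_pos (Finset.mem_range.1 hi)]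
    | succ m hm ih =>
      have hm1 : (1 : ℝ) ≤ m := by exact_mod_cast hJ.trans_le hm
      have hm' : (0 : ℝ) < m := by linarith
      rw [Finset.sum_range_succ, if_neg (not_lt.2 hm)]
      push_cast
      have : (1 : ℝ) / m ^ 2 ≤ 2 / m - 2 / (m + 1) := by
        rw [div_sub_div _ _ hm'.ne' (by positivity), div_le_div_iff₀ (by positivity) (by positivity)]
        nlinarith
      linarith
  rcases le_total J N with h | h
  · exact (key N h).trans (sub_le_self _ (by positivity))
  · rw [Finset.sum_eq_zero]
    · positivity
    · intro i hi; rw [if_pos ((Finset.mem_range.1 hi).trans_le h)]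

theorem sum_far_inv_sq_le {n : ℕ} [NeZero n] (σ t : ℝ) {J : ℕ} (hJ : 0 < J) :
    ∑ k : ZMod n, (if angularRank n σ t k < J then (0 : ℝ) else
      1 / (angularRank n σ t k : ℝ) ^ 2) ≤ 4 / J := by
  rw [sum_angularRank σ t (fun r => if r < J then (0 : ℝ) else 1 / (r : ℝ) ^ 2)]
  have h : ∀ i ∈ Finset.range n, (if min i (n - 1 - i) < J then (0 : ℝ) else
      1 / ((min i (n - 1 - i) : ℕ) : ℝ) ^ 2) ≤ (if i < J then (0 : ℝ) else 1 / (i : ℝ) ^ 2) +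
        (if n - 1 - i < J then (0 : ℝ) else 1 / ((n - 1 - i : ℕ) : ℝ) ^ 2) := by
    intro i _
    rcases min_choice i (n - 1 - i) with h1 | h1 <;> rw [h1]
    · refine le_add_of_nonneg_right ?_
      split_ifs <;> positivity
    · refine le_add_of_nonneg_left ?_
      split_ifs <;> positivity
  refine (Finset.sum_le_sum h).trans ?_
  rw [Finset.sum_add_distrib, Finset.sum_range_reflect
    (fun i => if i < J then (0 : ℝ) else 1 / (i : ℝ) ^ 2) n]
  have := sum_inv_sq_le hJ n
  calc _ ≤ 2 / (J : ℝ) + 2 / J := add_le_add this this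
    _ = 4 / J := by ring

end Spacing

/-! ### Twists that avoid near cancellation. -/

theorem half_abs_sub_le_norm_exp_sub {x y : ℝ} (h : |x - y| ≤ Real.pi) :
    |x - y| / 2 ≤ ‖Complex.exp (x * Complex.I) - Complex.exp (y * Complex.I)‖ := by
  have h1 : Complex.exp (x * Complex.I) - Complex.exp (y * Complex.I) =
      Complex.exp (y * Complex.I) * (Complex.exp (Complex.I * (x - y : ℝ)) - 1) := by
    rw [mul_sub, ← Complex.exp_add, mul_one]
    congr 2
    push_cast; ring
  rw [h1, norm_mul, Complex.norm_exp_ofReal_mul_I, one_mul, Complex.norm_exp_I_mul_ofReal_sub_one,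
    Real.norm_eq_abs, abs_mul, abs_two]
  have h2 : Real.sin (|x - y| / 2) ≤ |Real.sin ((x - y) / 2)| := by
    rcases abs_choice (x - y) with h3 | h3 <;> rw [h3]
    · exact le_abs_self _
    · rw [neg_div, Real.sin_neg]; exact neg_le_abs _
  have h3 := Real.mul_le_sin (x := |x - y| / 2) (by positivity) (by linarith)
  have h4 : |x - y| / 2 / 2 ≤ 2 / Real.pi * (|x - y| / 2) := by
    rw [div_eq_mul_inv _ (2 : ℝ), mul_comm]
    gcongr
    rw [inv_eq_one_div, div_le_div_iff₀ two_pos Real.pi_pos]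
    linarith [Real.pi_le_four]
  linarith

/-- Two phases for which `a` and `b` nearly cancel are close to each other. -/
theorem abs_sub_lt_of_near_cancel {a b : ℂ} {x y κ : ℝ} (hκ : κ ≤ 1 / 2)
    (hxy : |x - y| ≤ Real.pi)
    (hx : ‖a - Complex.exp (x * Complex.I) * b‖ < κ * max ‖a‖ ‖b‖)
    (hy : ‖a - Complex.exp (y * Complex.I) * b‖ < κ * max ‖a‖ ‖b‖) : |x - y| < 8 * κ := by
  have hM : 0 ≤ max ‖a‖ ‖b‖ := le_max_of_le_left (norm_nonneg _)
  -- Near cancellation forces the norms to be comparable, so dividing by ‖b‖ is safe.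
  have hb : max ‖a‖ ‖b‖ ≤ 2 * ‖b‖ := by
    rcases max_choice ‖a‖ ‖b‖ with h | h
    · have h1 := norm_sub_norm_le a (Complex.exp (x * Complex.I) * b)
      rw [norm_mul, Complex.norm_exp_ofReal_mul_I, one_mul] at h1
      rw [h] at hx hM ⊢
      nlinarith
    · rw [h]; linarith [norm_nonneg b]
  have h1 : ‖Complex.exp (x * Complex.I) - Complex.exp (y * Complex.I)‖ * ‖b‖ <
      2 * κ * max ‖a‖ ‖b‖ := by
    rw [← norm_mul]
    have h2 : (Complex.exp (x * Complex.I) - Complex.exp (y * Complex.I)) * b =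
        (a - Complex.exp (y * Complex.I) * b) - (a - Complex.exp (x * Complex.I) * b) := by ring
    rw [h2]
    have := norm_sub_le (a - Complex.exp (y * Complex.I) * b) (a - Complex.exp (x * Complex.I) * b)
    linarith
  have h2 := half_abs_sub_le_norm_exp_sub hxy
  by_contra h3
  push Not at h3
  have h4 : 4 * κ * ‖b‖ ≤ ‖Complex.exp (x * Complex.I) - Complex.exp (y * Complex.I)‖ * ‖b‖ := by
    gcongr
    linarith
  have h5 : 0 < κ * max ‖a‖ ‖b‖ := (norm_nonneg _).trans_lt hx
  have h6 : 0 < κ := pos_of_mul_pos_left h5 hM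
  nlinarith

/-- The grid point `j` is among the `J` nearest to one of `exp (± i t)`, on either side. -/
def IsNear (n : ℕ) (σ t : ℝ) (J j : ℕ) : Prop :=
  angularRank n σ t j < J ∨ angularRank n σ (-t) j < J

theorem card_near_le {n : ℕ} [NeZero n] (σ t : ℝ) (J : ℕ) [DecidablePred (IsNear n σ t J)] :
    ((Finset.range n).filter (IsNear n σ t J)).card ≤ 4 * J := by
  classical
  rw [Finset.card_filter, ← sum_zmod_val (fun j => if IsNear n σ t J j then 1 else 0),
    ← Finset.card_filter]
  have h : (Finset.univ.filter fun k : ZMod n => IsNear n σ t J k.val) ⊆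
      (Finset.univ.filter fun k : ZMod n => angularRank n σ t k < J) ∪
        (Finset.univ.filter fun k : ZMod n => angularRank n σ (-t) k < J) := by
    intro k hk
    simpa [IsNear] using hk
  refine (Finset.card_le_card h).trans ((Finset.card_union_le _ _).trans ?_)
  have h1 := card_angularRank_lt (n := n) σ t J
  have h2 := card_angularRank_lt (n := n) σ (-t) J
  omega

/-- The phase `exp (i τ)` keeps `a ^ n - exp (i τ) b ^ n` away from zero at the near grid points. -/
def IsGoodTwist (n : ℕ) (σ t : ℝ) (J : ℕ) (a b : ℂ → ℂ) (τ : ℝ) : Prop :=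
  ∀ j < n, IsNear n σ t J j →
    (J : ℝ) ^ 2 / (8 * n) * max ‖a (gridPoint n σ j)‖ ‖b (gridPoint n σ j)‖ ^ n ≤
      ‖a (gridPoint n σ j) ^ n - Complex.exp (τ * Complex.I) * b (gridPoint n σ j) ^ n‖

theorem IsGoodTwist.symm {n : ℕ} {σ t : ℝ} {J : ℕ} {a b : ℂ → ℂ} {τ : ℝ}
    (h : IsGoodTwist n σ t J a b τ) : IsGoodTwist n σ t J b a (-τ) := by
  intro j hj hn
  refine (le_of_eq (by rw [max_comm])).trans ((h j hj hn).trans (le_of_eq ?_))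
  have e : a (gridPoint n σ j) ^ n - Complex.exp (τ * Complex.I) * b (gridPoint n σ j) ^ n =
      -Complex.exp (τ * Complex.I) * (b (gridPoint n σ j) ^ n -
        Complex.exp ((-τ : ℝ) * Complex.I) * a (gridPoint n σ j) ^ n) := by
    have : Complex.exp (τ * Complex.I) * Complex.exp ((-τ : ℝ) * Complex.I) = 1 := by
      rw [← Complex.exp_add]; simp
    linear_combination (-a (gridPoint n σ j) ^ n) * this
  rw [e, norm_mul, norm_neg, Complex.norm_exp_ofReal_mul_I, one_mul]

theorem exists_isGoodTwist {n J : ℕ} [NeZero n] (hJ : 0 < J) (hn : 4 * J ^ 3 ≤ n) (σ t : ℝ)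
    (a b : ℂ → ℂ) (τ : ℝ) :
    ∃ φ : ℝ, 0 ≤ φ ∧ φ ≤ 4 * J ^ 3 / n ∧ IsGoodTwist n σ t J a b (τ + φ) := by
  classical
  by_contra hcon
  push Not at hcon
  have hn0 : (0 : ℝ) < n := Nat.cast_pos.2 (NeZero.pos n)
  have hJ1 : (1 : ℝ) ≤ J := by exact_mod_cast hJ
  have hnJ : 4 * (J : ℝ) ^ 3 ≤ n := by exact_mod_cast hn
  -- The candidates are φ = l J²/n for l = 0, ..., 4J. Their spacing J²/n is 8κ for κ = J²/(8n), so
  -- a near site excludes at most one of them by `abs_sub_lt_of_near_cancel`. There are at most 4J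
  -- near sites for 4J + 1 candidates.
  have hbad : ∀ l ∈ Finset.range (4 * J + 1), ∃ j ∈ (Finset.range n).filter (IsNear n σ t J),
      ‖a (gridPoint n σ j) ^ n -
        Complex.exp ((τ + l * (J ^ 2 / n) : ℝ) * Complex.I) * b (gridPoint n σ j) ^ n‖ <
      (J : ℝ) ^ 2 / (8 * n) * max ‖a (gridPoint n σ j)‖ ‖b (gridPoint n σ j)‖ ^ n := by
    intro l hl
    have hl' : (l : ℝ) ≤ 4 * J := by
      exact_mod_cast Nat.lt_succ_iff.1 (Finset.mem_range.1 hl)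
    have h1 := hcon (l * (J ^ 2 / n)) (by positivity) (by
      calc (l : ℝ) * (J ^ 2 / n) ≤ 4 * J * (J ^ 2 / n) := by gcongr
        _ = _ := by ring)
    simp only [IsGoodTwist, not_forall, not_le] at h1
    obtain ⟨j, hj, hnear, hlt⟩ := h1
    exact ⟨j, Finset.mem_filter.2 ⟨Finset.mem_range.2 hj, hnear⟩, hlt⟩
  choose! f hf hlt using hbad
  obtain ⟨l, hl, l', hl', hne, heq⟩ := Finset.exists_ne_map_eq_of_card_lt_of_maps_to
    (s := Finset.range (4 * J + 1)) (t := (Finset.range n).filter (IsNear n σ t J)) (f := f)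
    (by rw [Finset.card_range]; exact Nat.lt_succ_of_le (card_near_le σ t J)) hf
  have h1 := hlt l hl
  have h2 := hlt l' hl'
  rw [← heq] at h2
  have hmax : ∀ u v : ℂ, max ‖u‖ ‖v‖ ^ n = max ‖u ^ n‖ ‖v ^ n‖ := by
    intro u v
    rw [norm_pow, norm_pow]
    exact (pow_left_monotoneOn (n := n)).map_max (norm_nonneg _) (norm_nonneg _)
  rw [hmax] at h1 h2
  have hdiff : (τ + l * (J ^ 2 / n) : ℝ) - (τ + l' * (J ^ 2 / n)) = ((l : ℝ) - l') * (J ^ 2 / n) := by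
    ring
  have hll : |(l : ℝ) - l'| ≤ 4 * J := by
    have e1 : (l : ℝ) ≤ 4 * J := by exact_mod_cast Nat.lt_succ_iff.1 (Finset.mem_range.1 hl)
    have e2 : (l' : ℝ) ≤ 4 * J := by exact_mod_cast Nat.lt_succ_iff.1 (Finset.mem_range.1 hl')
    rw [abs_le]
    constructor <;> linarith [(Nat.cast_nonneg l : (0 : ℝ) ≤ l), (Nat.cast_nonneg l' : (0 : ℝ) ≤ l')]
  have hll1 : 1 ≤ |(l : ℝ) - l'| := by
    have : (1 : ℤ) ≤ |(l : ℤ) - l'| := Int.one_le_abs (sub_ne_zero.2 (by exact_mod_cast hne))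
    exact_mod_cast this
  have hpos : 0 < (J : ℝ) ^ 2 / n := by positivity
  have hκ : (J : ℝ) ^ 2 / (8 * n) ≤ 1 / 2 := by
    rw [div_le_div_iff₀ (by positivity) two_pos]
    nlinarith [pow_le_pow_right₀ hJ1 (show 2 ≤ 3 by norm_num)]
  have h3 := abs_sub_lt_of_near_cancel hκ (by
    rw [hdiff, abs_mul, abs_of_pos hpos]
    have e1 : |(l : ℝ) - l'| * ((J : ℝ) ^ 2 / n) ≤ 4 * J * ((J : ℝ) ^ 2 / n) := by gcongr
    have e2 : 4 * J * ((J : ℝ) ^ 2 / n) = 4 * (J : ℝ) ^ 3 / n := by ring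
    have e3 : 4 * (J : ℝ) ^ 3 / n ≤ 1 := by rw [div_le_one hn0]; exact hnJ
    linarith [Real.pi_gt_three]) h1 h2
  rw [hdiff, abs_mul, abs_of_pos hpos] at h3
  have h4 : 8 * ((J : ℝ) ^ 2 / (8 * n)) = J ^ 2 / n := by field_simp
  rw [h4] at h3
  nlinarith

/-- At most 4J sites are near, and a good twist limits the error at each to order n/J². At a far
site with ranks r₁, r₂ the error is of order n/(r₁ r₂), at most a multiple of n(1/r₁² + 1/r₂²).
Averaged over n sites, both contributions are O(1/J). -/
theorem norm_sum_cyclicCoeff_sub_le {n m J : ℕ} [NeZero n] {σ t τ c K : ℝ} {a b : ℂ → ℂ}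
    {ω : ℕ → ℂ} (hω : ∀ j, ‖ω j‖ ≤ 1) (hc : 0 < c) (hK : 0 < K) (hJ : 0 < J) (hJn : J ^ 2 ≤ n)
    (hm : 2 * (m + 1) ≤ n)
    (hmax : ∀ j, c ≤ max ‖a (gridPoint n σ j)‖ ‖b (gridPoint n σ j)‖)
    (hgap : ∀ j < n, K * (angularRank n σ t j * angularRank n σ (-t) j) / n ^ 2 ≤
      |‖a (gridPoint n σ j)‖ - ‖b (gridPoint n σ j)‖|)
    (hgood : IsGoodTwist n σ t J a b τ) :
    ‖(n : ℂ)⁻¹ * ∑ j ∈ Finset.range n, ω j *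
        cyclicCoeff n m (a (gridPoint n σ j)) (b (gridPoint n σ j)) (Complex.exp (τ * Complex.I)) -
      (n : ℂ)⁻¹ * ∑ j ∈ Finset.range n, ω j *
        laurentCoeff m (a (gridPoint n σ j)) (b (gridPoint n σ j))‖ ≤ (8 / K + 36 / c) / J := by
  classical
  have hn0 : (0 : ℝ) < n := Nat.cast_pos.2 (NeZero.pos n)
  have hJ0 : (0 : ℝ) < J := Nat.cast_pos.2 hJ
  have hJn' : (J : ℝ) ^ 2 ≤ n := by exact_mod_cast hJn
  have hN : (n : ℝ) / 2 ≤ (n - 1 - m : ℕ) := by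
    have : n ≤ 2 * (n - 1 - m) := by omega
    have : (n : ℝ) ≤ 2 * (n - 1 - m : ℕ) := by exact_mod_cast this
    linarith
  set F : ℕ → ℝ := fun r => if r < J then (0 : ℝ) else 1 / (r : ℝ) ^ 2 with hF
  have hterm : ∀ j ∈ Finset.range n, ‖ω j *
      cyclicCoeff n m (a (gridPoint n σ j)) (b (gridPoint n σ j)) (Complex.exp (τ * Complex.I)) -
      ω j * laurentCoeff m (a (gridPoint n σ j)) (b (gridPoint n σ j))‖ ≤
      (if IsNear n σ t J j then 8 * n / (J ^ 2 * c) + 1 / c else 0) +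
        n / K * (F (angularRank n σ t j) + F (angularRank n σ (-t) j)) := by
    intro j hj
    have hjn := Finset.mem_range.1 hj
    have hM := hmax j
    have hM0 := hc.trans_le hM
    rw [← mul_sub, norm_mul]
    refine (mul_le_of_le_one_left (norm_nonneg _) (hω j)).trans ?_
    have hF0 : ∀ r, 0 ≤ F r := fun r => by simp only [hF]; split_ifs <;> positivity
    by_cases hnear : IsNear n σ t J j
    · rw [if_pos hnear]
      refine le_add_of_le_of_nonneg ((norm_sub_le _ _).trans (add_le_add ?_ ?_))
        (mul_nonneg (by positivity) (add_nonneg (hF0 _) (hF0 _)))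
      · refine (norm_cyclicCoeff_le (by omega) (κ := (J : ℝ) ^ 2 / (8 * n)) (by positivity) hM0
          (hgood j hjn hnear)).trans ?_
        calc 1 / ((J : ℝ) ^ 2 / (8 * n) * max ‖a (gridPoint n σ j)‖ ‖b (gridPoint n σ j)‖)
            ≤ 1 / ((J : ℝ) ^ 2 / (8 * n) * c) := by gcongr
          _ = _ := by field_simp
      · exact (norm_laurentCoeff_le m _ _ hM0).trans (by gcongr)
    · rw [if_neg hnear, zero_add]
      simp only [IsNear, not_or, not_lt] at hnear
      obtain ⟨h1, h2⟩ := hnear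
      simp only [hF, if_neg (not_lt.2 h1), if_neg (not_lt.2 h2)]
      have hr1 : (0 : ℝ) < angularRank n σ t j := Nat.cast_pos.2 (hJ.trans_le h1)
      have hr2 : (0 : ℝ) < angularRank n σ (-t) j := Nat.cast_pos.2 (hJ.trans_le h2)
      have hg := hgap j hjn
      have hg0 : 0 < K * (angularRank n σ t j * angularRank n σ (-t) j) / n ^ 2 := by positivity
      refine (norm_cyclicCoeff_sub_laurentCoeff_le (by omega) (Complex.norm_exp_ofReal_mul_I τ)
        (fun h => by rw [h, sub_self, abs_zero] at hg; linarith)).trans ?_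
      generalize (angularRank n σ t j : ℝ) = r₁ at *
      generalize (angularRank n σ (-t) j : ℝ) = r₂ at *
      calc _ ≤ 1 / ((n : ℝ) / 2 * (K * (r₁ * r₂) / n ^ 2)) := by gcongr
        _ = n / K * (2 * (1 / r₁ * (1 / r₂))) := by field_simp
        _ ≤ _ := by
          gcongr
          have := two_mul_le_add_sq (1 / r₁) (1 / r₂)
          simp only [div_pow, one_pow] at this
          linarith
  have hsum : ∀ s : ℝ, ∑ j ∈ Finset.range n, F (angularRank n σ s j) ≤ 4 / J := by
    intro s
    have h := sum_far_inv_sq_le (n := n) σ s hJ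
    rw [← sum_zmod_val (fun j => F (angularRank n σ s j))]
    simpa [hF] using h
  rw [← mul_sub, ← Finset.sum_sub_distrib, norm_mul, norm_inv, Complex.norm_natCast]
  have h1 := (norm_sum_le _ _).trans (Finset.sum_le_sum hterm)
  rw [Finset.sum_add_distrib, ← Finset.mul_sum, Finset.sum_add_distrib, ← Finset.sum_filter,
    Finset.sum_const, nsmul_eq_mul] at h1
  have hcard : (((Finset.range n).filter (IsNear n σ t J)).card : ℝ) ≤ 4 * J := by
    exact_mod_cast card_near_le σ t J
  rw [inv_mul_le_iff₀ hn0]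
  refine h1.trans ?_
  calc _ ≤ 4 * J * (8 * n / (J ^ 2 * c) + 1 / c) + n / K * (4 / J + 4 / J) := by
        gcongr
        · exact hsum t
        · exact hsum (-t)
    _ = n * ((8 / K + 32 / c) / J) + 4 * J ^ 2 / (J * c) := by field_simp; ring
    _ ≤ n * ((8 / K + 32 / c) / J) + 4 * n / (J * c) := by gcongr
    _ = _ := by field_simp; ring

/-! ### Convergence of the Green function. -/

/-- The coefficient of order `-q` in the inverse of `a - ω b` modulo `ω ^ n = z`. -/
noncomputable def innerSum (n : ℕ) (q : ℤ) (a b z : ℂ) : ℂ :=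
  -- For q > 0, 1/(a - ωb) = -ω⁻¹/(b - ω⁻¹a) reduces to the other case in the variable ω⁻¹, whose
  -- n-th power is z⁻¹.
  if q ≤ 0 then cyclicCoeff n (-q).toNat a b z else -cyclicCoeff n (q - 1).toNat b a z⁻¹

/-- The coefficient of order `-q` in the Laurent expansion of the inverse of `a - ω b`. -/
noncomputable def innerLimit (q : ℤ) (a b : ℂ) : ℂ :=
  if q ≤ 0 then laurentCoeff (-q).toNat a b else -laurentCoeff (q - 1).toNat b a

theorem sum_div_sub_stdAddChar {n : ℕ} [NeZero n] {a b u : ℂ} (hu : u ≠ 0)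
    (h : a ^ n ≠ u ^ n * b ^ n) {q : ℤ} (hq : |q| < n) :
    (n : ℂ)⁻¹ * ∑ k : ZMod n, ZMod.stdAddChar (k * (q : ZMod n)) /
      (a - ZMod.stdAddChar k * (u * b)) = u ^ (-q) * innerSum n q a b (u ^ n) := by
  have h' : a ^ n ≠ (u * b) ^ n := by rwa [mul_pow]
  rw [abs_lt] at hq
  unfold innerSum
  split_ifs with h0
  · obtain ⟨m, rfl⟩ : ∃ m : ℕ, q = -m := ⟨(-q).toNat, by omega⟩
    have hm : m < n := by omega
    have h1 := sum_inv_sub_stdAddChar h' hm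
    push_cast
    rw [h1, neg_neg, Int.toNat_natCast, zpow_natCast, cyclicCoeff, cyclicCoeff]
    rw [mul_pow, mul_pow, one_mul]
    ring
  · obtain ⟨m, rfl⟩ : ∃ m : ℕ, q = m + 1 := ⟨(q - 1).toNat, by omega⟩
    have hm : m + 1 < n := by omega
    -- Modulo n, the order -(m + 1) is the order n - 1 - m.
    have h1 := sum_inv_sub_stdAddChar h' (m := n - 1 - m) (by omega)
    have h2 : -((n - 1 - m : ℕ) : ZMod n) = (((m : ℤ) + 1 : ℤ) : ZMod n) := by
      rw [neg_eq_iff_add_eq_zero]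
      have : (((n - 1 - m + (m + 1) : ℕ)) : ZMod n) = 0 := by
        rw [show n - 1 - m + (m + 1) = n by omega]; simp
      push_cast at this ⊢
      exact this
    rw [h2] at h1
    rw [h1, show ((m : ℤ) + 1 - 1).toNat = m by omega, cyclicCoeff, cyclicCoeff, one_mul,
      show n - 1 - (n - 1 - m) = m by omega]
    have hun : u ^ n ≠ 0 := pow_ne_zero _ hu
    have hne : a ^ n - u ^ n * b ^ n ≠ 0 := sub_ne_zero.2 h
    have hne' : b ^ n - (u ^ n)⁻¹ * a ^ n ≠ 0 := by
      intro h3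
      apply hne
      have : a ^ n - u ^ n * b ^ n = -u ^ n * (b ^ n - (u ^ n)⁻¹ * a ^ n) := by
        field_simp
        ring
      rw [this, h3, mul_zero]
    have hu1 : u ^ n = u ^ (n - 1 - m) * u ^ (m + 1) := by rw [← pow_add]; congr 1; omega
    have hu2 : u ^ (-((m : ℤ) + 1)) = (u ^ (m + 1))⁻¹ := by
      rw [zpow_neg]; norm_cast
    have hfac : a ^ n - u ^ n * b ^ n = -u ^ n * (b ^ n - (u ^ n)⁻¹ * a ^ n) := by
      field_simp
      ring
    rw [mul_pow, mul_pow, hfac, hu2, neg_mul, div_neg, mul_neg, neg_inj, div_eq_iff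
      (mul_ne_zero hun hne')]
    rw [← mul_div_assoc, div_mul_eq_mul_div, eq_div_iff hne']
    have hum : u ^ (m + 1) ≠ 0 := pow_ne_zero _ hu
    field_simp
    rw [hu1]
    ring

section Green

variable {α β γ : ℝ}

/-- The sum over the first frequency that computes the Green function of the discrete torus. -/
noncomputable def greenSum (α β γ : ℝ) (n : ℕ) (σ τ : ℝ) (p q : ℤ) : ℂ :=
  (halfPhase n σ ^ 2) ^ (-p) * (halfPhase n τ ^ 2) ^ (-q) * ((n : ℂ)⁻¹ * ∑ j ∈ Finset.range n,
    gridPoint n σ j ^ p * innerSum n q (coefA α (gridPoint n σ j)) (coefB α β γ (gridPoint n σ j))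
      (Complex.exp (τ * Complex.I)))

theorem symbolDet_eq {n : ℕ} [NeZero n] (σ τ : ℝ) (k : ZMod n × ZMod n) :
    symbolDet (α * halfPhase n σ ^ 2) (β * halfPhase n τ ^ 2) (γ * halfPhase n σ * halfPhase n τ) k =
      coefA α (gridPoint n σ k.1.val) - ZMod.stdAddChar k.2 *
        (halfPhase n τ ^ 2 * coefB α β γ (gridPoint n σ k.1.val)) := by
  rw [← gridPoint_eq, ← halfPhase_sq]
  unfold symbolDet coefA coefB
  ring

theorem halfPhase_ne_zero (n : ℕ) (σ : ℝ) : halfPhase n σ ≠ 0 := Complex.exp_ne_zero _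

theorem symbolDet_ne_zero {n : ℕ} [NeZero n] {σ τ : ℝ}
    (h : ∀ j < n, coefA α (gridPoint n σ j) ^ n ≠
      Complex.exp (τ * Complex.I) * coefB α β γ (gridPoint n σ j) ^ n) (k : ZMod n × ZMod n) :
    symbolDet (α * halfPhase n σ ^ 2) (β * halfPhase n τ ^ 2)
      (γ * halfPhase n σ * halfPhase n τ) k ≠ 0 := by
  rw [symbolDet_eq]
  intro h1
  refine h k.1.val (ZMod.val_lt _) ?_
  rw [sub_eq_zero.1 h1, mul_pow, mul_pow, ← halfPhase_pow (n := n), pow_mul]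
  have hk : (ZMod.stdAddChar k.2 : ℂ) ^ n = 1 := by
    rw [← AddChar.map_nsmul_eq_pow]; simp
  rw [hk, one_mul]

/-- The sum over the second frequency is evaluated exactly, which leaves a one-dimensional sum whose
only singularities are at the critical angles. -/
theorem torusGreen_eq_greenSum {n : ℕ} [NeZero n] {σ τ : ℝ}
    (h : ∀ j < n, coefA α (gridPoint n σ j) ^ n ≠
      Complex.exp (τ * Complex.I) * coefB α β γ (gridPoint n σ j) ^ n) (p : ℤ) {q : ℤ}
    (hq : |q| < n) :
    torusGreen (n := n) (α * halfPhase n σ ^ 2) (β * halfPhase n τ ^ 2)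
      (γ * halfPhase n σ * halfPhase n τ) (p, q) = greenSum α β γ n σ τ p q := by
  have hn : (n : ℂ) ≠ 0 := Nat.cast_ne_zero.2 (NeZero.ne n)
  have hu := pow_ne_zero 2 (halfPhase_ne_zero n τ)
  have hv := pow_ne_zero 2 (halfPhase_ne_zero n σ)
  have hz : (halfPhase n τ ^ 2) ^ n = Complex.exp (τ * Complex.I) := by
    rw [← pow_mul, halfPhase_pow]
  unfold torusGreen greenSum
  rw [Fintype.sum_prod_type, ← sum_zmod_val (fun j => gridPoint n σ j ^ p * innerSum n q
    (coefA α (gridPoint n σ j)) (coefB α β γ (gridPoint n σ j)) (Complex.exp (τ * Complex.I)))]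
  have hL : ((n : ℂ) ^ 2)⁻¹ * ∑ k : ZMod n, ∑ l : ZMod n,
      torusChar (k, l) ((p : ZMod n), (q : ZMod n)) / symbolDet (α * halfPhase n σ ^ 2)
        (β * halfPhase n τ ^ 2) (γ * halfPhase n σ * halfPhase n τ) (k, l) =
      (n : ℂ)⁻¹ * ∑ k : ZMod n, (n : ℂ)⁻¹ * ∑ l : ZMod n,
        torusChar (k, l) ((p : ZMod n), (q : ZMod n)) / symbolDet (α * halfPhase n σ ^ 2)
          (β * halfPhase n τ ^ 2) (γ * halfPhase n σ * halfPhase n τ) (k, l) := by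
    rw [← Finset.mul_sum]; ring
  rw [hL, mul_left_comm]
  congr 1
  rw [Finset.mul_sum]
  refine Finset.sum_congr rfl fun k _ => ?_
  have h1 := sum_div_sub_stdAddChar hu (a := coefA α (gridPoint n σ k.val))
    (b := coefB α β γ (gridPoint n σ k.val)) (by rw [hz]; exact h _ (ZMod.val_lt k)) hq
  rw [hz] at h1
  have h2 : ∀ l : ZMod n, torusChar (k, l) ((p : ZMod n), (q : ZMod n)) =
      (halfPhase n σ ^ 2) ^ (-p) * gridPoint n σ k.val ^ p * ZMod.stdAddChar (l * (q : ZMod n)) := by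
    intro l
    rw [torusChar, AddChar.map_add_eq_mul, ← gridPoint_eq, ← halfPhase_sq, mul_zpow,
      ← AddChar.map_zsmul_eq_zpow, ← mul_assoc, ← zpow_add₀ hv, neg_add_cancel, zpow_zero, one_mul]
    congr 2
    rw [zsmul_eq_mul, mul_comm]
  simp only [symbolDet_eq, h2, mul_div_assoc]
  rw [← Finset.mul_sum]
  linear_combination ((halfPhase n σ ^ 2) ^ (-p) * gridPoint n σ k.val ^ p) * h1

/-- The Green function of the infinite lattice, as an integral over the first frequency. -/
noncomputable def greenLimit (α β γ : ℝ) (p q : ℤ) : ℂ :=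
  (2 * Real.pi)⁻¹ • ∫ θ in 0..2 * Real.pi, Complex.exp (θ * Complex.I) ^ p *
    innerLimit q (coefA α (Complex.exp (θ * Complex.I))) (coefB α β γ (Complex.exp (θ * Complex.I)))

theorem tendsto_halfPhase_of_tendsto {ι : Type*} {l : Filter ι} {f : ι → ℕ} {g : ι → ℝ}
    (hf : Tendsto f l atTop) (hg : ∀ᶠ i in l, |g i| ≤ 8) :
    Tendsto (fun i => halfPhase (f i) (g i)) l (𝓝 1) := by
  have h1 : Tendsto (fun i => g i / (2 * f i)) l (𝓝 0) := by
    rw [tendsto_zero_iff_norm_tendsto_zero]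
    have h2 : Tendsto (fun i => 8 / (2 * (f i : ℝ))) l (𝓝 0) :=
      tendsto_const_nhds.div_atTop
        ((tendsto_natCast_atTop_atTop.comp hf).const_mul_atTop two_pos)
    refine squeeze_zero' (Eventually.of_forall fun _ => norm_nonneg _) ?_ h2
    filter_upwards [hg] with i hi
    rw [norm_div, Real.norm_eq_abs, Real.norm_of_nonneg (by positivity : (0 : ℝ) ≤ 2 * f i)]
    gcongr
  have h3 : Continuous fun x : ℝ => Complex.exp (x * Complex.I) := by fun_prop
  have h4 := (h3.tendsto 0).comp h1
  simpa [halfPhase, Function.comp_def] using h4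

/-- The angle at which the two coefficients have the same norm. -/
noncomputable def critAngle (α β γ : ℝ) : ℝ := Real.arccos (critCos α β γ)

/-- `Real.arccos` clamps c to [-1, 1], which only brings it closer to a cosine. Thus `critAngle`
also serves when the two norms never agree. -/
theorem abs_cos_sub_cos_arccos_le (x c : ℝ) :
    |Real.cos x - Real.cos (Real.arccos c)| ≤ |Real.cos x - c| := by
  have h1 := Real.neg_one_le_cos x
  have h2 := Real.cos_le_one x
  rcases le_or_gt c (-1) with h | h
  · rw [Real.arccos_of_le_neg_one h, Real.cos_pi, abs_of_nonneg (by linarith),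
      abs_of_nonneg (by linarith)]
    linarith
  rcases le_or_gt 1 c with h' | h'
  · rw [Real.arccos_of_one_le h', Real.cos_zero, abs_of_nonpos (by linarith),
      abs_of_nonpos (by linarith)]
    linarith
  · rw [Real.cos_arccos h.le h'.le]

theorem norm_innerLimit_le (q : ℤ) (a b : ℂ) (h : 0 < max ‖a‖ ‖b‖) :
    ‖innerLimit q a b‖ ≤ 1 / max ‖a‖ ‖b‖ := by
  unfold innerLimit
  split_ifs
  · exact norm_laurentCoeff_le _ _ _ h
  · rw [norm_neg, max_comm]
    rw [max_comm] at h
    exact norm_laurentCoeff_le _ _ _ h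

theorem continuousAt_laurentCoeff (m : ℕ) {f g : ℝ → ℂ} {x : ℝ} (hf : ContinuousAt f x)
    (hg : ContinuousAt g x) (h : ‖f x‖ ≠ ‖g x‖) :
    ContinuousAt (fun y => laurentCoeff m (f y) (g y)) x := by
  rcases lt_or_gt_of_ne h with h | h
  · have : ∀ᶠ y in 𝓝 x, ‖f y‖ < ‖g y‖ := hf.norm.eventually_lt hg.norm h
    refine (continuousAt_const (y := (0 : ℂ))).congr ?_
    filter_upwards [this] with y hy
    rw [laurentCoeff, if_neg (not_lt.2 hy.le)]
  · have : ∀ᶠ y in 𝓝 x, ‖g y‖ < ‖f y‖ := hg.norm.eventually_lt hf.norm h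
    have hne : f x ^ (m + 1) ≠ 0 :=
      pow_ne_zero _ (norm_pos_iff.1 ((norm_nonneg _).trans_lt h))
    refine ((hg.pow m).div (hf.pow (m + 1)) hne).congr ?_
    filter_upwards [this] with y hy
    simp only [laurentCoeff, if_pos hy, Pi.div_apply, Pi.pow_apply]

theorem continuousAt_innerLimit (q : ℤ) {f g : ℝ → ℂ} {x : ℝ} (hf : ContinuousAt f x)
    (hg : ContinuousAt g x) (h : ‖f x‖ ≠ ‖g x‖) :
    ContinuousAt (fun y => innerLimit q (f y) (g y)) x := by
  unfold innerLimit
  split_ifs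
  · exact continuousAt_laurentCoeff _ hf hg h
  · exact (continuousAt_laurentCoeff _ hg hf h.symm).neg

theorem norm_exp_zpow (θ : ℝ) (p : ℤ) : ‖Complex.exp (θ * Complex.I) ^ p‖ = 1 := by
  rw [norm_zpow, Complex.norm_exp_ofReal_mul_I, one_zpow]

/-- The filter along which the number of sites tends to infinity, with a phase that keeps the
determinant away from zero at the sites of near degeneracy. -/
def twistFilter (α β γ σ : ℝ) : Filter (ℕ × ℝ) :=
  atTop.bind fun J : ℕ => atTop.bind fun n : ℕ => 𝓟 {x | x.1 = n ∧ |x.2| ≤ 8 ∧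
    IsGoodTwist n σ (critAngle α β γ) J (coefA α) (coefB α β γ) x.2}

/-- Shows the order of limits: n tends to infinity for fixed J, then J does, uniformly over the good
twists. -/
theorem eventually_twistFilter_iff {σ : ℝ} {P : ℕ × ℝ → Prop} :
    (∀ᶠ x in twistFilter α β γ σ, P x) ↔ ∀ᶠ J : ℕ in atTop, ∀ᶠ n : ℕ in atTop, ∀ τ : ℝ, |τ| ≤ 8 →
      IsGoodTwist n σ (critAngle α β γ) J (coefA α) (coefB α β γ) τ → P (n, τ) := by
  unfold twistFilter
  rw [Filter.eventually_bind]
  refine eventually_congr (Eventually.of_forall fun J => ?_)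
  rw [Filter.eventually_bind]
  refine eventually_congr (Eventually.of_forall fun n => ?_)
  rw [Filter.eventually_principal]
  constructor
  · intro h τ h1 h2
    exact h (n, τ) ⟨rfl, h1, h2⟩
  · rintro h ⟨n', τ⟩ ⟨rfl, h1, h2⟩
    exact h τ h1 h2

theorem tendsto_fst_twistFilter (σ : ℝ) :
    Tendsto (fun x : ℕ × ℝ => x.1) (twistFilter α β γ σ) atTop := by
  intro s hs
  change ∀ᶠ x in twistFilter α β γ σ, x.1 ∈ s
  rw [eventually_twistFilter_iff]
  refine Eventually.of_forall fun J => ?_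
  filter_upwards [hs] with n hn τ _ _ using hn

theorem eventually_abs_snd_twistFilter (σ : ℝ) :
    ∀ᶠ x in twistFilter α β γ σ, |x.2| ≤ 8 := by
  rw [eventually_twistFilter_iff]
  exact Eventually.of_forall fun J => Eventually.of_forall fun n τ h _ => h

theorem tendsto_halfPhase_fst (σ : ℝ) :
    Tendsto (fun x : ℕ × ℝ => halfPhase x.1 σ) (twistFilter α β γ σ) (𝓝 1) := by
  have h3 : Continuous fun x : ℝ => Complex.exp (x * Complex.I) := by fun_prop
  have h1 : Tendsto (fun x : ℕ × ℝ => σ / (2 * (x.1 : ℝ))) (twistFilter α β γ σ) (𝓝 0) :=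
    tendsto_const_nhds.div_atTop ((tendsto_natCast_atTop_atTop.comp
      (tendsto_fst_twistFilter (α := α) (β := β) (γ := γ) σ)).const_mul_atTop two_pos)
  have h4 := (h3.tendsto 0).comp h1
  simpa [halfPhase, Function.comp_def] using h4

theorem tendsto_halfPhase_snd (σ : ℝ) :
    Tendsto (fun x : ℕ × ℝ => halfPhase x.1 x.2) (twistFilter α β γ σ) (𝓝 1) :=
  tendsto_halfPhase_of_tendsto (tendsto_fst_twistFilter (α := α) (β := β) (γ := γ) σ)
    (eventually_abs_snd_twistFilter (α := α) (β := β) (γ := γ) σ)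

variable (hα : 0 < α) (hβ : 0 < β) (hαβγ : 0 < γ ^ 2 - α * β)

include hα hβ hαβγ

/-- The norms of the two coefficients differ away from the critical angles. -/
theorem exists_abs_norm_sub_ge : ∃ K : ℝ, 0 < K ∧ ∀ θ : ℝ,
    K * (|Real.sin ((θ - critAngle α β γ) / 2)| * |Real.sin ((θ - -critAngle α β γ) / 2)|) ≤
      |absA α θ - absB α β γ θ| := by
  have hS := cosSlope_pos hα hβ hαβγ
  set S : ℝ := 1 + α + (γ ^ 2 - α * β) + β with hSdef
  have hS0 : 0 < S := by positivity
  refine ⟨2 * cosSlope α β γ / S, by positivity, fun θ => ?_⟩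
  have h1 := normSq_sub hα hβ hαβγ θ
  have hA : absA α θ ≤ 1 + α := by
    refine (norm_add_le _ _).trans ?_
    rw [norm_mul, Complex.norm_exp_ofReal_mul_I, norm_one, Complex.norm_real,
      Real.norm_of_nonneg hα.le, mul_one]
  have hB : absB α β γ θ ≤ (γ ^ 2 - α * β) + β := by
    refine (norm_sub_le _ _).trans ?_
    have : ((γ : ℂ) ^ 2 - α * β) = ((γ ^ 2 - α * β : ℝ) : ℂ) := by push_cast; rfl
    rw [norm_mul, Complex.norm_exp_ofReal_mul_I, this, Complex.norm_real,
      Complex.norm_real, Real.norm_of_nonneg hαβγ.le, Real.norm_of_nonneg hβ.le, mul_one]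
  change absA α θ ^ 2 - absB α β γ θ ^ 2 = _ at h1
  have hA0 : 0 ≤ absA α θ := norm_nonneg _
  have hB0 : 0 ≤ absB α β γ θ := norm_nonneg _
  have h2 : cosSlope α β γ * |Real.cos θ - critCos α β γ| ≤ |absA α θ - absB α β γ θ| * S := by
    rw [← abs_of_pos hS, ← abs_mul, ← h1, sq_sub_sq, mul_comm (_ + _), abs_mul]
    gcongr
    rw [abs_of_nonneg (by positivity)]
    linarith
  have h3 := abs_cos_sub_cos_arccos_le θ (critCos α β γ)
  have h4 : |Real.cos θ - Real.cos (Real.arccos (critCos α β γ))| =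
      2 * (|Real.sin ((θ - critAngle α β γ) / 2)| * |Real.sin ((θ - -critAngle α β γ) / 2)|) := by
    rw [Real.cos_sub_cos, abs_mul, abs_mul, abs_neg, abs_two, sub_neg_eq_add, critAngle]
    ring
  rw [h4] at h3
  rw [div_mul_eq_mul_div, div_le_iff₀ hS0]
  refine le_trans (le_of_eq ?_) ((mul_le_mul_of_nonneg_left h3 hS.le).trans h2)
  ring

theorem exists_gap : ∃ K : ℝ, 0 < K ∧ ∀ (n : ℕ) [NeZero n] (σ : ℝ), ∀ j < n,
    K * (angularRank n σ (critAngle α β γ) j * angularRank n σ (-critAngle α β γ) j) / n ^ 2 ≤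
      |‖coefA α (gridPoint n σ j)‖ - ‖coefB α β γ (gridPoint n σ j)‖| := by
  obtain ⟨K, hK, h⟩ := exists_abs_norm_sub_ge hα hβ hαβγ
  refine ⟨4 * K, by positivity, fun n _ σ j hj => ?_⟩
  have hn : (0 : ℝ) < n := Nat.cast_pos.2 (NeZero.pos n)
  refine le_trans ?_ (h ((2 * Real.pi * j + σ) / n))
  have s1 := abs_sin_grid_ge σ (critAngle α β γ) (j : ZMod n)
  have s2 := abs_sin_grid_ge σ (-critAngle α β γ) (j : ZMod n)
  rw [ZMod.val_cast_of_lt hj] at s1 s2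
  refine le_trans (le_of_eq ?_)
    (mul_le_mul_of_nonneg_left (mul_le_mul s1 s2 (by positivity) (abs_nonneg _)) hK.le)
  field_simp
  ring

theorem tendsto_greenLimit (σ : ℝ) (p q : ℤ) :
    Tendsto (fun n : ℕ => (n : ℂ)⁻¹ * ∑ j ∈ Finset.range n, gridPoint n σ j ^ p *
      innerLimit q (coefA α (gridPoint n σ j)) (coefB α β γ (gridPoint n σ j))) atTop
      (𝓝 (greenLimit α β γ p q)) := by
  obtain ⟨c, hc, hmax⟩ := exists_max_norm_ge hα hβ hαβγ
  have h := tendsto_riemann_sum (f := fun θ : ℝ => Complex.exp (θ * Complex.I) ^ p *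
    innerLimit q (coefA α (Complex.exp (θ * Complex.I))) (coefB α β γ (Complex.exp (θ * Complex.I))))
    (M := 1 / c) (fun θ => by
      rw [norm_mul, norm_exp_zpow, one_mul]
      refine (norm_innerLimit_le q _ _ (hc.trans_le (hmax θ))).trans ?_
      have := hmax θ
      gcongr) (by
      filter_upwards [ae_absA_ne_absB hα hβ hαβγ] with θ hθ
      refine ContinuousAt.mul ?_ (continuousAt_innerLimit q ?_ ?_ hθ)
      · exact ContinuousAt.zpow₀ (by fun_prop) _ (Or.inl (Complex.exp_ne_zero _))
      · unfold coefA; fun_prop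
      · unfold coefB; fun_prop) σ
  refine h.congr fun n => ?_
  rw [Complex.real_smul, Complex.ofReal_inv, Complex.ofReal_natCast]
  rfl

/-- At near sites this is the goodness of the twist; at far sites the two norms already differ. -/
theorem eventually_pow_ne_twistFilter (σ : ℝ) : ∀ᶠ x in twistFilter α β γ σ, ∀ j < x.1,
    coefA α (gridPoint x.1 σ j) ^ x.1 ≠
      Complex.exp (x.2 * Complex.I) * coefB α β γ (gridPoint x.1 σ j) ^ x.1 := by
  obtain ⟨c, hc, hmax⟩ := exists_max_norm_ge hα hβ hαβγ
  obtain ⟨K, hK, hgap⟩ := exists_gap hα hβ hαβγ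
  rw [eventually_twistFilter_iff]
  filter_upwards [eventually_gt_atTop 0] with J hJ
  filter_upwards [eventually_gt_atTop 0] with n hn τ _ hgood j hj heq
  have hn' : (0 : ℝ) < n := Nat.cast_pos.2 hn
  have hJ' : (0 : ℝ) < J := Nat.cast_pos.2 hJ
  have : NeZero n := ⟨hn.ne'⟩
  by_cases hnear : IsNear n σ (critAngle α β γ) J j
  · have h1 := hgood j hj hnear
    rw [heq, sub_self, norm_zero] at h1
    have h2 : 0 < max ‖coefA α (gridPoint n σ j)‖ ‖coefB α β γ (gridPoint n σ j)‖ :=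
      hc.trans_le (hmax _)
    have : 0 < (J : ℝ) ^ 2 / (8 * n) *
      max ‖coefA α (gridPoint n σ j)‖ ‖coefB α β γ (gridPoint n σ j)‖ ^ n := by positivity
    linarith
  · simp only [IsNear, not_or, not_lt] at hnear
    have hr1 : (0 : ℝ) < angularRank n σ (critAngle α β γ) j := Nat.cast_pos.2 (hJ.trans_le hnear.1)
    have hr2 : (0 : ℝ) < angularRank n σ (-critAngle α β γ) j :=
      Nat.cast_pos.2 (hJ.trans_le hnear.2)
    have h1 := hgap n σ j hj
    have h2 : 0 < K * (angularRank n σ (critAngle α β γ) j *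
      angularRank n σ (-critAngle α β γ) j) / n ^ 2 := by positivity
    have h3 := congrArg norm heq
    rw [norm_mul, norm_pow, norm_pow, Complex.norm_exp_ofReal_mul_I, one_mul] at h3
    have h4 := (pow_left_inj₀ (norm_nonneg _) (norm_nonneg _) hn.ne').1 h3
    rw [h4, sub_self, abs_zero] at h1
    linarith

/-- Up to O(1/J) the cyclic coefficients may be replaced by Laurent coefficients. These form Riemann
sums of a bounded, almost everywhere continuous function, and the phases in front tend to 1. -/
theorem tendsto_greenSum (σ : ℝ) (p q : ℤ) :
    Tendsto (fun x : ℕ × ℝ => greenSum α β γ x.1 σ x.2 p q) (twistFilter α β γ σ)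
      (𝓝 (greenLimit α β γ p q)) := by
  obtain ⟨c, hc, hmax⟩ := exists_max_norm_ge hα hβ hαβγ
  obtain ⟨K, hK, hgap⟩ := exists_gap hα hβ hαβγ
  have hfst := tendsto_fst_twistFilter (α := α) (β := β) (γ := γ) σ
  have hdiff : Tendsto (fun x : ℕ × ℝ => (x.1 : ℂ)⁻¹ * ∑ j ∈ Finset.range x.1,
      gridPoint x.1 σ j ^ p * innerSum x.1 q (coefA α (gridPoint x.1 σ j))
        (coefB α β γ (gridPoint x.1 σ j)) (Complex.exp (x.2 * Complex.I)) -
      (x.1 : ℂ)⁻¹ * ∑ j ∈ Finset.range x.1, gridPoint x.1 σ j ^ p *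
        innerLimit q (coefA α (gridPoint x.1 σ j)) (coefB α β γ (gridPoint x.1 σ j)))
      (twistFilter α β γ σ) (𝓝 0) := by
    rw [NormedAddGroup.tendsto_nhds_zero]
    intro ε hε
    rw [eventually_twistFilter_iff]
    have hlim : Tendsto (fun J : ℕ => (8 / K + 36 / c) / (J : ℝ)) atTop (𝓝 0) :=
      tendsto_const_nhds.div_atTop tendsto_natCast_atTop_atTop
    filter_upwards [eventually_gt_atTop 0, hlim.eventually (gt_mem_nhds hε)] with J hJ hJε
    filter_upwards [eventually_ge_atTop (J ^ 2),
      eventually_ge_atTop (2 * (q.natAbs + 1))] with n hn1 hn2 τ _ hgood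
    have : NeZero n := ⟨by omega⟩
    have hω : ∀ j, ‖gridPoint n σ j ^ p‖ ≤ 1 := fun j => (norm_exp_zpow _ p).le
    refine lt_of_le_of_lt ?_ hJε
    unfold innerSum innerLimit
    split_ifs with h0
    · exact norm_sum_cyclicCoeff_sub_le (t := critAngle α β γ) hω hc hK hJ hn1 (by omega)
        (fun j => hmax _) (hgap n σ) hgood
    · have h1 := norm_sum_cyclicCoeff_sub_le (m := (q - 1).toNat) (t := critAngle α β γ) hω hc hK hJ
        hn1 (by omega) (fun j => (hmax _).trans_eq (max_comm _ _))
        (fun j hj => (hgap n σ j hj).trans_eq (abs_sub_comm _ _)) hgood.symm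
      refine le_trans (le_of_eq ?_) h1
      rw [← norm_neg]
      congr 1
      have e : Complex.exp ((-τ : ℝ) * Complex.I) = (Complex.exp (τ * Complex.I))⁻¹ := by
        rw [← Complex.exp_neg]; push_cast; ring_nf
      rw [e]
      simp only [mul_neg, Finset.sum_neg_distrib]
      ring
  have hsum := hdiff.add ((tendsto_greenLimit hα hβ hαβγ σ p q).comp hfst)
  simp only [Function.comp_def, sub_add_cancel, zero_add] at hsum
  have hpow : ∀ r : ℤ, Tendsto (fun z : ℂ => (z ^ 2) ^ r) (𝓝 1) (𝓝 1) := by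
    intro r
    have : ContinuousAt (fun z : ℂ => (z ^ 2) ^ r) 1 :=
      ContinuousAt.zpow₀ (by fun_prop) _ (Or.inl (by simp))
    simpa [ContinuousAt] using this
  have hσ := tendsto_halfPhase_fst (α := α) (β := β) (γ := γ) σ
  have hτ := tendsto_halfPhase_snd (α := α) (β := β) (γ := γ) σ
  have h := (((hpow (-p)).comp hσ).mul ((hpow (-q)).comp hτ)).mul hsum
  simpa [greenSum, Function.comp_def] using h

end Green

/-! ### From twisted determinants to correlations. -/

theorem eventually_toTorus_eq_iff (x y : MidEdge ℤ) :
    ∀ᶠ n : ℕ in atTop, x.toTorus n = y.toTorus n ↔ x = y := by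
  filter_upwards [eventually_gt_atTop (x.2.1 - y.2.1).natAbs,
    eventually_gt_atTop (x.2.2 - y.2.2).natAbs] with n h1 h2
  refine ⟨fun h => ?_, fun h => by rw [h]⟩
  obtain ⟨c, a, b⟩ := x
  obtain ⟨c', a', b'⟩ := y
  simp only [toTorus, Prod.mk.injEq] at h h1 h2
  obtain ⟨h3, h4, h5⟩ := h
  rw [ZMod.intCast_eq_intCast_iff_dvd_sub] at h4 h5
  have e1 := Int.eq_zero_of_abs_lt_dvd h4 (by rw [abs_lt]; omega)
  have e2 := Int.eq_zero_of_abs_lt_dvd h5 (by rw [abs_lt]; omega)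
  simp only [Prod.mk.injEq]
  exact ⟨h3, by omega, by omega⟩

theorem eventually_stepWeight_toTorus {𝕜 : Type*} [CommRing 𝕜] (x y : MidEdge ℤ) :
    ∀ᶠ n : ℕ in atTop, ∀ a b c : 𝕜,
      stepWeight a b c (x.toTorus n) (y.toTorus n) = stepWeight a b c x y := by
  filter_upwards [eventually_toTorus_eq_iff y x, eventually_toTorus_eq_iff y x.addE3,
    eventually_toTorus_eq_iff y x.straight] with n h1 h2 h3 a b c
  unfold stepWeight
  rw [← toTorus_addE3, ← toTorus_straight]
  simp only [h1, h2, h3]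
  rfl

theorem stepWeight_eq_kasteleyn (α β γ : ℝ) (x y : MidEdge ℤ) :
    stepWeight (α : ℂ) β γ x y = kasteleyn α β γ x y := by
  obtain ⟨c, a, b⟩ := x
  obtain ⟨c', a', b'⟩ := y
  cases c <;> cases c' <;> simp [stepWeight, kasteleyn, addE1, addE2, addE3, straight]

section Entries

variable (α β γ : ℝ)

/-- The inverse of the Kasteleyn matrix of the discrete torus, in terms of sums over the first
frequency. -/
noncomputable def inverseSum (n : ℕ) (σ τ : ℝ) (x y : MidEdge ℤ) : ℂ :=
  match x.1, y.1 with
  | Colour.B, Colour.B => greenSum α β γ n σ τ (x.2.1 - y.2.1) (x.2.2 - y.2.2) +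
      β * halfPhase n τ ^ 2 * greenSum α β γ n σ τ (x.2.1 - y.2.1) (x.2.2 - y.2.2 + 1)
  | Colour.B, Colour.W => -(γ * halfPhase n σ * halfPhase n τ) *
      greenSum α β γ n σ τ (x.2.1 - y.2.1 + 1) (x.2.2 - y.2.2)
  | Colour.W, Colour.B => -(γ * halfPhase n σ * halfPhase n τ) *
      greenSum α β γ n σ τ (x.2.1 - y.2.1) (x.2.2 - y.2.2 + 1)
  | Colour.W, Colour.W => greenSum α β γ n σ τ (x.2.1 - y.2.1) (x.2.2 - y.2.2) +
      α * halfPhase n σ ^ 2 * greenSum α β γ n σ τ (x.2.1 - y.2.1 + 1) (x.2.2 - y.2.2)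

/-- The inverse of the Kasteleyn operator of the infinite lattice. -/
noncomputable def inverseLimit (x y : MidEdge ℤ) : ℂ :=
  match x.1, y.1 with
  | Colour.B, Colour.B => greenLimit α β γ (x.2.1 - y.2.1) (x.2.2 - y.2.2) +
      β * greenLimit α β γ (x.2.1 - y.2.1) (x.2.2 - y.2.2 + 1)
  | Colour.B, Colour.W => -γ * greenLimit α β γ (x.2.1 - y.2.1 + 1) (x.2.2 - y.2.2)
  | Colour.W, Colour.B => -γ * greenLimit α β γ (x.2.1 - y.2.1) (x.2.2 - y.2.2 + 1)
  | Colour.W, Colour.W => greenLimit α β γ (x.2.1 - y.2.1) (x.2.2 - y.2.2) +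
      α * greenLimit α β γ (x.2.1 - y.2.1 + 1) (x.2.2 - y.2.2)

variable {α β γ}

theorem torusInverse_toTorus {n : ℕ} [NeZero n] {σ τ : ℝ}
    (h : ∀ j < n, coefA α (gridPoint n σ j) ^ n ≠
      Complex.exp (τ * Complex.I) * coefB α β γ (gridPoint n σ j) ^ n) {x y : MidEdge ℤ}
    (hxy : |x.2.2 - y.2.2| + 1 < n) :
    torusInverse (α * halfPhase n σ ^ 2) (β * halfPhase n τ ^ 2)
      (γ * halfPhase n σ * halfPhase n τ) (x.toTorus n) (y.toTorus n) =
      inverseSum α β γ n σ τ x y := by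
  obtain ⟨c, a, b⟩ := x
  obtain ⟨c', a', b'⟩ := y
  simp only at hxy
  have h0 : |b - b'| < n := by omega
  have h1 : |b - b' + 1| < n := by
    have := abs_add_le (b - b') 1
    rw [abs_one] at this
    omega
  have e00 := torusGreen_eq_greenSum (γ := γ) (σ := σ) (τ := τ) h (a - a') h0
  have e01 := torusGreen_eq_greenSum (γ := γ) (σ := σ) (τ := τ) h (a - a') h1
  have e10 := torusGreen_eq_greenSum (γ := γ) (σ := σ) (τ := τ) h (a - a' + 1) h0
  push_cast at e00 e01 e10
  cases c <;> cases c' <;>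
    simp [torusInverse, toTorus, inverseSum, e00, e01, e10]

variable (hα : 0 < α) (hβ : 0 < β) (hγ : 0 < γ) (hαβγ : 0 < γ ^ 2 - α * β)

include hα hβ hαβγ

theorem tendsto_inverseSum (σ : ℝ) (x y : MidEdge ℤ) :
    Tendsto (fun t : ℕ × ℝ => inverseSum α β γ t.1 σ t.2 x y) (twistFilter α β γ σ)
      (𝓝 (inverseLimit α β γ x y)) := by
  have hg := tendsto_greenSum hα hβ hαβγ σ
  have h1 := tendsto_halfPhase_fst (α := α) (β := β) (γ := γ) σ
  have h2 := tendsto_halfPhase_snd (α := α) (β := β) (γ := γ) σ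
  obtain ⟨c, a, b⟩ := x
  obtain ⟨c', a', b'⟩ := y
  cases c <;> cases c' <;> simp only [inverseSum, inverseLimit]
  · simpa using (hg (a - a') (b - b')).add
      (((h2.pow 2).const_mul (β : ℂ)).mul (hg (a - a') (b - b' + 1)))
  · simpa using ((((h1.const_mul (γ : ℂ)).mul h2).neg).mul (hg (a - a' + 1) (b - b')))
  · simpa using ((((h1.const_mul (γ : ℂ)).mul h2).neg).mul (hg (a - a') (b - b' + 1)))
  · simpa using (hg (a - a') (b - b')).add
      (((h1.pow 2).const_mul (α : ℂ)).mul (hg (a - a' + 1) (b - b')))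

/-- The correlations of a twisted determinant, in terms of the inverse Kasteleyn matrix. -/
noncomputable def twistRatio (α β γ : ℝ) {k : ℕ} (x y : Fin k → MidEdge ℤ) (n : ℕ) (σ τ : ℝ) : ℂ :=
  (∏ i, stepWeight (α * halfPhase n σ ^ 2) (β * halfPhase n τ ^ 2)
    (γ * halfPhase n σ * halfPhase n τ) (x i) (y i)) *
    (Matrix.of fun i j => inverseSum α β γ n σ τ (y i) (x j)).det

theorem tendsto_twistRatio {k : ℕ} (x y : Fin k → MidEdge ℤ) (σ : ℝ) :
    Tendsto (fun t : ℕ × ℝ => twistRatio α β γ x y t.1 σ t.2) (twistFilter α β γ σ)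
      (𝓝 ((∏ i, kasteleyn α β γ (x i) (y i)) *
        (Matrix.of fun i j => inverseLimit α β γ (y i) (x j)).det)) := by
  have h1 := tendsto_halfPhase_fst (α := α) (β := β) (γ := γ) σ
  have h2 := tendsto_halfPhase_snd (α := α) (β := β) (γ := γ) σ
  refine Tendsto.mul (tendsto_finsetProd _ fun i _ => ?_) ?_
  · rw [← stepWeight_eq_kasteleyn]
    have ha := (h1.pow 2).const_mul (α : ℂ)
    have hb := (h2.pow 2).const_mul (β : ℂ)
    have hc := (h1.const_mul (γ : ℂ)).mul h2
    simp only [one_pow, mul_one] at ha hb hc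
    unfold stepWeight
    split_ifs
    · exact tendsto_const_nhds
    · exact hc
    · cases (x i).1
      · exact ha
      · exact hb
    · exact tendsto_const_nhds
  · have hdet : Continuous fun M : Matrix (Fin k) (Fin k) ℂ => M.det :=
      Continuous.matrix_det continuous_id
    refine (hdet.tendsto _).comp ?_
    exact tendsto_pi_nhds.2 fun i => tendsto_pi_nhds.2 fun j =>
      tendsto_inverseSum hα hβ hαβγ σ (y i) (x j)

/-- A good twist has nonzero determinant, so `det_restrictMatrix` applies; for large n reduction to
the torus keeps the chosen sites apart. -/
theorem eventually_twistedSum_eq {k : ℕ} {x : Fin k → MidEdge ℤ} (hx : Function.Injective x)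
    (y : Fin k → MidEdge ℤ) (σ : ℝ) : ∀ᶠ t in twistFilter α β γ σ, ∀ [NeZero t.1] [Fact (1 < t.1)],
    twistedSum α β γ (fun i => (x i).toTorus t.1) (fun i => (y i).toTorus t.1)
      (Complex.exp (σ * Complex.I)) (Complex.exp (t.2 * Complex.I)) =
    twistedSum α β γ (n := t.1) (Fin.elim0 : Fin 0 → _) (Fin.elim0 : Fin 0 → _)
      (Complex.exp (σ * Complex.I)) (Complex.exp (t.2 * Complex.I)) *
        twistRatio α β γ x y t.1 σ t.2 := by
  have hfst := tendsto_fst_twistFilter (α := α) (β := β) (γ := γ) σ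
  have h1 : ∀ᶠ n : ℕ in atTop, ∀ i j, (x i).toTorus n = (x j).toTorus n ↔ x i = x j :=
    eventually_all.2 fun i => eventually_all.2 fun j => eventually_toTorus_eq_iff _ _
  have h2 : ∀ᶠ n : ℕ in atTop, ∀ i, ∀ a b c : ℂ,
      stepWeight a b c ((x i).toTorus n) ((y i).toTorus n) = stepWeight a b c (x i) (y i) :=
    eventually_all.2 fun i => eventually_stepWeight_toTorus _ _
  have h3 : ∀ᶠ n : ℕ in atTop, ∀ i j, |(y i).2.2 - (x j).2.2| + 1 < n :=
    eventually_all.2 fun i => eventually_all.2 fun j => by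
      filter_upwards [eventually_gt_atTop (|(y i).2.2 - (x j).2.2| + 1).natAbs] with n hn
      omega
  filter_upwards [hfst.eventually h1, hfst.eventually h2, hfst.eventually h3,
    eventually_pow_ne_twistFilter hα hβ hαβγ σ] with t g1 g2 g3 g4
  intro _ _
  have hinv := torusMatrix_mul_torusInverse (symbolDet_ne_zero g4)
  rw [← halfPhase_pow (n := t.1) σ, ← halfPhase_pow (n := t.1) t.2, ← det_torusMatrix_restrict,
    ← det_torusMatrix, det_restrictMatrix _ _ hinv _ _ (fun i j hij => hx ((g1 i j).1 hij))]
  congr 2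
  · exact Finset.prod_congr rfl fun i _ => g2 i _ _ _
  · congr 1
    ext i j
    exact torusInverse_toTorus g4 (g3 i j)

include hγ

/-- The shift multiplies each term by exp(iφQ). After factoring out exp(iφnμ), the error factor is
at most 2 where Q is atypical and |φ|ηn elsewhere. It depends on the moved set only, so positivity
turns this into a bound for the signed sum. -/
theorem norm_twistedSum_shift_le {n k : ℕ} [NeZero n] [Fact (1 < n)]
    (x y : Fin k → MidEdge (ZMod n)) {z₁ z₂ : ℂ} (h₁ : ‖z₁‖ = 1) (h₂ : ‖z₂‖ = 1) {μ η δ φ : ℝ} (hη : 0 ≤ η)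
    (hlln : ∑ ρ : GenSnake (ZMod n), snakeWeight n α β γ ρ *
      (if η * n ≤ |(fluxN (moved ρ.1) : ℝ) - n * μ| then 1 else 0) ≤
        δ * snakePartition n α β γ) :
    ‖Complex.exp ((-(φ * (n * μ)) : ℝ) * Complex.I) *
        twistedSum α β γ x y z₁ (z₂ * Complex.exp (φ * Complex.I)) -
      twistedSum α β γ x y z₁ z₂‖ ≤
      (2 / (1 - α * β / γ ^ 2)) ^ k * ((2 * δ + |φ| * (η * n)) * snakePartition n α β γ) := by
  have h := norm_sum_restrict_le hα hβ hγ hαβγ x y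
    (fun Y => (fluxSign n (fluxE Y) (fluxN Y) : ℂ) * z₁ ^ fluxE Y * z₂ ^ fluxN Y *
      (Complex.exp (Complex.I * (φ * (fluxN Y - n * μ) : ℝ)) - 1))
  have e1 : ∑ ρ : GenSnake (ZMod n), (if ∀ i, ρ.1 (x i) = y i then (snakeWeight n α β γ ρ : ℂ) *
      ((fluxSign n (fluxE (moved ρ.1)) (fluxN (moved ρ.1)) : ℂ) * z₁ ^ fluxE (moved ρ.1) *
        z₂ ^ fluxN (moved ρ.1) *
          (Complex.exp (Complex.I * (φ * (fluxN (moved ρ.1) - n * μ) : ℝ)) - 1)) else 0) =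
      Complex.exp ((-(φ * (n * μ)) : ℝ) * Complex.I) *
        twistedSum α β γ x y z₁ (z₂ * Complex.exp (φ * Complex.I)) -
      twistedSum α β γ x y z₁ z₂ := by
    unfold twistedSum
    rw [Finset.mul_sum, ← Finset.sum_sub_distrib]
    refine Finset.sum_congr rfl fun ρ _ => ?_
    split_ifs
    · generalize fluxN (moved ρ.1) = Q
      have : Complex.exp (Complex.I * (φ * (Q - n * μ) : ℝ)) =
          Complex.exp ((-(φ * (n * μ)) : ℝ) * Complex.I) * Complex.exp (φ * Complex.I) ^ Q := by
        rw [← Complex.exp_nat_mul, ← Complex.exp_add]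
        congr 1
        push_cast
        ring
      rw [this, mul_pow]
      ring
    · simp
  rw [← e1]
  refine h.trans ?_
  obtain ⟨r0, r1⟩ := ratio_bounds hα hβ hγ hαβγ
  have hC : 0 ≤ 2 / (1 - α * β / γ ^ 2) := div_nonneg two_pos.le (by linarith)
  refine mul_le_mul_of_nonneg_left ?_ (pow_nonneg hC k)
  have h2 := sum_weight_mono hα hβ hγ hαβγ (n := n)
    (φ := fun Y => ‖(fluxSign n (fluxE Y) (fluxN Y) : ℂ) * z₁ ^ fluxE Y * z₂ ^ fluxN Y *
      (Complex.exp (Complex.I * (φ * (fluxN Y - n * μ) : ℝ)) - 1)‖)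
    (ψ := fun Y => 2 * (if η * n ≤ |(fluxN Y : ℝ) - n * μ| then 1 else 0) + |φ| * (η * n) * 1) (by
      intro Y
      have hs : ‖(fluxSign n (fluxE Y) (fluxN Y) : ℂ)‖ = 1 := by
        rw [fluxSign]; push_cast; rw [norm_pow]; simp
      rw [norm_mul, norm_mul, norm_mul, norm_pow, norm_pow, h₁, h₂, one_pow, one_pow, hs, one_mul,
        one_mul, one_mul, mul_one]
      have hφ := abs_nonneg φ
      have hb1 : ‖Complex.exp (Complex.I * (φ * (fluxN Y - n * μ) : ℝ)) - 1‖ ≤ 2 := by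
        refine (norm_sub_le _ _).trans ?_
        rw [mul_comm Complex.I, Complex.norm_exp_ofReal_mul_I, norm_one]
        norm_num
      have hb2 := Real.norm_exp_I_mul_ofReal_sub_one_le (x := φ * (fluxN Y - n * μ))
      rw [Real.norm_eq_abs, abs_mul] at hb2
      split_ifs with hc
      · have : 0 ≤ |φ| * (η * n) := by positivity
        linarith
      · rw [mul_zero, zero_add]
        exact hb2.trans (mul_le_mul_of_nonneg_left (not_le.1 hc).le hφ))
  refine h2.trans ?_
  have h3 : ∀ ρ : GenSnake (ZMod n), snakeWeight n α β γ ρ *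
      (2 * (if η * n ≤ |(fluxN (moved ρ.1) : ℝ) - n * μ| then 1 else 0) + |φ| * (η * n) * 1) =
      2 * (snakeWeight n α β γ ρ *
        (if η * n ≤ |(fluxN (moved ρ.1) : ℝ) - n * μ| then 1 else 0)) +
      |φ| * (η * n) * snakeWeight n α β γ ρ := fun ρ => by ring
  simp only [h3, Finset.sum_add_distrib, ← Finset.mul_sum]
  rw [add_mul]
  refine add_le_add (by linarith) le_rfl

/-- Both the restricted and the unrestricted sum are carried from τ to a good twist τ + φ, with the
same phase and error o(Z_n), and there their ratio is explicit. The error is measured against the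
partition function because the unrestricted sum may vanish at τ itself. -/
theorem tendsto_twistedSum_ratio {k : ℕ} {x : Fin k → MidEdge ℤ} (hx : Function.Injective x)
    (y : Fin k → MidEdge ℤ) (σ : ℝ) {τ : ℝ} (hτ : |τ| ≤ 7) {ε : ℝ} (hε : 0 < ε) :
    ∀ᶠ n : ℕ in atTop, ∀ [NeZero n] [Fact (1 < n)],
      ‖twistedSum α β γ (fun i => (x i).toTorus n) (fun i => (y i).toTorus n)
          (Complex.exp (σ * Complex.I)) (Complex.exp (τ * Complex.I)) -
        twistedSum α β γ (n := n) (Fin.elim0 : Fin 0 → _) (Fin.elim0 : Fin 0 → _)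
          (Complex.exp (σ * Complex.I)) (Complex.exp (τ * Complex.I)) *
        ((∏ i, kasteleyn α β γ (x i) (y i)) *
          (Matrix.of fun i j => inverseLimit α β γ (y i) (x j)).det)‖ ≤
        ε * snakePartition n α β γ := by
  set E := (∏ i, kasteleyn α β γ (x i) (y i)) *
    (Matrix.of fun i j => inverseLimit α β γ (y i) (x j)).det with hE
  set C := (2 / (1 - α * β / γ ^ 2)) ^ k with hCdef
  obtain ⟨r0, r1⟩ := ratio_bounds hα hβ hγ hαβγ
  have hC : 0 ≤ C := pow_nonneg (div_nonneg two_pos.le (by linarith)) k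
  obtain ⟨μ, hμ⟩ := exists_flux_lln hα hβ hγ hαβγ
  have hlim := tendsto_twistRatio hα hβ hαβγ x y σ
  have h1 := (Metric.tendsto_nhds.1 hlim) (ε / 2) (by positivity)
  have h2 := (h1.and (eventually_twistedSum_eq hα hβ hαβγ hx y σ))
  rw [eventually_twistFilter_iff] at h2
  obtain ⟨J, hJ0, hJ⟩ := ((eventually_gt_atTop 0).and h2).exists
  set D := C + ‖E‖ with hD
  have hD0 : 0 ≤ D := by positivity
  have hJ' : (0 : ℝ) < J := Nat.cast_pos.2 hJ0
  set δ := ε / (8 * (D + 1)) with hδ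
  have hδ0 : 0 < δ := by positivity
  -- The deviation η is fixed after J: as φ ≤ 4J³/n, the value δ/(2J³) keeps |φ|ηn below 2δ.
  have hη0 : 0 < δ / (2 * J ^ 3) := by positivity
  filter_upwards [hJ, hμ (δ / (2 * J ^ 3)) hη0 δ hδ0, eventually_ge_atTop (4 * J ^ 3)]
    with n hn hlln hnJ
  intro _ _
  have hn0 : (0 : ℝ) < n := Nat.cast_pos.2 (NeZero.pos n)
  have hZ := snakePartition_pos_of_fact hα hβ hγ hαβγ (n := n)
  obtain ⟨φ, hφ0, hφ1, hgood⟩ := exists_isGoodTwist hJ0 hnJ σ (critAngle α β γ) (coefA α)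
    (coefB α β γ) τ
  have hφ2 : φ ≤ 1 := hφ1.trans (by rw [div_le_one hn0]; exact_mod_cast hnJ)
  obtain ⟨g1, g2⟩ := hn (τ + φ) (by
    refine (abs_add_le _ _).trans ?_
    rw [abs_of_nonneg hφ0]; linarith) hgood
  rw [dist_eq_norm] at g1
  have g2' := g2
  have e1 : Complex.exp ((τ + φ : ℝ) * Complex.I) =
      Complex.exp (τ * Complex.I) * Complex.exp (φ * Complex.I) := by
    rw [← Complex.exp_add]; push_cast; ring_nf
  simp only [e1] at g2'
  have hphi : |φ| * (δ / (2 * J ^ 3) * n) ≤ 2 * δ := by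
    rw [abs_of_nonneg hφ0]
    calc φ * (δ / (2 * J ^ 3) * n) ≤ 4 * J ^ 3 / n * (δ / (2 * J ^ 3) * n) := by gcongr
      _ = 2 * δ := by field_simp; ring
  have s1 := norm_twistedSum_shift_le hα hβ hγ hαβγ (fun i => (x i).toTorus n)
    (fun i => (y i).toTorus n) (Complex.norm_exp_ofReal_mul_I σ) (Complex.norm_exp_ofReal_mul_I τ)
    (φ := φ) hη0.le hlln
  have s2 := norm_twistedSum_shift_le hα hβ hγ hαβγ (n := n) (Fin.elim0 : Fin 0 → _)
    (Fin.elim0 : Fin 0 → _) (Complex.norm_exp_ofReal_mul_I σ) (Complex.norm_exp_ofReal_mul_I τ)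
    (φ := φ) hη0.le hlln
  have s3 := norm_twistedSum_le hα hβ hγ hαβγ (n := n) (Fin.elim0 : Fin 0 → _)
    (Fin.elim0 : Fin 0 → _) (Complex.norm_exp_ofReal_mul_I σ)
    (Complex.norm_exp_ofReal_mul_I (τ + φ))
  rw [pow_zero, one_mul] at s2 s3
  rw [e1] at s3
  rw [g2'] at s1
  have hω : ‖Complex.exp ((-(φ * (n * μ)) : ℝ) * Complex.I)‖ = 1 := Complex.norm_exp_ofReal_mul_I _
  generalize Complex.exp ((-(φ * (n * μ)) : ℝ) * Complex.I) = ω at *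
  generalize twistedSum α β γ (fun i => (x i).toTorus n) (fun i => (y i).toTorus n)
    (Complex.exp (σ * Complex.I)) (Complex.exp (τ * Complex.I)) = T at *
  generalize twistedSum α β γ (n := n) (Fin.elim0 : Fin 0 → _) (Fin.elim0 : Fin 0 → _)
    (Complex.exp (σ * Complex.I)) (Complex.exp (τ * Complex.I)) = T₀ at *
  generalize twistedSum α β γ (n := n) (Fin.elim0 : Fin 0 → _) (Fin.elim0 : Fin 0 → _)
    (Complex.exp (σ * Complex.I)) (Complex.exp (τ * Complex.I) * Complex.exp (φ * Complex.I)) = T₁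
    at *
  generalize twistRatio α β γ x y n σ (τ + φ) = R at *
  set Z := snakePartition n α β γ
  have key : T - T₀ * E = -(ω * (T₁ * R) - T) + ω * T₁ * (R - E) + (ω * T₁ - T₀) * E := by ring
  rw [key]
  refine (norm_add_le _ _).trans ?_
  refine (add_le_add (norm_add_le _ _) le_rfl).trans ?_
  rw [norm_neg, norm_mul, norm_mul, norm_mul, hω, one_mul]
  have b1 : ‖ω * (T₁ * R) - T‖ ≤ C * (4 * δ * Z) := s1.trans (by gcongr; linarith)
  have b2 : ‖T₁‖ * ‖R - E‖ ≤ Z * (ε / 2) := by gcongr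
  have b3 : ‖ω * T₁ - T₀‖ * ‖E‖ ≤ 4 * δ * Z * ‖E‖ := by
    gcongr
    exact s2.trans (by gcongr; linarith)
  have b4 : 4 * δ * (D + 1) = ε / 2 := by rw [hδ]; field_simp; ring
  have b5 : 0 ≤ δ * Z := by positivity
  nlinarith

end Entries

section Correlations

variable {α β γ : ℝ}

/-- The limit of the probability that `ρ (x i) = y i` for all `i`. -/
noncomputable def correlationLimit (α β γ : ℝ) {k : ℕ} (x y : Fin k → MidEdge ℤ) : ℂ :=
  (∏ i, kasteleyn α β γ (x i) (y i)) *
    (Matrix.of fun i j => inverseLimit α β γ (y i) (x j)).det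

theorem eventually_mem_ofValues_iff {k : ℕ} (x y : Fin k → MidEdge ℤ) :
    ∀ᶠ n : ℕ in atTop, ∀ [NeZero n] (σ : GenSnake (ZMod n)),
      periodicExt n σ ∈ (CylinderEvent.ofValues x y).1 ↔
        ∀ i, σ.1 ((x i).toTorus n) = (y i).toTorus n := by
  have h : ∀ᶠ n : ℕ in atTop, ∀ i, ((x i).toTorus n = (y i).toTorus n ↔ x i = y i) ∧
      ((x i).addE3.toTorus n = (y i).toTorus n ↔ (x i).addE3 = y i) ∧
      ((x i).straight.toTorus n = (y i).toTorus n ↔ (x i).straight = y i) :=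
    eventually_all.2 fun i => (eventually_toTorus_eq_iff _ _).and
      ((eventually_toTorus_eq_iff _ _).and (eventually_toTorus_eq_iff _ _))
  filter_upwards [h] with n hn _ σ
  change (∀ i, periodicExtFun n σ (x i) = y i) ↔ _
  refine forall_congr' fun i => ?_
  rw [← toTorus_periodicExtFun]
  obtain ⟨h1, h2, h3⟩ := hn i
  unfold periodicExtFun
  split_ifs
  · exact h1.symm
  · exact h2.symm
  · exact h3.symm

variable (hα : 0 < α) (hβ : 0 < β) (hγ : 0 < γ) (hαβγ : 0 < γ ^ 2 - α * β)

include hα hβ hγ hαβγ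

theorem eventually_norm_sum_restrict_sub_le {k : ℕ} {x : Fin k → MidEdge ℤ}
    (hx : Function.Injective x) (y : Fin k → MidEdge ℤ) {ε : ℝ} (hε : 0 < ε) :
    ∀ᶠ n : ℕ in atTop, ∀ [NeZero n] [Fact (1 < n)],
      ‖∑ ρ : GenSnake (ZMod n), (if ∀ i, ρ.1 ((x i).toTorus n) = (y i).toTorus n then
          (snakeWeight n α β γ ρ : ℂ) else 0) -
        snakePartition n α β γ * correlationLimit α β γ x y‖ ≤ ε * snakePartition n α β γ := by
  have h := fun (σ τ : ℝ) (hτ : |τ| ≤ 7) =>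
    tendsto_twistedSum_ratio hα hβ hγ hαβγ hx y σ hτ (half_pos hε)
  have hpi : |Real.pi| ≤ 7 := by
    rw [abs_of_pos Real.pi_pos]; linarith [Real.pi_le_four]
  have h0 : |(0 : ℝ)| ≤ 7 := by simp
  filter_upwards [h 0 0 h0, h 0 Real.pi hpi, h Real.pi 0 h0, h Real.pi Real.pi hpi]
    with n h1 h2 h3 h4
  intro _ _
  replace h1 := @h1 _ _
  replace h2 := @h2 _ _
  replace h3 := @h3 _ _
  replace h4 := @h4 _ _
  have hs := sum_twistedSum α β γ (fun i => (x i).toTorus n) (fun i => (y i).toTorus n) 1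
  have hs0 := sum_twistedSum α β γ (n := n) (Fin.elim0 : Fin 0 → _) (Fin.elim0 : Fin 0 → _) 1
  simp only [IsEmpty.forall_iff, if_true, one_pow, mul_one] at hs hs0
  have hZ : (snakePartition n α β γ : ℂ) = ∑ ρ : GenSnake (ZMod n), (snakeWeight n α β γ ρ : ℂ) := by
    rw [snakePartition]; push_cast; rfl
  rw [hs, hZ, hs0]
  simp only [Complex.ofReal_zero, zero_mul, Complex.exp_zero, Complex.exp_pi_mul_I] at h1 h2 h3 h4
  unfold correlationLimit
  generalize ((∏ i, kasteleyn α β γ (x i) (y i)) *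
    (Matrix.of fun i j => inverseLimit α β γ (y i) (x j)).det) = E at *
  generalize twistedSum α β γ (fun i => (x i).toTorus n) (fun i => (y i).toTorus n) = T at *
  generalize twistedSum α β γ (n := n) (Fin.elim0 : Fin 0 → _) (Fin.elim0 : Fin 0 → _) = T₀ at *
  have tri : ∀ p q r t : ℂ, ‖(-p + q + r + t) / 2‖ ≤ (‖p‖ + ‖q‖ + ‖r‖ + ‖t‖) / 2 := by
    intro p q r t
    rw [norm_div, Complex.norm_two]
    gcongr
    have := norm_add_le (-p + q + r) t
    have := norm_add_le (-p + q) r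
    have := norm_add_le (-p) q
    rw [norm_neg] at this
    linarith
  -- The parity of n only decides which of the four twists (±1, ±1) carries the minus sign.
  rcases neg_one_pow_eq_or ℂ n with hn | hn <;> rw [hn]
  · have e : (-T 1 1 + T (-1) 1 + T 1 (-1) + T (-1) (-1)) / 2 -
        (-T₀ 1 1 + T₀ (-1) 1 + T₀ 1 (-1) + T₀ (-1) (-1)) / 2 * E =
        (-(T 1 1 - T₀ 1 1 * E) + (T (-1) 1 - T₀ (-1) 1 * E) + (T 1 (-1) - T₀ 1 (-1) * E) +
          (T (-1) (-1) - T₀ (-1) (-1) * E)) / 2 := by ring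
    rw [e]
    refine (tri _ _ _ _).trans ?_
    linarith
  · rw [neg_neg]
    have e : (-T (-1) (-1) + T 1 (-1) + T (-1) 1 + T 1 1) / 2 -
        (-T₀ (-1) (-1) + T₀ 1 (-1) + T₀ (-1) 1 + T₀ 1 1) / 2 * E =
        (-(T (-1) (-1) - T₀ (-1) (-1) * E) + (T 1 (-1) - T₀ 1 (-1) * E) +
          (T (-1) 1 - T₀ (-1) 1 * E) + (T 1 1 - T₀ 1 1 * E)) / 2 := by ring
    rw [e]
    refine (tri _ _ _ _).trans ?_
    linarith

theorem tendsto_periodicLaw_ofValues {k : ℕ} {x : Fin k → MidEdge ℤ}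
    (hx : Function.Injective x) (y : Fin k → MidEdge ℤ) :
    Tendsto (fun n : ℕ => ((periodicLaw (n + 1) α β γ (CylinderEvent.ofValues x y).1 : ℝ) : ℂ))
      atTop (𝓝 (correlationLimit α β γ x y)) := by
  rw [Metric.tendsto_nhds]
  intro ε hε
  have h1 := eventually_norm_sum_restrict_sub_le hα hβ hγ hαβγ hx y (half_pos hε)
  have h2 := eventually_mem_ofValues_iff x y
  have hsucc := tendsto_add_atTop_nat 1
  filter_upwards [hsucc.eventually h1, hsucc.eventually h2, eventually_gt_atTop 0]
    with n hn1 hn2 hn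
  have : Fact (1 < n + 1) := ⟨by omega⟩
  have hZ := snakePartition_pos_of_fact hα hβ hγ hαβγ (n := n + 1)
  have hZ' : ((snakePartition (n + 1) α β γ : ℝ) : ℂ) ≠ 0 := Complex.ofReal_ne_zero.2 hZ.ne'
  have e : ((periodicLaw (n + 1) α β γ (CylinderEvent.ofValues x y).1 : ℝ) : ℂ) =
      (∑ ρ : GenSnake (ZMod (n + 1)),
        (if ∀ i, ρ.1 ((x i).toTorus (n + 1)) = (y i).toTorus (n + 1) then
          (snakeWeight (n + 1) α β γ ρ : ℂ) else 0)) / snakePartition (n + 1) α β γ := by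
    rw [periodicLaw, Finset.sum_div]
    push_cast
    refine Finset.sum_congr rfl fun ρ _ => ?_
    simp only [hn2 ρ]
    split_ifs
    · rw [snakeBoltzmann]; push_cast; rfl
    · simp
  rw [dist_eq_norm, e, div_sub' hZ', norm_div, Complex.norm_real, Real.norm_of_nonneg hZ.le,
    div_lt_iff₀ hZ]
  refine (hn1).trans_lt ?_
  nlinarith

end Correlations

/-! ### Compactness and countable additivity. -/

section CylinderMeasures

/-- Cluster points of sequences of configurations exist. -/
theorem exists_cluster_genSnake (r : ℕ → GenSnake ℤ) (𝒰 : Ultrafilter ℕ) :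
    ∃ ρ : GenSnake ℤ, ∀ x, ∀ᶠ N in 𝒰, (r N).1 x = ρ.1 x := by
  have hf : ∀ x, ∃ y, (y = x ∨ y = x.addE3 ∨ y = x.straight) ∧ ∀ᶠ N in 𝒰, (r N).1 x = y := by
    intro x
    have h : ∀ᶠ N in 𝒰, (r N).1 x = x ∨ (r N).1 x = x.addE3 ∨ (r N).1 x = x.straight :=
      Eventually.of_forall fun N => (r N).2 x
    rw [Ultrafilter.eventually_or, Ultrafilter.eventually_or] at h
    rcases h with h | h | h
    · exact ⟨_, Or.inl rfl, h⟩
    · exact ⟨_, Or.inr (Or.inl rfl), h⟩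
    · exact ⟨_, Or.inr (Or.inr rfl), h⟩
  choose f hf1 hf2 using hf
  have hinj : Function.Injective f := by
    intro x x' hxx
    obtain ⟨N, h1, h2⟩ := ((hf2 x).and (hf2 x')).exists
    apply (r N).1.injective
    rw [h1, h2, hxx]
  -- Every configuration sends one of the three fixed sites y, u, v to y, so the ultrafilter selects
  -- one of them; no preimage escapes to infinity.
  have hsurj : Function.Surjective f := by
    intro y
    obtain ⟨u, hu⟩ := (addE3_bijective ℤ).2 y
    obtain ⟨v, hv⟩ := (straight_bijective ℤ).2 y
    have h : ∀ᶠ N in 𝒰, (r N).1 y = y ∨ (r N).1 u = y ∨ (r N).1 v = y := by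
      refine Eventually.of_forall fun N => ?_
      obtain ⟨w, hw⟩ := (r N).1.surjective y
      rcases (r N).2 w with h1 | h1 | h1
      · left; rw [hw] at h1; rw [h1, hw, h1]
      · right; left
        rw [hw] at h1
        rw [(addE3_bijective ℤ).1 (hu.trans h1), hw]
      · right; right
        rw [hw] at h1
        rw [(straight_bijective ℤ).1 (hv.trans h1), hw]
    rw [Ultrafilter.eventually_or, Ultrafilter.eventually_or] at h
    have key : ∀ w, (∀ᶠ N in 𝒰, (r N).1 w = y) → ∃ a, f a = y := by
      intro w hw
      obtain ⟨N, h1, h2⟩ := ((hf2 w).and hw).exists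
      exact ⟨w, h1.symm.trans h2⟩
    rcases h with h | h | h <;> exact key _ h
  exact ⟨⟨Equiv.ofBijective f ⟨hinj, hsurj⟩, hf1⟩, hf2⟩

/-- A cylinder event that is a countable union of cylinder events is a finite union of them. -/
theorem exists_finite_subunion (E : ℕ → CylinderEvent) (U : CylinderEvent)
    (hU : U.1 = ⋃ i, (E i).1) : ∃ N, U.1 = ⋃ i ∈ Finset.range N, (E i).1 := by
  by_contra hcon
  push Not at hcon
  have h1 : ∀ N, ∃ ρ ∈ U.1, ∀ i < N, ρ ∉ (E i).1 := by
    intro N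
    by_contra h2
    push Not at h2
    refine hcon N (Set.Subset.antisymm (fun ρ hρ => ?_) ?_)
    · obtain ⟨i, hi, h3⟩ := h2 ρ hρ
      exact Set.mem_biUnion (Finset.mem_coe.2 (Finset.mem_range.2 hi)) h3
    · rw [hU]
      exact Set.iUnion₂_subset fun i _ => Set.subset_iUnion (fun i => (E i).1) i
  choose r hr1 hr2 using h1
  -- A cluster point of configurations in U that avoid the first N events would lie in U but in none
  -- of the events.
  obtain ⟨ρ, hρ⟩ := exists_cluster_genSnake r (hyperfilter ℕ)
  have hcyl : ∀ C : CylinderEvent, ∀ᶠ N in hyperfilter ℕ, r N ∈ C.1 ↔ ρ ∈ C.1 := by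
    intro C
    obtain ⟨F, hF⟩ := C.2
    have h2 : ∀ᶠ N in hyperfilter ℕ, ∀ x ∈ F, (r N).1 x = ρ.1 x :=
      (Filter.eventually_all_finset F).2 fun x _ => hρ x
    filter_upwards [h2] with N hN using hF _ _ hN
  have hρU : ρ ∈ U.1 := by
    obtain ⟨N, hN⟩ := (hcyl U).exists
    exact hN.1 (hr1 N)
  rw [hU] at hρU
  obtain ⟨i, hi⟩ := Set.mem_iUnion.1 hρU
  have h3 : ∀ᶠ N in hyperfilter ℕ, i < N := by
    have := (eventually_gt_atTop i).filter_mono (Nat.hyperfilter_le_atTop)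
    exact this
  obtain ⟨N, hN1, hN2⟩ := ((hcyl (E i)).and h3).exists
  exact hr2 N i hN2 (hN1.2 hi)

theorem periodicLaw_biUnion (n : ℕ) [NeZero n] (α β γ : ℝ) {ι : Type*} (s : Finset ι)
    (E : ι → Set (GenSnake ℤ)) (hE : ∀ i ∈ s, ∀ j ∈ s, i ≠ j → Disjoint (E i) (E j)) :
    periodicLaw n α β γ (⋃ i ∈ s, E i) = ∑ i ∈ s, periodicLaw n α β γ (E i) := by
  classical
  unfold periodicLaw
  rw [Finset.sum_comm]
  refine Finset.sum_congr rfl fun σ _ => ?_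
  by_cases h : ∃ i ∈ s, periodicExt n σ ∈ E i
  · obtain ⟨i, hi, hm⟩ := h
    rw [if_pos (Set.mem_iUnion₂.2 ⟨i, hi, hm⟩), Finset.sum_eq_single i]
    · rw [if_pos hm]
    · intro j hj hji
      rw [if_neg]
      intro hm'
      exact Set.disjoint_left.1 (hE i hi j hj hji.symm) hm hm'
    · intro h; exact absurd hi h
  · push Not at h
    rw [if_neg, Finset.sum_eq_zero]
    · intro i hi; rw [if_neg (h i hi)]
    · intro hm
      obtain ⟨i, hi, hm'⟩ := Set.mem_iUnion₂.1 hm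
      exact h i hi hm'

/-- A cylinder event is a finite disjoint union of events that prescribe the values at given
sites. -/
theorem exists_ofValues_decomposition (E : CylinderEvent) : ∃ (k : ℕ) (x : Fin k → MidEdge ℤ)
    (S : Finset (Fin k → MidEdge ℤ)), Function.Injective x ∧
      E.1 = ⋃ y ∈ S, (CylinderEvent.ofValues x y).1 := by
  classical
  obtain ⟨F, hF⟩ := E.2
  let x : Fin F.card → MidEdge ℤ := fun i => (F.equivFin.symm i : MidEdge ℤ)
  have hx : Function.Injective x := Subtype.val_injective.comp F.equivFin.symm.injective
  refine ⟨F.card, x, (Fintype.piFinset fun i => {x i, (x i).addE3, (x i).straight}).filter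
    fun y => ∃ ρ ∈ E.1, ∀ i, ρ.1 (x i) = y i, hx, ?_⟩
  ext ρ
  simp only [Set.mem_iUnion, Finset.mem_filter, Fintype.mem_piFinset, Finset.mem_insert,
    Finset.mem_singleton, exists_prop]
  constructor
  · intro hρ
    exact ⟨fun i => ρ.1 (x i), ⟨fun i => ρ.2 (x i), ρ, hρ, fun i => rfl⟩, fun i => rfl⟩
  · rintro ⟨y, ⟨-, ρ', hρ', h1⟩, h2⟩
    refine (hF ρ' ρ fun z hz => ?_).1 hρ'
    have hz' : x (F.equivFin ⟨z, hz⟩) = z := by simp [x]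
    rw [← hz', h1, h2]

theorem disjoint_ofValues {k : ℕ} (x : Fin k → MidEdge ℤ) {y y' : Fin k → MidEdge ℤ}
    (h : y ≠ y') : Disjoint (CylinderEvent.ofValues x y).1 (CylinderEvent.ofValues x y').1 := by
  rw [Set.disjoint_left]
  intro ρ h1 h2
  exact h (funext fun i => (h1 i).symm.trans (h2 i))

/-- Pointwise limits of the periodic laws are countably additive. -/
theorem exists_signedCylinderMeasure (α β γ : ℝ) (h : ∀ (k : ℕ) (x y : Fin k → MidEdge ℤ),
    Function.Injective x → ∃ p : ℝ, Tendsto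
      (fun n : ℕ => periodicLaw (n + 1) α β γ (CylinderEvent.ofValues x y).1) atTop (𝓝 p)) :
    ∃ P : SignedCylinderMeasure, ∀ E : CylinderEvent,
      Tendsto (fun n : ℕ => periodicLaw (n + 1) α β γ E.1) atTop (𝓝 (P.toFun E)) := by
  classical
  have hlim : ∀ E : CylinderEvent, ∃ p : ℝ,
      Tendsto (fun n : ℕ => periodicLaw (n + 1) α β γ E.1) atTop (𝓝 p) := by
    intro E
    obtain ⟨k, x, S, hx, hE⟩ := exists_ofValues_decomposition E
    choose p hp using fun y => h k x y hx
    refine ⟨∑ y ∈ S, p y, ?_⟩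
    rw [hE]
    simp only [fun n : ℕ => periodicLaw_biUnion (n + 1) α β γ S
      (fun y => (CylinderEvent.ofValues x y).1) fun i _ j _ hij => disjoint_ofValues x hij]
    exact tendsto_finsetSum S fun y _ => hp y
  choose P hP using hlim
  refine ⟨⟨P, fun E U hdisj hU => ?_⟩, hP⟩
  obtain ⟨N, hN⟩ := exists_finite_subunion E U hU
  -- Disjointness leaves only finitely many nonempty events, so countable additivity reduces to
  -- finite additivity.
  have hempty : ∀ i ∉ Finset.range N, (E i).1 = ∅ := by
    intro i hi
    rw [Set.eq_empty_iff_forall_notMem]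
    intro ρ hρ
    have h1 : ρ ∈ U.1 := by rw [hU]; exact Set.mem_iUnion.2 ⟨i, hρ⟩
    rw [hN] at h1
    obtain ⟨j, hj, hm⟩ := Set.mem_iUnion₂.1 h1
    exact Set.disjoint_left.1 (hdisj i j (fun h => hi (h ▸ hj))) hρ hm
  have hzero : ∀ i ∉ Finset.range N, P (E i) = 0 := by
    intro i hi
    refine tendsto_nhds_unique (hP (E i)) ?_
    rw [hempty i hi]
    simp [periodicLaw]
  have hsum : P U = ∑ i ∈ Finset.range N, P (E i) := by
    refine tendsto_nhds_unique (hP U) ?_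
    rw [hN]
    simp only [fun n : ℕ => periodicLaw_biUnion (n + 1) α β γ (Finset.range N)
      (fun i => (E i).1) fun i _ j _ hij => hdisj i j hij]
    exact tendsto_finsetSum _ fun i _ => hP (E i)
  rw [hsum]
  exact hasSum_sum_of_ne_finset_zero hzero

end CylinderMeasures

/-! ### One-dimensional integrals and their singularities. -/

section SingularIntegrals

theorem tendsto_cyclicCoeff {a b : ℂ} (h : ‖a‖ ≠ ‖b‖) (m : ℕ) :
    Tendsto (fun n : ℕ => cyclicCoeff n m a b 1) atTop (𝓝 (laurentCoeff m a b)) := by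
  rw [tendsto_iff_norm_sub_tendsto_zero]
  have hpos : 0 < |‖a‖ - ‖b‖| := abs_pos.2 (sub_ne_zero.2 h)
  have h1 : Tendsto (fun n : ℕ => 1 / (((n - 1 - m : ℕ) : ℝ) * |‖a‖ - ‖b‖|)) atTop (𝓝 0) := by
    refine tendsto_const_nhds.div_atTop (Tendsto.atTop_mul_const hpos ?_)
    refine tendsto_natCast_atTop_atTop.comp ?_
    simp only [Nat.sub_sub]
    exact tendsto_sub_atTop_nat _
  refine squeeze_zero' (Eventually.of_forall fun _ => norm_nonneg _) ?_ h1
  filter_upwards [eventually_gt_atTop (m + 1)] with n hn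
  exact norm_cyclicCoeff_sub_laurentCoeff_le hn norm_one h

theorem tendsto_innerSum {a b : ℂ} (h : ‖a‖ ≠ ‖b‖) (q : ℤ) :
    Tendsto (fun n : ℕ => innerSum n q a b 1) atTop (𝓝 (innerLimit q a b)) := by
  unfold innerSum innerLimit
  split_ifs
  · exact tendsto_cyclicCoeff h _
  · rw [inv_one]
    exact (tendsto_cyclicCoeff h.symm _).neg

theorem abs_norm_sub_norm_le_norm_sub_exp_mul (a b : ℂ) (θ : ℝ) :
    |‖a‖ - ‖b‖| ≤ ‖a - Complex.exp (θ * Complex.I) * b‖ := by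
  have h := abs_norm_sub_norm_le a (Complex.exp (θ * Complex.I) * b)
  rwa [norm_mul, Complex.norm_exp_ofReal_mul_I, one_mul] at h

theorem continuous_inner_integrand {a b : ℂ} (h : ‖a‖ ≠ ‖b‖) (q : ℤ) : Continuous fun θ : ℝ =>
    Complex.exp (θ * Complex.I) ^ q / (a - Complex.exp (θ * Complex.I) * b) := by
  refine Continuous.div (Continuous.zpow₀ (by fun_prop) q fun θ => Or.inl (Complex.exp_ne_zero _))
    (by fun_prop) fun θ => ?_
  rw [← norm_pos_iff]
  exact (abs_pos.2 (sub_ne_zero.2 h)).trans_le (abs_norm_sub_norm_le_norm_sub_exp_mul a b θ)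

/-- The integral is the limit of sums over n-th roots of unity, which `sum_div_sub_stdAddChar`
evaluates exactly. -/
theorem integral_zpow_div_sub {a b : ℂ} (h : ‖a‖ ≠ ‖b‖) (q : ℤ) :
    (2 * Real.pi)⁻¹ • ∫ θ in 0..2 * Real.pi, Complex.exp (θ * Complex.I) ^ q /
      (a - Complex.exp (θ * Complex.I) * b) = innerLimit q a b := by
  have hpos : 0 < |‖a‖ - ‖b‖| := abs_pos.2 (sub_ne_zero.2 h)
  have h1 := tendsto_riemann_sum (f := fun θ : ℝ => Complex.exp (θ * Complex.I) ^ q /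
    (a - Complex.exp (θ * Complex.I) * b)) (M := 1 / |‖a‖ - ‖b‖|) (fun θ => by
      rw [norm_div, norm_exp_zpow]
      have := abs_norm_sub_norm_le_norm_sub_exp_mul a b θ
      gcongr) (Eventually.of_forall fun θ => (continuous_inner_integrand h q).continuousAt) 0
  refine tendsto_nhds_unique h1 ((tendsto_innerSum h q).congr' ?_)
  filter_upwards [eventually_gt_atTop q.natAbs] with n hn
  have : NeZero n := ⟨by omega⟩
  have hne : a ^ n ≠ (1 : ℂ) ^ n * b ^ n := by
    intro h2
    have h3 := congrArg norm h2
    rw [one_pow, one_mul, norm_pow, norm_pow] at h3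
    exact h ((pow_left_inj₀ (norm_nonneg _) (norm_nonneg _) (NeZero.ne n)).1 h3)
  have h2 := sum_div_sub_stdAddChar one_ne_zero hne (q := q) (by
    rw [← Int.natCast_natAbs]; exact_mod_cast hn)
  rw [one_zpow, one_pow, one_mul, one_mul] at h2
  rw [← h2, Complex.real_smul, Complex.ofReal_inv, Complex.ofReal_natCast]
  congr 1
  rw [← sum_zmod_val (fun j => Complex.exp (((2 * Real.pi * j + 0) / n : ℝ) * Complex.I) ^ q /
    (a - Complex.exp (((2 * Real.pi * j + 0) / n : ℝ) * Complex.I) * b))]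
  refine Finset.sum_congr rfl fun k _ => ?_
  have hk : Complex.exp (((2 * Real.pi * k.val + 0) / n : ℝ) * Complex.I) = ZMod.stdAddChar k := by
    have := gridPoint_eq 0 k
    rw [zero_div, Complex.ofReal_zero, zero_mul, Complex.exp_zero, one_mul] at this
    exact this.symm
  rw [hk, ← AddChar.map_zsmul_eq_zpow, zsmul_eq_mul, mul_comm]

/-- An integrable singularity at the multiples of `2 π`. -/
noncomputable def sinPole (θ : ℝ) : ℝ := |Real.sin (θ / 2)| ^ (-(2 / 3) : ℝ)

theorem sinPole_nonneg (θ : ℝ) : 0 ≤ sinPole θ := Real.rpow_nonneg (abs_nonneg _) _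

theorem measurable_sinPole : Measurable sinPole := by unfold sinPole; fun_prop

theorem periodic_sinPole : Function.Periodic sinPole (2 * Real.pi) := by
  intro θ
  unfold sinPole
  rw [add_div, mul_div_cancel_left₀ _ (two_ne_zero' ℝ), Real.sin_add_pi, abs_neg]

theorem sinPole_le {x θ : ℝ} (hx0 : 0 < x) (hx : x ≤ |Real.sin (θ / 2)|) :
    sinPole θ ≤ x ^ (-(2 / 3) : ℝ) :=
  Real.rpow_le_rpow_of_nonpos hx0 hx (by norm_num)

theorem intervalIntegrable_sinPole (a b : ℝ) : IntervalIntegrable sinPole volume a b := by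
  have hpi := Real.pi_pos
  refine periodic_sinPole.intervalIntegrable₀ (by positivity) ?_ a b
  have hI : IntervalIntegrable (fun θ : ℝ => Real.pi⁻¹ ^ (-(2 / 3) : ℝ) * θ ^ (-(2 / 3) : ℝ)) volume
      0 Real.pi :=
    (intervalIntegral.intervalIntegrable_rpow' (by norm_num)).const_mul _
  have h1 : IntervalIntegrable sinPole volume 0 Real.pi := by
    refine hI.mono_fun' measurable_sinPole.aestronglyMeasurable ?_
    rw [Set.uIoc_of_le hpi.le]
    filter_upwards [ae_restrict_mem measurableSet_Ioc] with θ hθ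
    rw [Real.norm_of_nonneg (sinPole_nonneg θ), ← Real.mul_rpow (by positivity) hθ.1.le]
    refine sinPole_le (mul_pos (by positivity) hθ.1) ?_
    refine le_trans (le_of_eq ?_) ((Real.mul_le_sin (x := θ / 2) (by linarith [hθ.1])
      (by linarith [hθ.2])).trans (le_abs_self _))
    field_simp
  have h2 : IntervalIntegrable sinPole volume Real.pi (2 * Real.pi) := by
    have h3 := h1.symm.comp_sub_left (2 * Real.pi)
    rw [sub_zero, show 2 * Real.pi - Real.pi = Real.pi by ring] at h3
    refine h3.congr (fun θ _ => ?_)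
    unfold sinPole
    rw [sub_div, mul_div_cancel_left₀ _ (two_ne_zero' ℝ), Real.sin_pi_sub]
  exact h1.trans h2

theorem integral_sinPole_sub (ψ : ℝ) : ∫ θ in 0..2 * Real.pi, sinPole (θ - ψ) =
    ∫ θ in 0..2 * Real.pi, sinPole θ := by
  rw [intervalIntegral.integral_comp_sub_right]
  have := periodic_sinPole.intervalIntegral_add_eq (0 - ψ) 0
  rw [zero_add] at this
  rw [← this]
  congr 1
  ring

theorem ae_sin_half_sub_ne_zero (ψ : ℝ) : ∀ᵐ θ : ℝ, Real.sin ((θ - ψ) / 2) ≠ 0 := by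
  filter_upwards [ae_cos_ne (Real.cos ψ)] with θ hθ h
  apply hθ
  rw [← sub_eq_zero, Real.cos_sub_cos, h, mul_zero]

/-- The distance from a point of the unit circle to the root of a linear polynomial. -/
theorem exists_phase_norm_sub_ge (a b : ℂ) {c : ℝ} (hc0 : 0 < c) (hc : c ≤ max ‖a‖ ‖b‖) :
    ∃ ψ : ℝ, ∀ θ : ℝ, c / 2 * |Real.sin ((θ - ψ) / 2)| ≤
      ‖a - Complex.exp (θ * Complex.I) * b‖ := by
  have hd : ∀ θ ψ : ℝ, ‖Complex.exp (θ * Complex.I) - Complex.exp (ψ * Complex.I)‖ =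
      2 * |Real.sin ((θ - ψ) / 2)| := by
    intro θ ψ
    have h1 : Complex.exp (θ * Complex.I) - Complex.exp (ψ * Complex.I) =
        Complex.exp (ψ * Complex.I) * (Complex.exp (Complex.I * (θ - ψ : ℝ)) - 1) := by
      rw [mul_sub, ← Complex.exp_add, mul_one]
      congr 2
      push_cast; ring
    rw [h1, norm_mul, Complex.norm_exp_ofReal_mul_I, one_mul,
      Complex.norm_exp_I_mul_ofReal_sub_one, Real.norm_eq_abs, abs_mul, abs_two]
  have hsin : ∀ x : ℝ, |Real.sin x| ≤ 1 := Real.abs_sin_le_one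
  -- If b is not small, ψ is the argument of the root a/b. Otherwise a dominates and any ψ will do.
  by_cases hb : c / 2 ≤ ‖b‖
  · have hb0 : 0 < ‖b‖ := by linarith
    have hb' : b ≠ 0 := norm_pos_iff.1 hb0
    refine ⟨(a / b).arg, fun θ => ?_⟩
    have h1 : ‖a - Complex.exp (θ * Complex.I) * b‖ =
        ‖b‖ * ‖Complex.exp (θ * Complex.I) - a / b‖ := by
      rw [← norm_mul, ← norm_neg]
      congr 1
      field_simp
      ring
    have h2 : ‖a / b - Complex.exp ((a / b).arg * Complex.I)‖ ≤
        ‖Complex.exp (θ * Complex.I) - a / b‖ := by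
      have h3 : a / b - Complex.exp ((a / b).arg * Complex.I) =
          ((‖a / b‖ - 1 : ℝ) : ℂ) * Complex.exp ((a / b).arg * Complex.I) := by
        nth_rewrite 1 [← Complex.norm_mul_exp_arg_mul_I (a / b)]
        push_cast
        ring
      rw [h3, norm_mul, Complex.norm_exp_ofReal_mul_I, mul_one, Complex.norm_real,
        Real.norm_eq_abs]
      have := abs_norm_sub_norm_le (a / b) (Complex.exp (θ * Complex.I))
      rwa [Complex.norm_exp_ofReal_mul_I, norm_sub_rev] at this
    have h4 := norm_sub_le_norm_sub_add_norm_sub (Complex.exp (θ * Complex.I)) (a / b)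
      (Complex.exp ((a / b).arg * Complex.I))
    rw [hd] at h4
    rw [h1]
    have h5 : |Real.sin ((θ - (a / b).arg) / 2)| ≤ ‖Complex.exp (θ * Complex.I) - a / b‖ := by
      linarith
    exact mul_le_mul hb h5 (abs_nonneg _) hb0.le
  · refine ⟨0, fun θ => ?_⟩
    have ha : c ≤ ‖a‖ := by
      rcases le_max_iff.1 hc with h | h
      · exact h
      · linarith
    have h1 := (le_abs_self _).trans (abs_norm_sub_norm_le_norm_sub_exp_mul a b θ)
    have h2 := hsin ((θ - 0) / 2)
    nlinarith

/-- The power -1 of the denominator is split as -1/3 - 2/3. The first part is bounded by the gap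
between the norms, the second by the distance to the root, integrable uniformly in its position. The
power -1/3 of the gap stays integrable in the outer angle even if the two critical angles coincide.
-/
theorem integral_inv_norm_sub_le {a b : ℂ} {c : ℝ} (hc0 : 0 < c) (hc : c ≤ max ‖a‖ ‖b‖)
    (h : ‖a‖ ≠ ‖b‖) : ∫ θ in 0..2 * Real.pi, ‖a - Complex.exp (θ * Complex.I) * b‖⁻¹ ≤
      (|‖a‖ - ‖b‖| ^ (-(1 / 3) : ℝ)) * ((c / 2) ^ (-(2 / 3) : ℝ) *
        ∫ θ in 0..2 * Real.pi, sinPole θ) := by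
  obtain ⟨ψ, hψ⟩ := exists_phase_norm_sub_ge a b hc0 hc
  have hpos : 0 < |‖a‖ - ‖b‖| := abs_pos.2 (sub_ne_zero.2 h)
  rw [← integral_sinPole_sub ψ, ← intervalIntegral.integral_const_mul,
    ← intervalIntegral.integral_const_mul]
  have hpi : (0 : ℝ) ≤ 2 * Real.pi := by positivity
  refine intervalIntegral.integral_mono_ae hpi ?_ ?_ ?_
  · refine Continuous.intervalIntegrable (Continuous.inv₀ (by fun_prop) fun θ => ?_) _ _
    exact (hpos.trans_le (abs_norm_sub_norm_le_norm_sub_exp_mul a b θ)).ne'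
  · have := (intervalIntegrable_sinPole (0 - ψ) (2 * Real.pi - ψ)).comp_sub_right ψ
    simp only [sub_add_cancel] at this
    exact (this.const_mul _).const_mul _
  · filter_upwards [ae_sin_half_sub_ne_zero ψ] with θ hθ
    have h1 := abs_norm_sub_norm_le_norm_sub_exp_mul a b θ
    have hP := hpos.trans_le h1
    have hs : 0 < |Real.sin ((θ - ψ) / 2)| := abs_pos.2 hθ
    have e : ‖a - Complex.exp (θ * Complex.I) * b‖⁻¹ =
        ‖a - Complex.exp (θ * Complex.I) * b‖ ^ (-(1 / 3) : ℝ) *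
          ‖a - Complex.exp (θ * Complex.I) * b‖ ^ (-(2 / 3) : ℝ) := by
      rw [← Real.rpow_add hP, ← Real.rpow_neg_one]; norm_num
    rw [e, sinPole, ← Real.mul_rpow (by positivity) hs.le]
    refine mul_le_mul (Real.rpow_le_rpow_of_nonpos hpos h1 (by norm_num))
      (Real.rpow_le_rpow_of_nonpos (by positivity) (hψ θ) (by norm_num))
      (Real.rpow_nonneg (norm_nonneg _) _) (Real.rpow_nonneg (abs_nonneg _) _)

end SingularIntegrals

/-! ### The kernel L as the limiting inverse. -/

section Kernel

variable {α β γ : ℝ}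

/-- The integrand of the lattice Green function. -/
noncomputable def greenIntegrand (α β γ : ℝ) (p q : ℤ) (w : Fin 2 → ℂ) : ℂ :=
  (2 * Real.pi * Complex.I * w 0)⁻¹ * (2 * Real.pi * Complex.I * w 1)⁻¹ *
    (w 0 ^ p * (w 1 ^ q / (coefA α (w 0) - w 1 * coefB α β γ (w 0))))

theorem sqrtBranch_sq (z : ℂ) : sqrtBranch z ^ 2 = z := by
  unfold sqrtBranch
  have h : (z ^ (1 / 2 : ℂ)) ^ 2 = z := by
    rw [← Complex.cpow_nat_mul]; norm_num
  split_ifs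
  · exact h
  · rw [neg_sq, h]

theorem sqrtBranch_ne_zero {z : ℂ} (hz : z ≠ 0) : sqrtBranch z ≠ 0 := by
  intro h
  apply hz
  rw [← sqrtBranch_sq z, h]; simp

theorem det_symbolMatrix (w₁ w₂ : ℂ) :
    (symbolMatrix α β γ w₁ w₂).det = coefA α w₁ - w₂ * coefB α β γ w₁ := by
  rw [det_colour]
  simp only [symbolMatrix, Matrix.of_apply, coefA, coefB]
  linear_combination (-γ ^ 2 * sqrtBranch w₂ ^ 2 : ℂ) * sqrtBranch_sq w₁ -
    (γ ^ 2 * w₁ : ℂ) * sqrtBranch_sq w₂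

/-- Singular M is included, both sides then being zero by convention, so identities of integrands
hold at the poles too. -/
theorem inv_colour (M : Matrix Colour Colour ℂ) (c c' : Colour) : M⁻¹ c c' = M.det⁻¹ *
    match c, c' with
    | Colour.B, Colour.B => M Colour.W Colour.W
    | Colour.B, Colour.W => -M Colour.B Colour.W
    | Colour.W, Colour.B => -M Colour.W Colour.B
    | Colour.W, Colour.W => M Colour.B Colour.B := by
  let N : Matrix Colour Colour ℂ := Matrix.of fun c c' => match c, c' with
    | Colour.B, Colour.B => M Colour.W Colour.W
    | Colour.B, Colour.W => -M Colour.B Colour.W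
    | Colour.W, Colour.B => -M Colour.W Colour.B
    | Colour.W, Colour.W => M Colour.B Colour.B
  by_cases h : M.det = 0
  · rw [Matrix.nonsing_inv_apply_not_isUnit M (by simpa using h), h]
    simp
  · have h1 : M * (M.det⁻¹ • N) = 1 := by
      have hd := det_colour M
      rw [Matrix.mul_smul]
      ext i j
      rw [Matrix.smul_apply, Matrix.mul_apply, sum_colour, smul_eq_mul,
        inv_mul_eq_iff_eq_mul₀ h, hd]
      cases i <;> cases j <;> simp [N] <;> ring
    rw [Matrix.inv_eq_right_inv h1]
    rfl

theorem torusMap_zero_one (θ : Fin 2 → ℝ) (i : Fin 2) :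
    torusMap 0 1 θ i = Complex.exp (θ i * Complex.I) := by
  simp [torusMap]

/-- The half-integer powers combine with the square roots in the off-diagonal entries to integer
powers. Only the square of `sqrtBranch` survives, so the branch is immaterial. -/
theorem kernelIntegrand_eq (x y : MidEdge ℤ) {w : Fin 2 → ℂ} (h0 : w 0 ≠ 0) (h1 : w 1 ≠ 0) :
    kernelIntegrand α β γ x y w = match y.1, x.1 with
      | Colour.B, Colour.B => greenIntegrand α β γ (y.2.1 - x.2.1) (y.2.2 - x.2.2) w +
          β * greenIntegrand α β γ (y.2.1 - x.2.1) (y.2.2 - x.2.2 + 1) w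
      | Colour.B, Colour.W =>
          -γ * greenIntegrand α β γ (y.2.1 - x.2.1 + 1) (y.2.2 - x.2.2) w
      | Colour.W, Colour.B =>
          -γ * greenIntegrand α β γ (y.2.1 - x.2.1) (y.2.2 - x.2.2 + 1) w
      | Colour.W, Colour.W => greenIntegrand α β γ (y.2.1 - x.2.1) (y.2.2 - x.2.2) w +
          α * greenIntegrand α β γ (y.2.1 - x.2.1 + 1) (y.2.2 - x.2.2) w := by
  have s0 := sqrtBranch_ne_zero h0
  have s1 := sqrtBranch_ne_zero h1
  have hz : ∀ (z : ℂ) (m : ℤ), sqrtBranch z ^ (2 * m) = z ^ m := by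
    intro z m
    rw [zpow_mul, zpow_ofNat, sqrtBranch_sq]
  obtain ⟨c, a, b⟩ := x
  obtain ⟨c', a', b'⟩ := y
  cases c <;> cases c' <;>
    simp only [kernelIntegrand, inv_colour, det_symbolMatrix, twice1, twice2, greenIntegrand]
  · rw [show 2 * a' + 1 - (2 * a + 1) = 2 * (a' - a) by ring,
      show 2 * b' - 2 * b = 2 * (b' - b) by ring, hz, hz, zpow_add_one₀ h1]
    simp only [symbolMatrix, Matrix.of_apply]
    ring
  · rw [show 2 * a' - (2 * a + 1) = 2 * (a' - a) - 1 by ring,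
      show 2 * b' + 1 - 2 * b = 2 * (b' - b) + 1 by ring, zpow_sub_one₀ s0, zpow_add_one₀ s1, hz, hz,
      zpow_add_one₀ h1]
    simp only [symbolMatrix, Matrix.of_apply]
    rw [div_eq_mul_inv]
    generalize (coefA α (w 0) - w 1 * coefB α β γ (w 0))⁻¹ = R
    field_simp
    linear_combination (-R * γ) * sqrtBranch_sq (w 1)
  · rw [show 2 * a' + 1 - 2 * a = 2 * (a' - a) + 1 by ring,
      show 2 * b' - (2 * b + 1) = 2 * (b' - b) - 1 by ring, zpow_sub_one₀ s1, zpow_add_one₀ s0, hz, hz,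
      zpow_add_one₀ h0]
    simp only [symbolMatrix, Matrix.of_apply]
    rw [div_eq_mul_inv]
    generalize (coefA α (w 0) - w 1 * coefB α β γ (w 0))⁻¹ = R
    field_simp
    linear_combination (-R * γ) * sqrtBranch_sq (w 0)
  · rw [show 2 * a' - 2 * a = 2 * (a' - a) by ring,
      show 2 * b' + 1 - (2 * b + 1) = 2 * (b' - b) by ring, hz, hz, zpow_add_one₀ h0]
    simp only [symbolMatrix, Matrix.of_apply]
    ring

variable (hα : 0 < α) (hβ : 0 < β) (hαβγ : 0 < γ ^ 2 - α * β)

include hα hβ hαβγ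

theorem integrable_greenIntegrand (p q : ℤ) : Integrable (fun x : ℝ × ℝ =>
    Complex.exp (x.1 * Complex.I) ^ p * (Complex.exp (x.2 * Complex.I) ^ q /
      (coefA α (Complex.exp (x.1 * Complex.I)) -
        Complex.exp (x.2 * Complex.I) * coefB α β γ (Complex.exp (x.1 * Complex.I)))))
    ((volume.restrict (Set.Ioc 0 (2 * Real.pi))).prod
      (volume.restrict (Set.Ioc 0 (2 * Real.pi)))) := by
  obtain ⟨c, hc, hmax⟩ := exists_max_norm_ge hα hβ hαβγ
  obtain ⟨K, hK, hgap⟩ := exists_abs_norm_sub_ge hα hβ hαβγ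
  have hpi : (0 : ℝ) ≤ 2 * Real.pi := by positivity
  set t := critAngle α β γ
  have hmeas : AEStronglyMeasurable (fun x : ℝ × ℝ =>
      Complex.exp (x.1 * Complex.I) ^ p * (Complex.exp (x.2 * Complex.I) ^ q /
      (coefA α (Complex.exp (x.1 * Complex.I)) -
        Complex.exp (x.2 * Complex.I) * coefB α β γ (Complex.exp (x.1 * Complex.I)))))
      ((volume.restrict (Set.Ioc 0 (2 * Real.pi))).prod
        (volume.restrict (Set.Ioc 0 (2 * Real.pi)))) := by
    have h1 : Continuous fun x : ℝ × ℝ => Complex.exp (x.1 * Complex.I) ^ p :=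
      Continuous.zpow₀ (by fun_prop) p fun x => Or.inl (Complex.exp_ne_zero _)
    have h2 : Continuous fun x : ℝ × ℝ => Complex.exp (x.2 * Complex.I) ^ q :=
      Continuous.zpow₀ (by fun_prop) q fun x => Or.inl (Complex.exp_ne_zero _)
    have h3 : Continuous fun x : ℝ × ℝ => coefA α (Complex.exp (x.1 * Complex.I)) -
        Complex.exp (x.2 * Complex.I) * coefB α β γ (Complex.exp (x.1 * Complex.I)) := by
      unfold coefA coefB; fun_prop
    exact (h1.measurable.mul (h2.measurable.div h3.measurable)).aestronglyMeasurable
  rw [integrable_prod_iff hmeas]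
  constructor
  · filter_upwards [ae_restrict_of_ae (ae_absA_ne_absB hα hβ hαβγ)] with x hx
    exact ((continuous_inner_integrand hx q).intervalIntegrable 0 (2 * Real.pi)).1.const_mul _
  · set C := K ^ (-(1 / 3) : ℝ) * ((c / 2) ^ (-(2 / 3) : ℝ) * ∫ θ in 0..2 * Real.pi, sinPole θ) with hC
    have hC0 : 0 ≤ C := by
      have : 0 ≤ ∫ θ in 0..2 * Real.pi, sinPole θ :=
        intervalIntegral.integral_nonneg hpi fun θ _ => sinPole_nonneg θ
      positivity
    have hsub : ∀ ψ : ℝ, IntervalIntegrable (fun θ => sinPole (θ - ψ)) volume 0 (2 * Real.pi) := by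
      intro ψ
      have := (intervalIntegrable_sinPole (0 - ψ) (2 * Real.pi - ψ)).comp_sub_right ψ
      simpa only [sub_add_cancel] using this
    have hbound : Integrable (fun θ => C * (sinPole (θ - t) + sinPole (θ - -t)))
        (volume.restrict (Set.Ioc 0 (2 * Real.pi))) :=
      (((hsub t).add (hsub (-t))).const_mul C).1
    refine hbound.mono' hmeas.norm.integral_prod_right' ?_
    filter_upwards [ae_restrict_of_ae (ae_absA_ne_absB hα hβ hαβγ),
      ae_restrict_of_ae (ae_sin_half_sub_ne_zero t),
      ae_restrict_of_ae (ae_sin_half_sub_ne_zero (-t))] with θ h1 h2 h3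
    rw [Real.norm_of_nonneg (integral_nonneg fun _ => norm_nonneg _),
      ← intervalIntegral.integral_of_le hpi]
    simp only [norm_mul, norm_div, norm_exp_zpow, one_mul, one_div]
    refine (integral_inv_norm_sub_le hc (hmax θ) h1).trans ?_
    have g := hgap θ
    have s2 : 0 < |Real.sin ((θ - t) / 2)| := abs_pos.2 h2
    have s3 : 0 < |Real.sin ((θ - -t) / 2)| := abs_pos.2 h3
    have hI : 0 ≤ ∫ θ in 0..2 * Real.pi, sinPole θ :=
        intervalIntegral.integral_nonneg hpi fun θ _ => sinPole_nonneg θ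
    -- The gap is at least K s₂ s₃ for the two sines, and s₂^(-1/3) s₃^(-1/3) ≤ s₂^(-2/3) +
    -- s₃^(-2/3).
    have e : |absA α θ - absB α β γ θ| ^ (-(1 / 3) : ℝ) ≤
        K ^ (-(1 / 3) : ℝ) * (sinPole (θ - t) + sinPole (θ - -t)) := by
      refine (Real.rpow_le_rpow_of_nonpos (by positivity) g (by norm_num)).trans ?_
      rw [Real.mul_rpow hK.le (by positivity), Real.mul_rpow s2.le s3.le]
      gcongr
      have hsq : ∀ s : ℝ, 0 < s → s ^ (-(2 / 3) : ℝ) = (s ^ (-(1 / 3) : ℝ)) ^ 2 := by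
        intro s hs
        rw [← Real.rpow_natCast, ← Real.rpow_mul hs.le]; norm_num
      rw [sinPole, sinPole, hsq _ s2, hsq _ s3]
      nlinarith [sq_nonneg (|Real.sin ((θ - t) / 2)| ^ (-(1 / 3) : ℝ) -
        |Real.sin ((θ - -t) / 2)| ^ (-(1 / 3) : ℝ)),
        sq_nonneg (|Real.sin ((θ - t) / 2)| ^ (-(1 / 3) : ℝ)),
        sq_nonneg (|Real.sin ((θ - -t) / 2)| ^ (-(1 / 3) : ℝ))]
    calc _ ≤ K ^ (-(1 / 3) : ℝ) * (sinPole (θ - t) + sinPole (θ - -t)) *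
          ((c / 2) ^ (-(2 / 3) : ℝ) * ∫ θ in 0..2 * Real.pi, sinPole θ) := by
          refine mul_le_mul_of_nonneg_right e (by positivity)
      _ = _ := by rw [hC]; ring

theorem torusIntegrable_greenIntegrand (p q : ℤ) :
    TorusIntegrable (greenIntegrand α β γ p q) 0 1 := by
  have h := integrable_greenIntegrand hα hβ hαβγ p q
  rw [Measure.prod_restrict, Measure.restrict_congr_set
    (Measure.set_prod_ae_eq Ioc_ae_eq_Icc Ioc_ae_eq_Icc)] at h
  have h2 := ((volume_preserving_finTwoArrow ℝ).integrableOn_comp_preimage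
    (MeasurableEquiv.finTwoArrow (α := ℝ)).measurableEmbedding).2 h
  have hset : (MeasurableEquiv.finTwoArrow (α := ℝ)) ⁻¹'
      (Set.Icc 0 (2 * Real.pi) ×ˢ Set.Icc 0 (2 * Real.pi)) =
      Set.Icc (0 : Fin 2 → ℝ) (fun _ => 2 * Real.pi) := by
    ext θ
    simp [MeasurableEquiv.finTwoArrow, Pi.le_def, Fin.forall_fin_two]
  rw [hset] at h2
  have hunit : Continuous fun θ : Fin 2 → ℝ => (2 * Real.pi * Complex.I *
      Complex.exp (θ 0 * Complex.I))⁻¹ * (2 * Real.pi * Complex.I *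
      Complex.exp (θ 1 * Complex.I))⁻¹ := by
    have : (2 * Real.pi * Complex.I : ℂ) ≠ 0 := Complex.two_pi_I_ne_zero
    refine Continuous.mul (Continuous.inv₀ (by fun_prop) fun θ => ?_)
      (Continuous.inv₀ (by fun_prop) fun θ => ?_) <;>
    exact mul_ne_zero this (Complex.exp_ne_zero _)
  have h3 := h2.continuousOn_mul hunit.continuousOn isCompact_Icc
  unfold TorusIntegrable
  refine h3.congr_fun (fun θ _ => ?_) measurableSet_Icc
  simp only [greenIntegrand, torusMap_zero_one]
  rfl

theorem torusIntegral_greenIntegrand (p q : ℤ) :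
    torusIntegral (greenIntegrand α β γ p q) 0 1 = greenLimit α β γ p q := by
  rw [torusIntegral_succ (torusIntegrable_greenIntegrand hα hβ hαβγ p q), greenLimit,
    circleIntegral, ← intervalIntegral.integral_smul]
  refine intervalIntegral.integral_congr_ae ?_
  have hI : (2 * Real.pi * Complex.I : ℂ) ≠ 0 := Complex.two_pi_I_ne_zero
  have hpi : (Real.pi : ℂ) ≠ 0 := Complex.ofReal_ne_zero.2 Real.pi_ne_zero
  filter_upwards [ae_absA_ne_absB hα hβ hαβγ] with θ hθ _
  rw [torusIntegral_dim1, circleIntegral, ← integral_zpow_div_sub hθ q]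
  simp only [deriv_circleMap, Pi.zero_apply, Pi.one_apply, Function.comp_apply, circleMap_zero,
    Complex.ofReal_one, one_mul, greenIntegrand, Fin.cons_zero, Fin.cons_one]
  rw [Complex.real_smul, Complex.real_smul, smul_eq_mul]
  have he := Complex.exp_ne_zero (θ * Complex.I)
  have h1 : ∀ s : ℝ, (Complex.exp (s * Complex.I) * Complex.I) •
      ((2 * Real.pi * Complex.I * Complex.exp (θ * Complex.I))⁻¹ *
        (2 * Real.pi * Complex.I * Complex.exp (s * Complex.I))⁻¹ *
          (Complex.exp (θ * Complex.I) ^ p * (Complex.exp (s * Complex.I) ^ q /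
            (coefA α (Complex.exp (θ * Complex.I)) -
              Complex.exp (s * Complex.I) * coefB α β γ (Complex.exp (θ * Complex.I)))))) =
      ((2 * Real.pi * Complex.I * Complex.exp (θ * Complex.I))⁻¹ * (2 * Real.pi : ℂ)⁻¹ *
        Complex.exp (θ * Complex.I) ^ p) * (Complex.exp (s * Complex.I) ^ q /
            (coefA α (Complex.exp (θ * Complex.I)) -
              Complex.exp (s * Complex.I) * coefB α β γ (Complex.exp (θ * Complex.I)))) := by
    intro s
    have hs := Complex.exp_ne_zero (s * Complex.I)
    rw [smul_eq_mul]
    field_simp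
  simp only [h1]
  rw [intervalIntegral.integral_const_mul]
  generalize ∫ s in 0..2 * Real.pi, Complex.exp (s * Complex.I) ^ q /
    (coefA α (Complex.exp (θ * Complex.I)) -
      Complex.exp (s * Complex.I) * coefB α β γ (Complex.exp (θ * Complex.I))) = V
  push_cast
  field_simp

theorem torusIntegrable_kernelIntegrand (x y : MidEdge ℤ) :
    TorusIntegrable (kernelIntegrand α β γ x y) 0 1 := by
  have hT := torusIntegrable_greenIntegrand hα hβ hαβγ
  have hne : ∀ (θ : Fin 2 → ℝ) i, torusMap 0 1 θ i ≠ (0 : ℂ) := fun θ i => by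
    rw [torusMap_zero_one]; exact Complex.exp_ne_zero _
  have key : ∀ f : (Fin 2 → ℂ) → ℂ, TorusIntegrable f 0 1 → (∀ w : Fin 2 → ℂ, w 0 ≠ 0 → w 1 ≠ 0 →
      kernelIntegrand α β γ x y w = f w) → TorusIntegrable (kernelIntegrand α β γ x y) 0 1 := by
    intro f hf h
    exact IntegrableOn.congr_fun hf (fun θ _ => (h _ (hne θ 0) (hne θ 1)).symm) measurableSet_Icc
  refine key _ ?_ fun w h0 h1 => kernelIntegrand_eq x y h0 h1
  obtain ⟨c, a, b⟩ := x
  obtain ⟨c', a', b'⟩ := y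
  cases c <;> cases c' <;> dsimp only
  · exact (hT _ _).add ((hT _ _).const_mul _)
  · exact (hT _ _).const_mul _
  · exact (hT _ _).const_mul _
  · exact (hT _ _).add ((hT _ _).const_mul _)

/-- The arguments are exchanged: the exponents y - x make L the transpose of the inverse of the
Kasteleyn operator. -/
theorem kernelL_eq_inverseLimit (x y : MidEdge ℤ) :
    kernelL α β γ x y = inverseLimit α β γ y x := by
  have hT := torusIntegrable_greenIntegrand hα hβ hαβγ
  have hV := torusIntegral_greenIntegrand hα hβ hαβγ
  have hne : ∀ (θ : Fin 2 → ℝ) i, torusMap 0 1 θ i ≠ (0 : ℂ) := fun θ i => by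
    rw [torusMap_zero_one]; exact Complex.exp_ne_zero _
  have hc : ∀ (a : ℂ) (p q : ℤ), TorusIntegrable (fun w => a * greenIntegrand α β γ p q w) 0 1 :=
    fun a p q => (hT p q).const_mul a
  have key : ∀ f : (Fin 2 → ℂ) → ℂ, (∀ w : Fin 2 → ℂ, w 0 ≠ 0 → w 1 ≠ 0 →
      kernelIntegrand α β γ x y w = f w) → kernelL α β γ x y = torusIntegral f 0 1 := by
    intro f h
    unfold kernelL torusIntegral
    refine integral_congr_ae (Eventually.of_forall fun θ => ?_)
    simp only
    rw [h _ (hne θ 0) (hne θ 1)]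
  rw [key _ fun w h0 h1 => kernelIntegrand_eq x y h0 h1]
  obtain ⟨c, a, b⟩ := x
  obtain ⟨c', a', b'⟩ := y
  cases c <;> cases c' <;> dsimp only [inverseLimit]
  · rw [torusIntegral_add (hT _ _) (hc _ _ _), torusIntegral_const_mul, hV, hV]
  · rw [torusIntegral_const_mul, hV]
  · rw [torusIntegral_const_mul, hV]
  · rw [torusIntegral_add (hT _ _) (hc _ _ _), torusIntegral_const_mul, hV, hV]

end Kernel

/-! ### Conclusion. -/

theorem det_eq_zero_of_not_injective {α β γ : ℝ} {k : ℕ} {x y : Fin k → MidEdge ℤ}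
    (hx : ¬ Function.Injective x) :
    (Matrix.of fun i j => kernelL α β γ (x i) (y j)).det = 0 := by
  rw [Function.not_injective_iff] at hx
  obtain ⟨i, j, hij, hne⟩ := hx
  refine Matrix.det_zero_of_row_eq hne ?_
  ext l
  simp [hij]

theorem ofValues_eq_empty {k : ℕ} {x y : Fin k → MidEdge ℤ}
    (hxy : Function.Injective fun i => (x i, y i)) (hx : ¬ Function.Injective x) :
    (CylinderEvent.ofValues x y).1 = ∅ := by
  rw [Function.not_injective_iff] at hx
  obtain ⟨i, j, hij, hne⟩ := hx
  rw [Set.eq_empty_iff_forall_notMem]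
  intro ρ hρ
  refine hne (hxy (Prod.ext hij ?_))
  exact (hρ i).symm.trans ((congrArg ρ.1 hij).trans (hρ j))

theorem periodicLaw_univ {n : ℕ} [NeZero n] {α β γ : ℝ} (h : snakePartition n α β γ ≠ 0) :
    periodicLaw n α β γ Set.univ = 1 := by
  simp only [periodicLaw, Set.mem_univ, if_true, snakeBoltzmann, ← Finset.sum_div]
  exact div_self h

theorem theorem4p1 (α β γ : ℝ) (hα : 0 < α) (hβ : 0 < β) (hγ : 0 < γ)
    (hαβγ : 0 < γ ^ 2 - α * β) :
    (∀ (n : ℕ) [NeZero n], 2 ≤ n → 0 < snakePartition n α β γ) ∧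
    (∀ x y : MidEdge ℤ, TorusIntegrable (kernelIntegrand α β γ x y) 0 1) ∧
    ∃ P : SignedCylinderMeasure,
      (∀ E : CylinderEvent,
        Tendsto (fun n : ℕ => periodicLaw (n + 1) α β γ E.1) atTop (𝓝 (P.toFun E))) ∧
      P.toFun CylinderEvent.univ = 1 ∧
      ∀ (k : ℕ) (x y : Fin k → MidEdge ℤ),
        Function.Injective (fun i => (x i, y i)) →
        (∀ i, y i = x i ∨ y i = (x i).addE1 ∨ y i = (x i).addE2 ∨ y i = (x i).addE3) →
        ((P.toFun (CylinderEvent.ofValues x y) : ℝ) : ℂ) =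
          (∏ i, kasteleyn α β γ (x i) (y i)) *
            (Matrix.of fun i j => kernelL α β γ (x i) (y j)).det := by
  have hZ : ∀ (n : ℕ) [NeZero n], 2 ≤ n → 0 < snakePartition n α β γ := by
    intro n _ hn
    have : Fact (1 < n) := ⟨hn⟩
    exact snakePartition_pos_of_fact hα hβ hγ hαβγ
  refine ⟨hZ, torusIntegrable_kernelIntegrand hα hβ hαβγ, ?_⟩
  have hlim := fun (k : ℕ) (x y : Fin k → MidEdge ℤ) (hx : Function.Injective x) =>
    tendsto_periodicLaw_ofValues hα hβ hγ hαβγ hx y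
  obtain ⟨P, hP⟩ := exists_signedCylinderMeasure α β γ fun k x y hx =>
    ⟨_, (Complex.continuous_re.tendsto _).comp (hlim k x y hx)⟩
  refine ⟨P, hP, ?_, fun k x y hxy _ => ?_⟩
  · refine tendsto_nhds_unique (hP _) (tendsto_const_nhds.congr' ?_)
    filter_upwards [eventually_ge_atTop 1] with n hn
    exact (periodicLaw_univ (hZ (n + 1) (by omega)).ne').symm
  -- If a site occurs twice, distinctness of the pairs asks for two different values there, so the
  -- event is empty, while the determinant has two equal rows.
  · by_cases hx : Function.Injective x
    · have h1 := (Complex.continuous_ofReal.tendsto _).comp (hP (CylinderEvent.ofValues x y))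
      -- The minor of the inverse has rows indexed by y and columns by x; transposing matches the
      -- order of arguments in L.
      rw [tendsto_nhds_unique h1 (hlim k x y hx), correlationLimit, ← Matrix.det_transpose]
      congr 2
      ext i j
      exact (kernelL_eq_inverseLimit hα hβ hαβγ (x i) (y j)).symm
    · have h0 : P.toFun (CylinderEvent.ofValues x y) = 0 := by
        refine tendsto_nhds_unique (hP _) ?_
        rw [ofValues_eq_empty hxy hx]
        simp [periodicLaw]
      rw [h0, det_eq_zero_of_not_injective hx]
      simp
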